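/- Let $\mathcal O\subset\mathbb C$ be a bounded open set and let $Q=\begin{pmatrix}0&Q_{12}\\Q_{21}&0\end{pmatrix}$, where $Q_{12},Q_{21}\in L^\infty(\mathbb C)$ are complex-valued and vanish outside $\mathcal O$. Write $d\sigma$ for Lebesgue measure on $\mathbb C$, $I$ for the $2\times2$ identity matrix and $\overline A$ for the entrywise conjugate of a matrix $A$; limits, integrals and estimates of matrices are entrywise. For $\lambda,w\in\mathbb C$ consider the Lippmann--Schwinger equation for a bounded measurable matrix function $\mu(\cdot,\lambda,w):\mathbb C\to\mathbb C^{2\times2}$, $$\mu(z,\lambda,w)=I+\frac1\pi\int_{\mathbb C}\frac{e^{-i\,\mathrm{Im}[\lambda(z'-w)^2]/2}}{z-z'}\,Q(z')\,\overline{\mu(z',\lambda,w)}\,d\sigma_{z'}\quad(z\in\mathbb C),\qquad \mu\to I\ \text{ as } z\to\infty ,$$ and put $$T^\lambda[G](w)=\int_{\mathcal O}e^{-i\,\mathrm{Im}[\lambda(z-w)^2]/2}\,Q(z)G(z)\,d\sigma_z,\qquad h(\lambda,w)=\int_{\mathbb C}e^{-i\,\mathrm{Im}[\lambda(z-w)^2]/2}\,Q(z)\,\overline{\mu(z,\lambda,w)}\,d\sigma_z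 .$$ Then there is $R_0>0$ such that for all $w\in\mathbb C$ and all $\lambda$ with $|\lambda|>R_0$ the equation has exactly one bounded measurable solution $\mu(\cdot,\lambda,w)$, one has $h(\lambda,w)=T^\lambda[\overline\mu](w)=T^\lambda[I](w)+T^\lambda[\overline\mu-I](w)$, and the following holds. (1) For $R\ge R_0$ and $w\in\mathcal O$ the functions $|\lambda|^{-1}T^\lambda[\overline\mu-I](w)$ and $|\lambda|^{-1}T^\lambda[\mu-I](w)$ of $\lambda$ are integrable over $R<|\lambda|<2R$, and as $R\to\infty$ $$\sup_{w\in\mathcal O}\Big|\int_{R<|\lambda|<2R}|\lambda|^{-1}\,T^\lambda[\overline\mu-I](w)\,d\sigma_\lambda\Big|\to0,\qquad \sup_{w\in\mathcal O}\Big|\int_{R<|\lambda|<2R}|\lambda|^{-1}\,T^\lambda[\mu-I](w)\,d\sigma_\lambda\Big|\to0 .$$ (2) For every smooth $g:\mathbb C\to\mathbb C$ with compact support in $\mathcal O$, as $R\to\infty$, $$\int_{\mathcal O}g(w)\int_{R<|\lambda|<2R}|\lambda|^{-1}\,T^\lambda[I](w)\,d\sigma_\lambda\,d\sigma_w\to4\pi^2\ln2\int_{\mathcal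 O}g(z)Q(z)\,d\sigma_z .$$ (3) For every such $g$, the function $|\lambda|^{-1}\int_{\mathbb C}g(w)h(\lambda,w)\,d\sigma_w$ of $\lambda$ is integrable over $R<|\lambda|<2R$ for $R\ge R_0$, and $$\int_{\mathcal O}g(z)Q(z)\,d\sigma_z=\frac1{4\pi^2\ln2}\lim_{R\to\infty}\int_{R<|\lambda|<2R}|\lambda|^{-1}\int_{\mathbb C}g(w)\,h(\lambda,w)\,d\sigma_w\,d\sigma_\lambda .$$ -/

import Mathlib

open MeasureTheory Filter Topology
open scoped ContDiff ComplexConjugate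

noncomputable section

/-- `2 × 2` complex matrices. -/
abbrev Mat2 : Type := Matrix (Fin 2) (Fin 2) ℂ

/-- The off-diagonal matrix potential of the Dirac equation `∂̄ψ = Q ψ̄`. -/
def diracPotential (Q₁₂ Q₂₁ : ℂ → ℂ) (z : ℂ) : Mat2 :=
  !![0, Q₁₂ z; Q₂₁ z, 0]

/-- The oscillating factor `exp(-i Im[lam (z - w)²] / 2)`. -/
def oscPhase (lam w z : ℂ) : ℂ :=
  Complex.exp (-Complex.I * (((lam * (z - w) ^ 2).im / 2 : ℝ) : ℂ))

/-- Entrywise complex conjugate of a matrix (no transposition). -/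
def conjMat (A : Mat2) : Mat2 := A.map (fun c => conj c)

/-- `μ` (as a function of `z`, for fixed `lam` and `w`) is a bounded solution of the
Lippmann–Schwinger equation
`μ(z) = I + (1/π) ∫_ℂ Q(z') exp(-i Im[lam (z' - w)²]/2) / (z - z') * conj μ(z') dσ(z')`,
with `μ → I` at infinity. Then `ψ = μ exp(lam (z - w)² / 4)` solves `∂̄ψ = Q ψ̄`. -/
structure IsLippmannSchwingerSolution (Q : ℂ → Mat2) (lam w : ℂ) (μ : ℂ → Mat2) : Prop where
  measurable : ∀ i j, Measurable fun z => μ z i j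
  bounded : ∃ C : ℝ, ∀ z i j, ‖μ z i j‖ ≤ C
  equation : ∀ z i j, μ z i j = (1 : Mat2) i j +
    (1 / (Real.pi : ℂ)) * ∫ z' : ℂ, oscPhase lam w z' / (z - z') * (Q z' * conjMat (μ z')) i j
  tendsto_infty : ∀ i j, Tendsto (fun z => μ z i j) (cocompact ℂ) (𝓝 ((1 : Mat2) i j))

/-- The (matrix) scattering data
`h(lam, w) = ∫_ℂ exp(-i Im[lam (z - w)²]/2) Q(z) conj μ(z, lam, w) dσ(z)`;
`μ` has arguments `z`, `lam`, `w` in this order. -/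
def scatteringData (Q : ℂ → Mat2) (μ : ℂ → ℂ → ℂ → Mat2) (lam w : ℂ) : Mat2 :=
  Matrix.of fun i j => ∫ z : ℂ, oscPhase lam w z * (Q z * conjMat (μ z lam w)) i j

/-- The operator `T^lam[G](w) = ∫_O exp(-i Im[lam (z - w)²]/2) Q(z) G(z) dσ(z)`. -/
def scatteringOp (O : Set ℂ) (Q : ℂ → Mat2) (lam w : ℂ) (G : ℂ → Mat2) : Mat2 :=
  Matrix.of fun i j => ∫ z in O, oscPhase lam w z * (Q z * G z) i j

/-- The annulus `R < |lam| < 2R`. -/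
def annulus (R : ℝ) : Set ℂ := {lam | R < ‖lam‖ ∧ ‖lam‖ < 2 * R}

end

noncomputable section

open scoped ENNReal NNReal

/-! Everything rests on one kernel, `annulusKernel R ζ`, the Fourier transform of `‖lam‖⁻¹` cut off
to the annulus. In polar coordinates it is an integral of `J₀` over a dyadic interval, and the `t ^
(-1/2)` decay of `J₁` gives `C * R ^ (1 - β) * ‖ζ‖ ^ (-β)` for every `0 ≤ β ≤ 3/2`
(`exists_enorm_annulusKernel_le`). Averaging an oscillatory integral over the annulus replaces its
phase by this kernel (`integral_annulus_cexp_mul`).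

Main term. Here `ζ = (z - w)²`. By scaling, `annulusKernel R ((z - w)²)` is `R` times a fixed
function of `√R (z - w)`; that function decays cubically, so it is integrable on the plane and the
kernels form an approximate identity. Its mass `4π² log 2` is found by testing against a Gaussian
(`integral_annulusKernel_one_sq`).

Solvability. As `Q` is off-diagonal, each column of `μ` satisfies a scalar system `a = 1 + L_q (conj
b)`, `b = L_p (conj a)`, with `L` the operator `lsOp`. Eliminating `b` leaves `a = 1 + M a` with `M
= lsSq` complex linear. The kernel of `M` contains an oscillatory integral that tends to zero by a
Riemann-Lebesgue lemma for the quadratic phase, uniform in `w` (`tendsto_integral_oscPhase_mul`); so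
`M` halves sup norms once `‖lam‖` is large (`exists_isContractive`, `norm_lsSq_le`).

Remainder. Put `b₁ = L_p 1`. Then `a - 1 = L_q (conj b)` and `b = b₁ + L_p (conj (a - 1))`, and both
`a - 1` and `b` are dominated on the ball by `b₁` and its Riesz potential
(`exists_enorm_solution_le`). Applying `T` to `L g`, or to its conjugate, pairs `g` with an
oscillatory Cauchy potential. For `g` equal to `a - 1` or `b` up to conjugation, the pairing is
bounded by two squared `L²` norms, and a `T T*` argument shows that their averages are `O(R ^
(-1/4))` (`exists_lintegral_annulus_sq_oscPot_le`, `exists_lintegral_annulus_le_of_pairing`).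

Only the first-order terms `T[b₁]` and `T[conj b₁]` remain. In `T[b₁]` the phases add, the zeros of
`(z - w)² + (x - w)²` stay away from the Cauchy pole `z = x` unless `x = w`, and absolute values
suffice. In `T[conj b₁]` the phases subtract, `(z - w)² - (x - w)²` vanishes on `z = x`, and the
rate `β > 1` needed for decay would produce a singularity of order above two. The resulting
`skewKernel` is antisymmetric: for Lipschitz densities antisymmetrisation removes the Cauchy pole,
and an estimate by `L⁵` norms, uniform in `R`, passes to bounded densities by approximation
(`eventually_integral_mul_skewKernel_le`). -/

/-! ### Riesz kernels and their compositions over a ball. -/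

/-- The Riesz kernel `‖x‖ ^ (-s)`, with the value `∞` at the origin when `s > 0`. -/
def rieszKernel (s : ℝ) (x : ℂ) : ℝ≥0∞ := ‖x‖ₑ⁻¹ ^ s

@[fun_prop]
lemma measurable_rieszKernel (s : ℝ) : Measurable (rieszKernel s) := by
  unfold rieszKernel; fun_prop

lemma rieszKernel_one (x : ℂ) : rieszKernel 1 x = ‖x‖ₑ⁻¹ := by simp [rieszKernel]

lemma rieszKernel_neg (s : ℝ) (x : ℂ) : rieszKernel s (-x) = rieszKernel s x := by
  simp [rieszKernel]

lemma rieszKernel_sub_comm (s : ℝ) (x y : ℂ) : rieszKernel s (x - y) = rieszKernel s (y - x) := by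
  rw [← rieszKernel_neg, neg_sub]

lemma rieszKernel_mul (s : ℝ) (hs : 0 ≤ s) (x y : ℂ) :
    rieszKernel s (x * y) = rieszKernel s x * rieszKernel s y := by
  unfold rieszKernel
  rw [enorm_mul, ENNReal.mul_inv (by simp) (by simp), ENNReal.mul_rpow_of_nonneg _ _ hs]

lemma rieszKernel_add {s t : ℝ} (hs : 0 ≤ s) (ht : 0 ≤ t) (x : ℂ) :
    rieszKernel (s + t) x = rieszKernel s x * rieszKernel t x := by
  unfold rieszKernel
  rw [ENNReal.rpow_add_of_nonneg _ _ hs ht]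

lemma enorm_inv_le_rieszKernel (x : ℂ) : ‖x⁻¹‖ₑ ≤ rieszKernel 1 x := by
  rw [rieszKernel_one]
  by_cases hx : x = 0
  · simp [hx]
  · rw [enorm_inv hx]

lemma enorm_div_sub_le (e x : ℂ) (he : ‖e‖ ≤ 1) : ‖e / x‖ₑ ≤ rieszKernel 1 x := by
  rw [div_eq_mul_inv, enorm_mul]
  calc _ ≤ 1 * rieszKernel 1 x := by
        gcongr
        · rw [← ofReal_norm]; exact ENNReal.ofReal_le_one.2 he
        · exact enorm_inv_le_rieszKernel x
    _ = _ := one_mul _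

/-- The longer of `x` and `y` has length at least `‖d‖ / 2`, so `κ` of its powers can be traded for
`rieszKernel κ d`. The powers left over are dominated by giving all of them to one of the two
factors. -/
lemma rieszKernel_mul_le {s t κ : ℝ} (hκ : 0 ≤ κ) (hs : κ ≤ s) (ht : κ ≤ t) (x y d : ℂ)
    (hd : ‖d‖ ≤ ‖x‖ + ‖y‖) :
    rieszKernel s x * rieszKernel t y ≤
      2 ^ κ * rieszKernel κ d * (rieszKernel (s + t - κ) x + rieszKernel (s + t - κ) y) := by
  have hd' : ‖d‖ₑ ≤ ‖x‖ₑ + ‖y‖ₑ := by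
    rw [← ofReal_norm, ← ofReal_norm, ← ofReal_norm, ← ENNReal.ofReal_add (by positivity)
      (by positivity)]
    exact ENNReal.ofReal_le_ofReal hd
  have young : ∀ a b : ℝ, 0 ≤ a → 0 ≤ b → ∀ X Y : ℝ≥0∞, X ^ a * Y ^ b ≤ X ^ (a + b) + Y ^ (a + b) := by
    intro a b ha hb X Y
    rw [ENNReal.rpow_add_of_nonneg _ _ ha hb, ENNReal.rpow_add_of_nonneg _ _ ha hb]
    rcases le_total X Y with h | h
    · exact le_add_left (mul_le_mul_left (ENNReal.rpow_le_rpow h ha) _)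
    · exact le_add_right (mul_le_mul_right (ENNReal.rpow_le_rpow h hb) _)
  have key : ∀ u : ℂ, ‖d‖ₑ ≤ 2 * ‖u‖ₑ → rieszKernel κ u ≤ 2 ^ κ * rieszKernel κ d := by
    intro u hu
    unfold rieszKernel
    rw [← ENNReal.mul_rpow_of_nonneg _ _ hκ]
    refine ENNReal.rpow_le_rpow ?_ hκ
    have := ENNReal.inv_le_inv.2 hu
    rw [ENNReal.mul_inv (by simp) (by simp)] at this
    calc ‖u‖ₑ⁻¹ = 2 * (2⁻¹ * ‖u‖ₑ⁻¹) := by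
          rw [← mul_assoc, ENNReal.mul_inv_cancel (by simp) (by simp), one_mul]
      _ ≤ _ := by gcongr
  rcases le_total ‖x‖ₑ ‖y‖ₑ with h | h
  · have h1 := key y (hd'.trans (by rw [two_mul]; gcongr))
    calc rieszKernel s x * rieszKernel t y
        = rieszKernel κ y * (rieszKernel s x * rieszKernel (t - κ) y) := by
          conv_lhs => rw [show t = κ + (t - κ) by ring, rieszKernel_add hκ (by linarith)]
          ring
      _ ≤ (2 ^ κ * rieszKernel κ d) *
          (rieszKernel (s + (t - κ)) x + rieszKernel (s + (t - κ)) y) := by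
          gcongr
          exact young _ _ (by linarith) (by linarith) _ _
      _ = _ := by rw [add_sub_assoc]
  · have h1 := key x (hd'.trans (by rw [two_mul]; gcongr))
    calc rieszKernel s x * rieszKernel t y
        = rieszKernel κ x * (rieszKernel (s - κ) x * rieszKernel t y) := by
          conv_lhs => rw [show s = κ + (s - κ) by ring, rieszKernel_add hκ (by linarith)]
          ring
      _ ≤ (2 ^ κ * rieszKernel κ d) *
          (rieszKernel ((s - κ) + t) x + rieszKernel ((s - κ) + t) y) := by
          gcongr
          exact young _ _ (by linarith) (by linarith) _ _
      _ = _ := by rw [sub_add_eq_add_sub]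

lemma setLIntegral_rieszKernel_ball_lt_top {s : ℝ} (hs : s < 2) :
    ∫⁻ x in Metric.ball (0 : ℂ) 1, rieszKernel s x < ⊤ := by
  have h : IntegrableOn (fun x : ℂ => ‖x‖ ^ (-s)) (Metric.ball 0 1) := by
    refine integrableOn_ball_of_norm_le_rpow (C := 1) (α := s) ?_ ?_ ?_ ?_
    · simp
    · simpa using hs
    · refine Eventually.of_forall fun x => ?_
      rw [Real.norm_of_nonneg (by positivity), one_mul]
    · exact (measurable_norm.pow_const _).aestronglyMeasurable
  refine lt_of_le_of_lt (le_of_eq ?_) h.2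
  refine lintegral_congr_ae (ae_restrict_of_ae ?_)
  have h0 : ∀ᵐ x : ℂ, x ≠ 0 := by simp [ae_iff, measure_singleton]
  filter_upwards [h0] with x hx
  rw [← ofReal_norm, Real.norm_of_nonneg (by positivity), rieszKernel, ← ofReal_norm,
    ← ENNReal.ofReal_inv_of_pos (by positivity), ENNReal.ofReal_rpow_of_pos (by positivity),
    Real.inv_rpow (by positivity), Real.rpow_neg (by positivity)]

/-- At distance at least one from the pole the kernel is at most `1`, which costs the volume of the
ball. What is left is a translate of one finite integral, hence the uniformity in `a`. -/
lemma exists_setLIntegral_rieszKernel_le (ρ : ℝ) {s : ℝ} (hs0 : 0 ≤ s) (hs : s < 2) :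
    ∃ C : ℝ≥0, ∀ a : ℂ, ∫⁻ z in Metric.ball (0 : ℂ) ρ, rieszKernel s (z - a) ≤ C := by
  have h1 := setLIntegral_rieszKernel_ball_lt_top hs
  have h2 : volume (Metric.ball (0 : ℂ) ρ) < ⊤ := measure_ball_lt_top
  refine ⟨(volume (Metric.ball (0 : ℂ) ρ) + ∫⁻ x in Metric.ball (0 : ℂ) 1, rieszKernel s x).toNNReal,
    fun a => ?_⟩
  rw [ENNReal.coe_toNNReal (ENNReal.add_lt_top.2 ⟨h2, h1⟩).ne]
  have pt : ∀ x : ℂ, rieszKernel s x ≤ 1 + (Metric.ball (0 : ℂ) 1).indicator (rieszKernel s) x := by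
    intro x
    by_cases hx : x ∈ Metric.ball (0 : ℂ) 1
    · rw [Set.indicator_of_mem hx]; exact le_add_self
    · rw [Set.indicator_of_notMem hx, add_zero]
      refine ENNReal.rpow_le_one ?_ hs0
      rw [ENNReal.inv_le_one, ← ofReal_norm]
      exact ENNReal.one_le_ofReal.2 (by simpa using hx)
  calc _ ≤ ∫⁻ z in Metric.ball (0 : ℂ) ρ,
        (1 + (Metric.ball (0 : ℂ) 1).indicator (rieszKernel s) (z - a)) :=
        lintegral_mono fun z => pt _
    _ = volume (Metric.ball (0 : ℂ) ρ) + ∫⁻ z in Metric.ball (0 : ℂ) ρ,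
        (Metric.ball (0 : ℂ) 1).indicator (rieszKernel s) (z - a) := by
        rw [lintegral_add_left measurable_const]; simp
    _ ≤ volume (Metric.ball (0 : ℂ) ρ) + ∫⁻ z,
        (Metric.ball (0 : ℂ) 1).indicator (rieszKernel s) (z - a) := by
        gcongr; exact Measure.restrict_le_self
    _ = _ := by
        rw [lintegral_sub_right_eq_self (fun z => (Metric.ball (0 : ℂ) 1).indicator (rieszKernel s) z)
          a, lintegral_indicator measurableSet_ball]

/-- The composition rule behind all later kernel estimates. The order `κ` is free: a larger value
worsens the singularity in `a - b` but relaxes the integrability condition `s + t - κ < 2`. -/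
lemma exists_setLIntegral_rieszKernel_mul_le (ρ : ℝ) {s t κ : ℝ} (hκ : 0 ≤ κ) (hs : κ ≤ s)
    (ht : κ ≤ t) (hst : s + t - κ < 2) :
    ∃ C : ℝ≥0, ∀ a b : ℂ, ∫⁻ z in Metric.ball (0 : ℂ) ρ, rieszKernel s (z - a) * rieszKernel t (z - b)
      ≤ C * rieszKernel κ (a - b) := by
  obtain ⟨C, hC⟩ := exists_setLIntegral_rieszKernel_le ρ (s := s + t - κ) (by linarith) hst
  refine ⟨2 ^ κ * (C + C), fun a b => ?_⟩
  calc _ ≤ ∫⁻ z in Metric.ball (0 : ℂ) ρ, 2 ^ κ * rieszKernel κ (a - b) *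
        (rieszKernel (s + t - κ) (z - a) + rieszKernel (s + t - κ) (z - b)) := by
        refine lintegral_mono fun z => rieszKernel_mul_le hκ hs ht _ _ _ ?_
        have : a - b = (z - b) - (z - a) := by ring
        rw [this, add_comm]; exact norm_sub_le _ _
    _ = 2 ^ κ * rieszKernel κ (a - b) * ((∫⁻ z in Metric.ball (0 : ℂ) ρ, rieszKernel (s + t - κ) (z - a))
        + ∫⁻ z in Metric.ball (0 : ℂ) ρ, rieszKernel (s + t - κ) (z - b)) := by
        rw [lintegral_const_mul _ (by fun_prop), lintegral_add_left (by fun_prop)]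
    _ ≤ 2 ^ κ * rieszKernel κ (a - b) * (C + C) := by gcongr <;> apply hC
    _ = _ := by
        rw [ENNReal.coe_mul, ENNReal.coe_add, ENNReal.coe_rpow_of_nonneg _ hκ]
        push_cast; ring

/-! ### The Bessel functions `J₀`, `J₁` and their decay. -/

/-- `2π` times the Bessel function `J₀`. -/
def besselZero (t : ℝ) : ℝ := ∫ θ in (-Real.pi)..Real.pi, Real.cos (t * Real.sin θ)

/-- `2π` times the Bessel function `J₁`. -/
def besselOne (t : ℝ) : ℝ :=
  ∫ θ in (-Real.pi)..Real.pi, Real.sin θ * Real.sin (t * Real.sin θ)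

lemma hasDerivAt_intervalIntegral_of_bounded {F F' : ℝ → ℝ → ℝ} {a b : ℝ} (t : ℝ)
    (hF : ∀ t, Continuous (F t)) (hF' : ∀ t, Continuous (F' t))
    (hb : ∀ t θ, ‖F' t θ‖ ≤ 1) (hd : ∀ t θ, HasDerivAt (fun t => F t θ) (F' t θ) t) :
    HasDerivAt (fun t => ∫ θ in a..b, F t θ) (∫ θ in a..b, F' t θ) t := by
  refine (intervalIntegral.hasDerivAt_integral_of_dominated_loc_of_deriv_le (bound := fun _ => 1)
    (Filter.univ_mem) ?_ ?_ ?_ ?_ ?_ ?_).2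
  · exact Eventually.of_forall fun t => (hF t).aestronglyMeasurable
  · exact (hF t).intervalIntegrable _ _
  · exact (hF' t).aestronglyMeasurable
  · exact Eventually.of_forall fun θ _ x _ => hb x θ
  · exact intervalIntegrable_const
  · exact Eventually.of_forall fun θ _ x _ => hd x θ

lemma hasDerivAt_besselZero (t : ℝ) : HasDerivAt besselZero (-besselOne t) t := by
  have := hasDerivAt_intervalIntegral_of_bounded (a := -Real.pi) (b := Real.pi)
    (F := fun t θ => Real.cos (t * Real.sin θ))
    (F' := fun t θ => -(Real.sin θ * Real.sin (t * Real.sin θ))) t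
    (fun t => by fun_prop) (fun t => by fun_prop) (fun t θ => by
      rw [norm_neg, norm_mul]
      exact mul_le_one₀ (Real.abs_sin_le_one _) (norm_nonneg _) (Real.abs_sin_le_one _))
    (fun t θ => by
      have := ((hasDerivAt_id t).mul_const (Real.sin θ)).cos
      simp only [id] at this
      convert this using 1; ring)
  rw [intervalIntegral.integral_neg] at this
  exact this

/-- Integration by parts: the total derivative of `-cos θ * sin (t * sin θ)` has vanishing boundary
values because `sin (±π) = 0`. The formula identifies the quotient `besselOne t / t` in the Bessel
recurrence. -/
lemma besselOne_eq (t : ℝ) : besselOne t =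
    t * ∫ θ in (-Real.pi)..Real.pi, Real.cos θ ^ 2 * Real.cos (t * Real.sin θ) := by
  have h := intervalIntegral.integral_eq_sub_of_hasDerivAt (a := -Real.pi) (b := Real.pi)
    (f := fun θ => -(Real.cos θ * Real.sin (t * Real.sin θ)))
    (f' := fun θ => Real.sin θ * Real.sin (t * Real.sin θ) -
      t * (Real.cos θ ^ 2 * Real.cos (t * Real.sin θ)))
    (fun θ _ => by
      have := ((Real.hasDerivAt_cos θ).mul ((Real.hasDerivAt_sin θ).const_mul t).sin).neg
      exact this.congr_deriv (by ring))
    (Continuous.intervalIntegrable (by fun_prop) _ _)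
  rw [intervalIntegral.integral_sub (Continuous.intervalIntegrable (by fun_prop) _ _)
    (Continuous.intervalIntegrable (by fun_prop) _ _), intervalIntegral.integral_const_mul] at h
  simp only [Real.sin_pi, Real.sin_neg, mul_zero, neg_zero, Real.sin_zero, sub_zero] at h
  unfold besselOne
  linarith

lemma hasDerivAt_besselOne {t : ℝ} (ht : t ≠ 0) :
    HasDerivAt besselOne (besselZero t - besselOne t / t) t := by
  have := hasDerivAt_intervalIntegral_of_bounded (a := -Real.pi) (b := Real.pi)
    (F := fun t θ => Real.sin θ * Real.sin (t * Real.sin θ))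
    (F' := fun t θ => Real.cos (t * Real.sin θ) - Real.cos θ ^ 2 * Real.cos (t * Real.sin θ)) t
    (fun t => by fun_prop) (fun t => by fun_prop) (fun t θ => by
      have : Real.cos (t * Real.sin θ) - Real.cos θ ^ 2 * Real.cos (t * Real.sin θ) =
        Real.sin θ ^ 2 * Real.cos (t * Real.sin θ) := by rw [Real.sin_sq]; ring
      rw [this, norm_mul, norm_pow]
      exact mul_le_one₀ (pow_le_one₀ (norm_nonneg _) (Real.abs_sin_le_one _)) (norm_nonneg _)
        (Real.abs_cos_le_one _))
    (fun t θ => by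
      have := (((hasDerivAt_id t).mul_const (Real.sin θ)).sin).const_mul (Real.sin θ)
      simp only [id] at this
      refine this.congr_deriv ?_
      linear_combination Real.cos (t * Real.sin θ) * Real.sin_sq θ)
  rw [intervalIntegral.integral_sub (Continuous.intervalIntegrable (by fun_prop) _ _)
    (Continuous.intervalIntegrable (by fun_prop) _ _)] at this
  refine HasDerivAt.congr_deriv this ?_
  rw [besselOne_eq, mul_div_cancel_left₀ _ ht]
  rfl

lemma continuous_besselZero : Continuous besselZero :=
  continuous_iff_continuousAt.2 fun t => (hasDerivAt_besselZero t).continuousAt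

lemma abs_besselZero_le (t : ℝ) : |besselZero t| ≤ 2 * Real.pi := by
  have := intervalIntegral.norm_integral_le_of_norm_le_const (a := -Real.pi) (b := Real.pi) (C := 1)
    (f := fun θ => Real.cos (t * Real.sin θ)) (fun θ _ => Real.abs_cos_le_one _)
  rw [one_mul, abs_of_nonneg (by linarith [Real.pi_pos])] at this
  calc _ ≤ _ := this
    _ = _ := by ring

/-- A nonincreasing energy for the Bessel equation. -/
def besselEnergy (t : ℝ) : ℝ :=
  t * (besselZero t ^ 2 + besselOne t ^ 2) - besselZero t * besselOne t + besselZero t ^ 2 / (2 * t)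

lemma antitoneOn_besselEnergy : AntitoneOn besselEnergy (Set.Ici 1) := by
  -- The two corrections to `t * (J₀² + J₁²)` are chosen so that the indefinite terms produced by
  -- the recurrences cancel, leaving only a negative square.
  have hd : ∀ t : ℝ, 1 ≤ t → HasDerivAt besselEnergy (-(besselZero t ^ 2 / (2 * t ^ 2))) t := by
    intro t ht
    have ht0 : t ≠ 0 := by positivity
    have h0 := hasDerivAt_besselZero t
    have h1 := hasDerivAt_besselOne ht0
    have := (((hasDerivAt_id t).mul ((h0.pow 2).add (h1.pow 2))).sub (h0.mul h1)).add
      ((h0.pow 2).div ((hasDerivAt_id t).const_mul 2) (by simpa using ht0))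
    refine HasDerivAt.congr_deriv this ?_
    simp only [id, Pi.add_apply, Pi.pow_apply]
    field_simp
    ring
  refine antitoneOn_of_deriv_nonpos (convex_Ici 1)
    (fun t ht => (hd t ht).continuousAt.continuousWithinAt) ?_ ?_
  · intro t ht
    rw [interior_Ici] at ht
    exact (hd t (le_of_lt ht)).differentiableAt.differentiableWithinAt
  · intro t ht
    rw [interior_Ici] at ht
    rw [(hd t (le_of_lt ht)).deriv]
    have : 0 ≤ besselZero t ^ 2 / (2 * t ^ 2) := by positivity
    linarith

/-- For `t ≥ 1` the mixed term `J₀ * J₁` costs at most half of `t * (J₀² + J₁²)`, so the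
nonincreasing energy controls `t * J₁²`. -/
lemma exists_abs_besselOne_le :
    ∃ C : ℝ, 0 ≤ C ∧ ∀ t : ℝ, 1 ≤ t → |besselOne t| ≤ C * t ^ (-(1 / 2) : ℝ) := by
  refine ⟨√(2 * besselEnergy 1), Real.sqrt_nonneg _, fun t ht => ?_⟩
  have h : besselEnergy t ≤ besselEnergy 1 :=
    antitoneOn_besselEnergy (Set.self_mem_Ici) ht ht
  have h2 : t * besselOne t ^ 2 ≤ 2 * besselEnergy 1 := by
    have e1 : 0 ≤ besselZero t ^ 2 / (2 * t) := by positivity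
    have : t / 2 * (besselZero t ^ 2 + besselOne t ^ 2) ≤ besselEnergy t := by
      unfold besselEnergy
      nlinarith [sq_nonneg (besselZero t - besselOne t), sq_nonneg (besselZero t),
        sq_nonneg (besselOne t)]
    nlinarith [sq_nonneg (besselZero t)]
  have ht0 : 0 < t := by linarith
  rw [Real.rpow_neg ht0.le, ← Real.sqrt_eq_rpow, ← div_eq_mul_inv, ← Real.sqrt_div' _ ht0.le]
  refine Real.abs_le_sqrt ?_
  rw [le_div_iff₀ ht0]; linarith

/-- Since `J₀ = J₁' + J₁ / t`, the integral consists of two boundary values of `J₁` and the integral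
of `J₁ / t` over an interval of length `s`. Each of the three pieces has the decay of `J₁`. -/
lemma exists_abs_integral_besselZero_le :
    ∃ C : ℝ, 0 ≤ C ∧ ∀ s : ℝ, 1 ≤ s → |∫ t in s..2 * s, besselZero t| ≤ C * s ^ (-(1 / 2) : ℝ) := by
  obtain ⟨C, hC0, hC⟩ := exists_abs_besselOne_le
  refine ⟨3 * C, by positivity, fun s hs => ?_⟩
  have hs0 : 0 < s := by linarith
  have hcont : ContinuousOn (fun t => besselOne t / t) (Set.uIcc s (2 * s)) := by
    intro t ht
    rw [Set.uIcc_of_le (by linarith)] at ht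
    have ht0 : t ≠ 0 := (hs0.trans_le ht.1).ne'
    exact ((hasDerivAt_besselOne ht0).continuousAt.div continuousAt_id ht0).continuousWithinAt
  have i1 := continuous_besselZero.intervalIntegrable (μ := volume) s (2 * s)
  have i2 := hcont.intervalIntegrable (μ := volume)
  have h := intervalIntegral.integral_eq_sub_of_hasDerivAt (a := s) (b := 2 * s)
    (f := besselOne) (f' := fun t => besselZero t - besselOne t / t)
    (fun t ht => by
      rw [Set.uIcc_of_le (by linarith)] at ht
      exact hasDerivAt_besselOne (hs0.trans_le ht.1).ne') (i1.sub i2)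
  rw [intervalIntegral.integral_sub i1 i2] at h
  have hmono : ∀ t, s ≤ t → |besselOne t| ≤ C * s ^ (-(1 / 2) : ℝ) := fun t ht =>
    (hC t (hs.trans ht)).trans (mul_le_mul_of_nonneg_left
      (Real.rpow_le_rpow_of_nonpos hs0 ht (by norm_num)) hC0)
  have b : |∫ t in s..2 * s, besselOne t / t| ≤ C * s ^ (-(1 / 2) : ℝ) := by
    have := intervalIntegral.norm_integral_le_of_norm_le_const (a := s) (b := 2 * s)
      (C := C * s ^ (-(1 / 2) : ℝ) / s) (f := fun t => besselOne t / t) (fun t ht => by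
        rw [Set.uIoc_of_le (by linarith)] at ht
        rw [norm_div, Real.norm_eq_abs, Real.norm_of_nonneg (hs0.le.trans ht.1.le)]
        exact div_le_div₀ (by positivity) (hmono t ht.1.le) hs0 ht.1.le)
    rwa [show 2 * s - s = s by ring, abs_of_pos hs0, div_mul_cancel₀ _ hs0.ne'] at this
  have b1 := hmono (2 * s) (by linarith)
  have b2 := hmono s le_rfl
  rw [abs_le] at *
  constructor <;> linarith [b.1, b.2, b1.1, b1.2, b2.1, b2.2]

/-! ### The annulus kernel: Bessel formula, scaling, decay. -/

/-- The Fourier transform of `‖lam‖⁻¹` restricted to an annulus. -/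
def annulusKernel (R : ℝ) (ζ : ℂ) : ℂ :=
  ∫ lam in annulus R, ((‖lam‖⁻¹ : ℝ) : ℂ) * Complex.exp (-Complex.I * (((lam * ζ).im / 2 : ℝ) : ℂ))

lemma isOpen_annulus (R : ℝ) : IsOpen (annulus R) :=
  (isOpen_lt continuous_const continuous_norm).inter (isOpen_lt continuous_norm continuous_const)

lemma measurableSet_annulus (R : ℝ) : MeasurableSet (annulus R) := (isOpen_annulus R).measurableSet

lemma norm_cexp_neg_I_mul (x : ℝ) : ‖Complex.exp (-Complex.I * (x : ℂ))‖ = 1 := by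
  rw [show -Complex.I * (x : ℂ) = ((-x : ℝ) : ℂ) * Complex.I by push_cast; ring]
  exact Complex.norm_exp_ofReal_mul_I _

/-- Periodicity removes the shift by `α`, and the imaginary part is odd in `θ`. -/
lemma integral_cexp_sin_eq (x α : ℝ) :
    ∫ θ in (-Real.pi)..Real.pi, Complex.exp (-Complex.I * ((x * Real.sin (θ + α) : ℝ) : ℂ)) =
      (besselZero x : ℂ) := by
  have hper : Function.Periodic (fun θ : ℝ => Complex.exp (-Complex.I * ((x * Real.sin θ : ℝ) : ℂ)))
      (2 * Real.pi) := fun θ => by simp only [Real.sin_add_two_pi]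
  rw [intervalIntegral.integral_comp_add_right
    (fun θ : ℝ => Complex.exp (-Complex.I * ((x * Real.sin θ : ℝ) : ℂ)))]
  have := hper.intervalIntegral_add_eq (-Real.pi + α) (-Real.pi)
  rw [show -Real.pi + α + 2 * Real.pi = Real.pi + α by ring,
    show -Real.pi + 2 * Real.pi = Real.pi by ring] at this
  rw [this]
  have e : ∀ θ : ℝ, Complex.exp (-Complex.I * ((x * Real.sin θ : ℝ) : ℂ)) =
      ((Real.cos (x * Real.sin θ) : ℝ) : ℂ) - Complex.I * ((Real.sin (x * Real.sin θ) : ℝ) : ℂ) := by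
    intro θ
    rw [show -Complex.I * ((x * Real.sin θ : ℝ) : ℂ) = ((-(x * Real.sin θ) : ℝ) : ℂ) * Complex.I by
      push_cast; ring, Complex.exp_mul_I, ← Complex.ofReal_cos, ← Complex.ofReal_sin, Real.cos_neg,
      Real.sin_neg]
    push_cast; ring
  simp_rw [e]
  rw [intervalIntegral.integral_sub (Continuous.intervalIntegrable (by fun_prop) _ _)
    (Continuous.intervalIntegrable (by fun_prop) _ _), intervalIntegral.integral_const_mul,
    intervalIntegral.integral_ofReal, intervalIntegral.integral_ofReal]
  have odd : ∫ θ in (-Real.pi)..Real.pi, Real.sin (x * Real.sin θ) = 0 := by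
    have := intervalIntegral.integral_comp_neg (a := -Real.pi) (b := Real.pi)
      (fun θ => Real.sin (x * Real.sin θ))
    simp only [Real.sin_neg, mul_neg, neg_neg, intervalIntegral.integral_neg] at this
    linarith
  rw [odd]
  simp [besselZero]

/-- In polar coordinates the Jacobian cancels the weight `‖lam‖⁻¹`, and the argument of `ζ` only
shifts the angle. -/
lemma annulusKernel_eq {R : ℝ} (hR : 0 < R) (ζ : ℂ) :
    annulusKernel R ζ = ((∫ r in R..2 * R, besselZero (r * (‖ζ‖ / 2)) : ℝ) : ℂ) := by
  set f : ℂ → ℂ := fun lam => ((‖lam‖⁻¹ : ℝ) : ℂ) *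
    Complex.exp (-Complex.I * (((lam * ζ).im / 2 : ℝ) : ℂ)) with hf
  set g : ℝ × ℝ → ℂ := fun p => Complex.exp (-Complex.I *
    ((p.1 * (‖ζ‖ / 2) * Real.sin (p.2 + ζ.arg) : ℝ) : ℂ)) with hg
  have hgc : Continuous g := by rw [hg]; fun_prop
  have h1 : annulusKernel R ζ = ∫ p in Set.Ioo R (2 * R) ×ˢ Set.Ioo (-Real.pi) Real.pi, g p := by
    rw [annulusKernel, ← integral_indicator (measurableSet_annulus R),
      ← Complex.integral_comp_polarCoord_symm,
      ← integral_indicator polarCoord.open_target.measurableSet,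
      ← integral_indicator (measurableSet_Ioo.prod measurableSet_Ioo)]
    congr 1
    ext p
    by_cases hp : p ∈ polarCoord.target
    · have hp' := hp
      rw [polarCoord_target] at hp'
      have hp1 : 0 < p.1 := hp'.1
      rw [Set.indicator_of_mem hp]
      have hn := Complex.norm_polarCoord_symm p
      rw [abs_of_pos hp1] at hn
      by_cases hq : p.1 ∈ Set.Ioo R (2 * R)
      · have hm : Complex.polarCoord.symm p ∈ annulus R := by
          simp only [annulus, Set.mem_ofPred_eq, hn]; exact hq
        rw [Set.indicator_of_mem hm, Set.indicator_of_mem (show p ∈ Set.Ioo R (2 * R) ×ˢ Set.Ioo (-Real.pi) Real.pi from ⟨hq, hp'.2⟩), hn]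
        have him : (Complex.polarCoord.symm p * ζ).im = p.1 * (‖ζ‖ * Real.sin (p.2 + ζ.arg)) := by
          rw [Complex.polarCoord_symm_apply, mul_assoc, Complex.im_ofReal_mul, Real.sin_add]
          congr 1
          simp only [Complex.mul_im, Complex.add_re, Complex.add_im, Complex.ofReal_re,
            Complex.ofReal_im, Complex.mul_re, Complex.I_re, Complex.I_im]
          have a := Complex.norm_mul_cos_arg ζ
          have b := Complex.norm_mul_sin_arg ζ
          rw [← a, ← b]
          simp only [Complex.norm_mul_cos_arg, Complex.norm_mul_sin_arg]
          rw [← a, ← b]; ring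
        rw [him, Complex.real_smul, ← mul_assoc, ← Complex.ofReal_mul, mul_inv_cancel₀ hp1.ne',
          Complex.ofReal_one, one_mul, hg]
        congr 4; ring
      · have hm : Complex.polarCoord.symm p ∉ annulus R := by
          simp only [annulus, Set.mem_ofPred_eq, hn]; exact hq
        rw [Set.indicator_of_notMem hm, Set.indicator_of_notMem (fun h => hq h.1), smul_zero]
    · rw [Set.indicator_of_notMem hp, Set.indicator_of_notMem]
      intro h
      apply hp
      rw [polarCoord_target]
      exact ⟨hR.trans h.1.1, h.2⟩
  have hint : IntegrableOn g (Set.Ioo R (2 * R) ×ˢ Set.Ioo (-Real.pi) Real.pi)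
      ((volume : Measure ℝ).prod volume) :=
    (hgc.continuousOn.integrableOn_compact (isCompact_Icc.prod isCompact_Icc)).mono_set
      (Set.prod_mono Set.Ioo_subset_Icc_self Set.Ioo_subset_Icc_self)
  rw [h1, Measure.volume_eq_prod, setIntegral_prod _ hint, ← intervalIntegral.integral_ofReal,
    intervalIntegral.integral_of_le (by linarith), integral_Ioc_eq_integral_Ioo]
  refine setIntegral_congr_fun measurableSet_Ioo fun r _ => ?_
  rw [← integral_cexp_sin_eq _ ζ.arg, intervalIntegral.integral_of_le (by linarith [Real.pi_pos]),
    integral_Ioc_eq_integral_Ioo]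

lemma annulusKernel_scale {R : ℝ} (hR : 0 < R) (ζ : ℂ) :
    annulusKernel R ζ = R * annulusKernel 1 (R * ζ) := by
  rw [annulusKernel_eq hR, annulusKernel_eq one_pos]
  have := intervalIntegral.mul_integral_comp_mul_left (a := 1) (b := 2 * 1) (c := R)
    (f := fun r => besselZero (r * (‖ζ‖ / 2)))
  rw [show R * (2 * 1) = 2 * R by ring, show R * 1 = R by ring] at this
  rw [← this]
  push_cast
  refine congrArg (fun x : ℝ => (R : ℂ) * (x : ℂ)) ?_
  refine intervalIntegral.integral_congr fun r _ => ?_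
  simp only [norm_mul, Complex.norm_real, Real.norm_of_nonneg hR.le]
  congr 1; ring

lemma norm_annulusKernel_one_le (ζ : ℂ) : ‖annulusKernel 1 ζ‖ ≤ 2 * Real.pi := by
  rw [annulusKernel_eq one_pos, Complex.norm_real]
  have := intervalIntegral.norm_integral_le_of_norm_le_const (a := 1) (b := 2 * 1) (C := 2 * Real.pi)
    (f := fun r => besselZero (r * (‖ζ‖ / 2))) (fun r _ => abs_besselZero_le _)
  norm_num at this ⊢
  exact this

lemma continuous_annulusKernel_one : Continuous (annulusKernel 1) := by
  have : annulusKernel 1 = fun ζ => ((∫ r in (1:ℝ)..2 * 1, besselZero (r * (‖ζ‖ / 2)) : ℝ) : ℂ) := by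
    ext ζ; exact annulusKernel_eq one_pos ζ
  rw [this]
  refine Complex.continuous_ofReal.comp ?_
  refine intervalIntegral.continuous_parametric_intervalIntegral_of_continuous' ?_ _ _
  have := continuous_besselZero
  fun_prop

/-- With `s = ‖ζ‖ / 2` the kernel is `s⁻¹` times the integral of `J₀` from `s` to `2 s`: one power
of decay comes from the substitution and half a power from the cancellation in `J₀`. The exception
`‖ζ‖ < 2` is the range `s < 1`. -/
lemma exists_norm_annulusKernel_one_le :
    ∃ C : ℝ, 0 ≤ C ∧ ∀ ζ : ℂ, ‖annulusKernel 1 ζ‖ ≤ C * (‖ζ‖⁻¹) ^ (3 / 2 : ℝ) ∨ ‖ζ‖ < 2 := by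
  obtain ⟨C, hC0, hC⟩ := exists_abs_integral_besselZero_le
  refine ⟨C * 2 ^ (3 / 2 : ℝ), by positivity, fun ζ => ?_⟩
  by_cases hζ : ‖ζ‖ < 2
  · exact Or.inr hζ
  left
  rw [not_lt] at hζ
  set s := ‖ζ‖ / 2 with hs
  have hs1 : 1 ≤ s := by rw [hs]; linarith
  have hs0 : 0 < s := by linarith
  have := intervalIntegral.integral_comp_mul_right (a := 1) (b := 2 * 1) besselZero hs0.ne'
  rw [annulusKernel_eq one_pos, Complex.norm_real, ← hs, this, one_mul, mul_one, smul_eq_mul,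
    norm_mul, norm_inv, Real.norm_of_nonneg hs0.le]
  calc s⁻¹ * ‖∫ x in s..2 * s, besselZero x‖ ≤ s⁻¹ * (C * s ^ (-(1 / 2) : ℝ)) := by
        gcongr; exact hC s hs1
    _ = C * (s⁻¹) ^ (3 / 2 : ℝ) := by
        rw [Real.rpow_neg hs0.le, ← Real.inv_rpow hs0.le, show (3 / 2 : ℝ) = 1 + 1 / 2 by norm_num,
          Real.rpow_add (by positivity), Real.rpow_one]
        ring
    _ = _ := by
        rw [hs, inv_div, div_eq_mul_inv, Real.mul_rpow (by norm_num) (by positivity)]; ring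

/-- Decay of the annulus kernel, at all rates up to `3 / 2`. -/
lemma exists_enorm_annulusKernel_le : ∃ C : ℝ≥0, ∀ R : ℝ, 0 < R → ∀ β : ℝ, 0 ≤ β → β ≤ 3 / 2 →
    ∀ ζ : ℂ, ‖annulusKernel R ζ‖ₑ ≤ C * ENNReal.ofReal R ^ (1 - β) * rieszKernel β ζ := by
  obtain ⟨C, hC0, hC⟩ := exists_norm_annulusKernel_one_le
  -- At scale one, the constant bound serves for `‖ζ‖ < 2`, where `2 ^ (3/2) * ‖ζ‖ ^ (-β) ≥ 1`;
  -- farther out the rate `3/2` is stronger than the rate `β`. Scaling then contributes `R * R ^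
  -- (-β)`.
  have key : ∀ β : ℝ, 0 ≤ β → β ≤ 3 / 2 → ∀ ζ : ℂ, ‖annulusKernel 1 ζ‖ₑ ≤
      ENNReal.ofReal (C + 2 * Real.pi * 2 ^ (3 / 2 : ℝ)) * rieszKernel β ζ := by
    intro β h0 h1 ζ
    by_cases hz : ζ = 0
    · subst hz
      rcases h0.eq_or_lt with h | h
      · subst h
        simp only [rieszKernel, ENNReal.rpow_zero, mul_one]
        rw [← ofReal_norm]
        refine ENNReal.ofReal_le_ofReal ((norm_annulusKernel_one_le 0).trans ?_)
        have : (1:ℝ) ≤ 2 ^ (3 / 2 : ℝ) := Real.one_le_rpow (by norm_num) (by norm_num)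
        nlinarith [Real.pi_pos]
      · have : rieszKernel β 0 = ⊤ := by simp [rieszKernel, h]
        rw [this, ENNReal.mul_top]
        · exact le_top
        · simp; positivity
    have hz' : 0 < ‖ζ‖ := norm_pos_iff.2 hz
    rw [rieszKernel, ← ofReal_norm, ← ofReal_norm, ← ENNReal.ofReal_inv_of_pos hz',
      ENNReal.ofReal_rpow_of_pos (by positivity), ← ENNReal.ofReal_mul (by positivity)]
    refine ENNReal.ofReal_le_ofReal ?_
    by_cases hl : ‖ζ‖ < 2
    · have e1 : (1:ℝ) ≤ 2 ^ (3 / 2 : ℝ) * (‖ζ‖⁻¹) ^ β := by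
        have : (2:ℝ) ^ β ≤ 2 ^ (3 / 2 : ℝ) := Real.rpow_le_rpow_of_exponent_le (by norm_num) h1
        calc (1:ℝ) ≤ (2 * ‖ζ‖⁻¹) ^ β := by
              refine Real.one_le_rpow ?_ h0
              rw [← div_eq_mul_inv, one_le_div hz']; exact hl.le
          _ = 2 ^ β * (‖ζ‖⁻¹) ^ β := Real.mul_rpow (by norm_num) (by positivity)
          _ ≤ _ := by gcongr
      have e2 : 0 ≤ C * (‖ζ‖⁻¹) ^ β := by positivity
      calc _ ≤ 2 * Real.pi * 1 := by rw [mul_one]; exact norm_annulusKernel_one_le ζ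
        _ ≤ 2 * Real.pi * (2 ^ (3 / 2 : ℝ) * (‖ζ‖⁻¹) ^ β) := by gcongr
        _ ≤ _ := by nlinarith
    · refine ((hC ζ).resolve_right hl).trans ?_
      rw [not_lt] at hl
      have : (‖ζ‖⁻¹) ^ (3 / 2 : ℝ) ≤ (‖ζ‖⁻¹) ^ β :=
        Real.rpow_le_rpow_of_exponent_ge (by positivity) (inv_le_one_of_one_le₀ (by linarith)) h1
      calc C * (‖ζ‖⁻¹) ^ (3 / 2 : ℝ) ≤ C * (‖ζ‖⁻¹) ^ β := by gcongr
        _ ≤ _ := by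
          refine mul_le_mul_of_nonneg_right ?_ (by positivity)
          have : 0 ≤ 2 * Real.pi * 2 ^ (3 / 2 : ℝ) := by positivity
          linarith
  refine ⟨(C + 2 * Real.pi * 2 ^ (3 / 2 : ℝ)).toNNReal, fun R hR β h0 h1 ζ => ?_⟩
  have hRe : ‖(R : ℂ)‖ₑ = ENNReal.ofReal R := by
    rw [← ofReal_norm, Complex.norm_real, Real.norm_of_nonneg hR.le]
  have hRp : ENNReal.ofReal R ≠ 0 := by simpa using hR
  rw [annulusKernel_scale hR, enorm_mul, hRe]
  calc _ ≤ ENNReal.ofReal R * (ENNReal.ofReal (C + 2 * Real.pi * 2 ^ (3 / 2 : ℝ)) *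
        rieszKernel β (R * ζ)) := by gcongr; exact key β h0 h1 _
    _ = _ := by
        rw [rieszKernel_mul β h0, show rieszKernel β (R : ℂ) = ENNReal.ofReal R ^ (-β) by
          rw [rieszKernel, hRe, ENNReal.inv_rpow, ENNReal.rpow_neg], sub_eq_add_neg,
          ENNReal.rpow_add _ _ hRp ENNReal.ofReal_ne_top, ENNReal.rpow_one]
        simp only [ENNReal.ofReal]
        ring

/-- The rate `3/2` in `v²` is the rate `3` in `v`, which exceeds the real dimension two. -/
lemma integrable_annulusKernel_one_sq : Integrable fun v : ℂ => annulusKernel 1 (v ^ 2) := by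
  obtain ⟨C, hC⟩ := exists_enorm_annulusKernel_le
  have hdom : Integrable (fun v : ℂ => (8 * (2 * Real.pi + C)) * (1 + ‖v‖) ^ (-(3:ℝ))) :=
    (integrable_one_add_norm (by simp; norm_num)).const_mul _
  refine hdom.mono' (continuous_annulusKernel_one.comp (by fun_prop)).aestronglyMeasurable
    (Eventually.of_forall fun v => ?_)
  have e : (1 + ‖v‖) ^ (-(3:ℝ)) = ((1 + ‖v‖) ^ 3)⁻¹ := by
    rw [Real.rpow_neg (by positivity)]; norm_cast
  have hp : (0:ℝ) < (1 + ‖v‖) ^ 3 := by positivity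
  rw [e]
  rcases lt_or_ge ‖v‖ 1 with h | h
  · have h8 : (1 + ‖v‖) ^ 3 ≤ 8 := by
      calc (1 + ‖v‖) ^ 3 ≤ (1 + 1) ^ 3 := by gcongr
        _ = 8 := by norm_num
    have : (1:ℝ) ≤ 8 * ((1 + ‖v‖) ^ 3)⁻¹ := by
      rw [← div_eq_mul_inv, one_le_div hp]; exact h8
    calc _ ≤ (2 * Real.pi + C) * 1 := by
          have := norm_annulusKernel_one_le (v ^ 2)
          have := C.2
          linarith [NNReal.coe_nonneg C]
      _ ≤ (2 * Real.pi + C) * (8 * ((1 + ‖v‖) ^ 3)⁻¹) := by gcongr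
      _ = _ := by ring
  · have hv : 0 < ‖v‖ := by linarith
    have h1 := hC 1 one_pos (3 / 2) (by norm_num) le_rfl (v ^ 2)
    rw [ENNReal.ofReal_one, ENNReal.one_rpow, mul_one, rieszKernel, enorm_pow, ENNReal.inv_pow,
      ← ENNReal.rpow_natCast, ← ENNReal.rpow_mul, ← ofReal_norm, ← ofReal_norm,
      ← ENNReal.ofReal_inv_of_pos hv, ENNReal.ofReal_rpow_of_pos (by positivity),
      ← ENNReal.ofReal_coe_nnreal, ← ENNReal.ofReal_mul (by positivity),
      ENNReal.ofReal_le_ofReal_iff (by positivity)] at h1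
    refine h1.trans ?_
    have e2 : (‖v‖⁻¹) ^ (((2:ℕ):ℝ) * (3 / 2)) = (‖v‖ ^ 3)⁻¹ := by
      rw [show (((2:ℕ):ℝ) * (3 / 2)) = ((3:ℕ):ℝ) by norm_num, Real.rpow_natCast, inv_pow]
    rw [e2]
    have h8 : (‖v‖ ^ 3)⁻¹ ≤ 8 * ((1 + ‖v‖) ^ 3)⁻¹ := by
      rw [← div_eq_mul_inv, inv_eq_one_div, div_le_div_iff₀ (by positivity) hp]
      calc 1 * (1 + ‖v‖) ^ 3 ≤ 1 * (2 * ‖v‖) ^ 3 := by gcongr; linarith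
        _ = _ := by ring
    calc (C:ℝ) * (‖v‖ ^ 3)⁻¹ ≤ (2 * Real.pi + C) * (8 * ((1 + ‖v‖) ^ 3)⁻¹) := by
          gcongr
          linarith [Real.pi_pos]
      _ = _ := by ring

/-! ### The approximate identity given by `annulusKernel R ((z - w) ^ 2)`. -/

/-- Substitute `v = √R (z - w)`: the factor `R` of the scaling law cancels the planar Jacobian. -/
lemma integral_mul_annulusKernel_sq {R : ℝ} (hR : 0 < R) (g : ℂ → ℂ) (z : ℂ) :
    ∫ w, g w * annulusKernel R ((z - w) ^ 2) =
      ∫ v, g (z - (√R)⁻¹ • v) * annulusKernel 1 (v ^ 2) := by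
  have hs : 0 < √R := Real.sqrt_pos.2 hR
  rw [← integral_sub_left_eq_self _ volume z]
  have e : ∀ u : ℂ, g (z - u) * annulusKernel R ((z - (z - u)) ^ 2) =
      R * (fun v => g (z - (√R)⁻¹ • v) * annulusKernel 1 (v ^ 2)) (√R • u) := by
    intro u
    simp only
    rw [smul_smul, inv_mul_cancel₀ hs.ne', one_smul, sub_sub_cancel, annulusKernel_scale hR,
      Complex.real_smul, mul_pow, ← Complex.ofReal_pow, Real.sq_sqrt hR.le]
    ring
  simp_rw [e]
  rw [integral_const_mul, Measure.integral_comp_smul volume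
    (fun v => g (z - (√R)⁻¹ • v) * annulusKernel 1 (v ^ 2))]
  simp only [Complex.finrank_real_complex, Real.sq_sqrt hR.le, abs_of_pos (inv_pos.2 hR),
    Complex.real_smul]
  rw [← mul_assoc, ← Complex.ofReal_mul, mul_inv_cancel₀ hR.ne', Complex.ofReal_one, one_mul]

lemma norm_integral_mul_annulusKernel_sq_le {R : ℝ} (hR : 0 < R) {g : ℂ → ℂ} {A : ℝ}
    (hA : ∀ w, ‖g w‖ ≤ A) (z : ℂ) :
    ‖∫ w, g w * annulusKernel R ((z - w) ^ 2)‖ ≤ A * ∫ v, ‖annulusKernel 1 (v ^ 2)‖ := by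
  rw [integral_mul_annulusKernel_sq hR, ← integral_const_mul]
  refine norm_integral_le_of_norm_le (integrable_annulusKernel_one_sq.norm.const_mul A)
    (Eventually.of_forall fun v => ?_)
  rw [norm_mul]
  gcongr
  exact hA _

lemma tendsto_integral_mul_annulusKernel_sq_aux {g : ℂ → ℂ} (hg : Continuous g) {A : ℝ}
    (hA : ∀ w, ‖g w‖ ≤ A) (z : ℂ) :
    Tendsto (fun R => ∫ w, g w * annulusKernel R ((z - w) ^ 2)) atTop
      (𝓝 (g z * ∫ v, annulusKernel 1 (v ^ 2))) := by
  rw [← integral_const_mul]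
  have : Tendsto (fun R : ℝ => ∫ v, g (z - (√R)⁻¹ • v) * annulusKernel 1 (v ^ 2)) atTop
      (𝓝 (∫ v, g z * annulusKernel 1 (v ^ 2))) := by
    refine tendsto_integral_filter_of_dominated_convergence
      (fun v => A * ‖annulusKernel 1 (v ^ 2)‖) ?_ ?_ ?_ ?_
    · refine Eventually.of_forall fun R => Continuous.aestronglyMeasurable ?_
      have := continuous_annulusKernel_one
      fun_prop
    · refine Eventually.of_forall fun R => Eventually.of_forall fun v => ?_
      rw [norm_mul]; gcongr; exact hA _
    · exact integrable_annulusKernel_one_sq.norm.const_mul A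
    · refine Eventually.of_forall fun v => Tendsto.mul_const _ ?_
      have h1 : Tendsto (fun R : ℝ => (√R)⁻¹) atTop (𝓝 0) :=
        tendsto_inv_atTop_zero.comp Real.tendsto_sqrt_atTop
      have h2 : Tendsto (fun R : ℝ => z - (√R)⁻¹ • v) atTop (𝓝 (z - (0:ℝ) • v)) :=
        tendsto_const_nhds.sub (h1.smul_const v)
      rw [zero_smul, sub_zero] at h2
      exact (hg.tendsto z).comp h2
  refine this.congr' ?_
  filter_upwards [eventually_gt_atTop 0] with R hR
  rw [integral_mul_annulusKernel_sq hR]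

/-! ### The mass of the approximate identity, by a Gaussian test function. -/

/-- The Gaussian `exp (-‖w‖²)`. -/
def gaussianBump (w : ℂ) : ℂ := ((Real.exp (-‖w‖ ^ 2) : ℝ) : ℂ)

lemma continuous_gaussianBump : Continuous gaussianBump := by
  unfold gaussianBump; fun_prop

lemma norm_gaussianBump_le (w : ℂ) : ‖gaussianBump w‖ ≤ 1 := by
  rw [gaussianBump, Complex.norm_real, Real.norm_of_nonneg (Real.exp_pos _).le, Real.exp_le_one_iff]
  have := sq_nonneg ‖w‖
  linarith

lemma integrable_gaussianBump : Integrable gaussianBump := by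
  have h : Integrable fun p : ℝ × ℝ => Real.exp (-1 * p.1 ^ 2) * Real.exp (-1 * p.2 ^ 2) :=
    (integrable_exp_neg_mul_sq one_pos).mul_prod (integrable_exp_neg_mul_sq one_pos)
  have h2 := (Complex.volume_preserving_equiv_real_prod.integrable_comp_emb
    Complex.measurableEquivRealProd.measurableEmbedding).2 h
  refine (h2.ofReal (𝕜 := ℂ)).congr (Eventually.of_forall fun w => ?_)
  simp only [Function.comp, gaussianBump, Complex.measurableEquivRealProd_apply]
  rw [← Real.exp_add, Complex.sq_norm, Complex.normSq_apply]
  congr 2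
  simp; ring

/-- Rotating by half the argument of `lam` makes the quadratic phase real and nonnegative; the
Gaussian does not see the rotation. -/
lemma exists_sqrt_phase (lam : ℂ) : ∃ c : Circle, lam * (c : ℂ) ^ 2 = ‖lam‖ := by
  refine ⟨Circle.exp (-(lam.arg / 2)), ?_⟩
  rw [Circle.coe_exp, ← Complex.exp_nat_mul]
  have : (lam.arg : ℂ) * Complex.I + ((2:ℕ):ℂ) * (((-(lam.arg / 2) : ℝ) : ℂ) * Complex.I) = 0 := by
    push_cast; ring
  calc _ = (‖lam‖ * Complex.exp (lam.arg * Complex.I)) *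
        Complex.exp (((2:ℕ):ℂ) * (((-(lam.arg / 2) : ℝ) : ℂ) * Complex.I)) := by
        rw [Complex.norm_mul_exp_arg_mul_I lam]
    _ = _ := by rw [mul_assoc, ← Complex.exp_add, this, Complex.exp_zero, mul_one]

/-- After a rotation the phase is `‖lam‖ * x * y`. The `x` integral is then the Fourier transform of
a Gaussian, and it turns the `y` integral into a Gaussian one with coefficient `1 + ‖lam‖² / 4`. -/
lemma integral_gaussianBump_mul_cexp (lam : ℂ) :
    ∫ u, gaussianBump u * Complex.exp (-Complex.I * (((lam * u ^ 2).im / 2 : ℝ) : ℂ)) =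
      ((Real.pi * (√(1 + ‖lam‖ ^ 2 / 4))⁻¹ : ℝ) : ℂ) := by
  obtain ⟨c, hc⟩ := exists_sqrt_phase lam
  set l := ‖lam‖ with hl
  have hrot := (rotation c).measurePreserving.integral_comp
    (rotation c).toHomeomorph.measurableEmbedding
    (fun u => gaussianBump u * Complex.exp (-Complex.I * (((lam * u ^ 2).im / 2 : ℝ) : ℂ)))
  rw [← hrot]
  have e1 : ∀ u : ℂ, gaussianBump (rotation c u) *
      Complex.exp (-Complex.I * (((lam * (rotation c u) ^ 2).im / 2 : ℝ) : ℂ)) =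
      gaussianBump u * Complex.exp (-Complex.I * ((l * (u ^ 2).im / 2 : ℝ) : ℂ)) := by
    intro u
    have : lam * (rotation c u) ^ 2 = (l : ℂ) * u ^ 2 := by
      rw [rotation_apply, mul_pow, ← mul_assoc, hc]
    rw [this, Complex.im_ofReal_mul]
    congr 1
    simp only [gaussianBump, LinearIsometryEquiv.norm_map]
  simp_rw [e1]
  rw [← Complex.volume_preserving_equiv_real_prod.symm.integral_comp
    Complex.measurableEquivRealProd.symm.measurableEmbedding]
  have e2 : ∀ p : ℝ × ℝ, gaussianBump (Complex.measurableEquivRealProd.symm p) * Complex.exp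
      (-Complex.I * ((l * ((Complex.measurableEquivRealProd.symm p) ^ 2).im / 2 : ℝ) : ℂ)) =
      Complex.exp (-(1:ℂ) * (p.2:ℂ) ^ 2) *
        (Complex.exp (Complex.I * ((-(l * p.2) : ℝ) : ℂ) * (p.1 : ℂ)) *
          Complex.exp (-(1:ℂ) * (p.1:ℂ) ^ 2)) := by
    intro p
    rw [gaussianBump, Complex.ofReal_exp, ← Complex.exp_add, ← Complex.exp_add, ← Complex.exp_add,
      Complex.sq_norm, Complex.normSq_apply, sq (Complex.measurableEquivRealProd.symm p),
      Complex.mul_im]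
    congr 1
    simp only [Complex.measurableEquivRealProd_symm_apply]
    push_cast; ring
  have hi : Integrable (fun p : ℝ × ℝ => Complex.exp (-(1:ℂ) * (p.2:ℂ) ^ 2) *
        (Complex.exp (Complex.I * ((-(l * p.2) : ℝ) : ℂ) * (p.1 : ℂ)) *
          Complex.exp (-(1:ℂ) * (p.1:ℂ) ^ 2))) ((volume : Measure ℝ).prod volume) := by
    have h : Integrable fun p : ℝ × ℝ => Real.exp (-1 * p.1 ^ 2) * Real.exp (-1 * p.2 ^ 2) :=
      (integrable_exp_neg_mul_sq one_pos).mul_prod (integrable_exp_neg_mul_sq one_pos)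
    refine h.mono' (Continuous.aestronglyMeasurable (by fun_prop)) (Eventually.of_forall fun p => ?_)
    rw [norm_mul, norm_mul, Complex.norm_exp, Complex.norm_exp, Complex.norm_exp]
    have a1 : (Complex.I * ((-(l * p.2) : ℝ) : ℂ) * (p.1 : ℂ)).re = 0 := by simp
    have a2 : ∀ x : ℝ, (-(1:ℂ) * (x:ℂ) ^ 2).re = -1 * x ^ 2 := by
      intro x; rw [neg_one_mul, Complex.neg_re, ← Complex.ofReal_pow, Complex.ofReal_re]; ring
    rw [a1, a2, a2, Real.exp_zero, one_mul, mul_comm]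
  simp_rw [e2]
  rw [Measure.volume_eq_prod, integral_prod_symm _ hi]
  simp only
  have e3 : ∀ y : ℝ, ∫ x : ℝ, Complex.exp (-(1:ℂ) * (y:ℂ) ^ 2) *
        (Complex.exp (Complex.I * ((-(l * y) : ℝ) : ℂ) * (x : ℂ)) *
          Complex.exp (-(1:ℂ) * (x:ℂ) ^ 2)) =
        ((√Real.pi * Real.exp (-(1 + l ^ 2 / 4) * y ^ 2) : ℝ) : ℂ) := by
    intro y
    rw [integral_const_mul, fourierIntegral_gaussian (by simp), div_one,
      show ((1:ℂ) / 2) = ((1 / 2 : ℝ) : ℂ) by push_cast; rfl, ← Complex.ofReal_cpow Real.pi_pos.le,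
      ← Real.sqrt_eq_rpow, mul_left_comm, ← Complex.exp_add]
    push_cast
    congr 2
    ring
  simp_rw [e3]
  rw [integral_complex_ofReal, integral_const_mul, integral_gaussian, ← Real.sqrt_mul Real.pi_pos.le]
  congr 1
  rw [show Real.pi * (Real.pi / (1 + l ^ 2 / 4)) = Real.pi ^ 2 * (1 + l ^ 2 / 4)⁻¹ by
    rw [sq, div_eq_mul_inv]; ring, Real.sqrt_mul (by positivity), Real.sqrt_sq Real.pi_pos.le,
    Real.sqrt_inv]

lemma integral_annulus_norm {R : ℝ} (hR : 0 < R) (f : ℝ → ℝ) :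
    ∫ lam in annulus R, ‖lam‖⁻¹ * f ‖lam‖ = 2 * Real.pi * ∫ r in R..2 * R, f r := by
  have h := integral_fun_norm_addHaar (volume : Measure ℂ)
    ((Set.Ioo R (2 * R)).indicator fun r => r⁻¹ * f r)
  have e : ∀ lam : ℂ, (annulus R).indicator (fun lam => ‖lam‖⁻¹ * f ‖lam‖) lam =
      (Set.Ioo R (2 * R)).indicator (fun r => r⁻¹ * f r) ‖lam‖ := fun lam => rfl
  rw [← integral_indicator (measurableSet_annulus R)]
  simp_rw [e]
  rw [h]
  have hb : (volume : Measure ℂ).real (Metric.ball 0 1) = Real.pi := by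
    simp [Measure.real, Complex.volume_ball]
  rw [hb, Complex.finrank_real_complex]
  have e2 : ∀ y : ℝ, y ^ (2 - 1) • (Set.Ioo R (2 * R)).indicator (fun r => r⁻¹ * f r) y =
      (Set.Ioo R (2 * R)).indicator f y := by
    intro y
    by_cases hy : y ∈ Set.Ioo R (2 * R)
    · rw [Set.indicator_of_mem hy, Set.indicator_of_mem hy]
      have : y ≠ 0 := (hR.trans hy.1).ne'
      simp [this]
    · rw [Set.indicator_of_notMem hy, Set.indicator_of_notMem hy, smul_zero]
  simp_rw [e2]
  rw [setIntegral_indicator measurableSet_Ioo, intervalIntegral.integral_of_le (by linarith),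
    integral_Ioc_eq_integral_Ioo, Set.inter_eq_self_of_subset_right]
  · simp; ring
  · exact fun x hx => hR.trans hx.1

lemma integrable_inv_norm_annulus {R : ℝ} (hR : 0 < R) :
    IntegrableOn (fun lam : ℂ => ((‖lam‖⁻¹ : ℝ) : ℂ)) (annulus R) := by
  refine Measure.integrableOn_of_bounded (M := R⁻¹) ?_ (Measurable.aestronglyMeasurable (by fun_prop))
    ((ae_restrict_iff' (measurableSet_annulus R)).2 (Eventually.of_forall fun lam hl => ?_))
  · refine ((measure_mono (t := Metric.ball 0 (2 * R)) ?_).trans_lt measure_ball_lt_top).ne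
    intro lam hl
    simpa using hl.2
  · rw [Complex.norm_real, norm_inv, norm_norm]
    exact inv_anti₀ hR hl.1.le

lemma integral_gaussianBump_mul_annulusKernel {R : ℝ} (hR : 0 < R) :
    ∫ w, gaussianBump w * annulusKernel R ((0 - w) ^ 2) =
      ((2 * Real.pi * ∫ r in R..2 * R, Real.pi * (√(1 + r ^ 2 / 4))⁻¹ : ℝ) : ℂ) := by
  rw [← integral_annulus_norm hR, ← integral_complex_ofReal]
  have e : ∀ w : ℂ, gaussianBump w * annulusKernel R ((0 - w) ^ 2) =
      ∫ lam in annulus R, gaussianBump w * (((‖lam‖⁻¹ : ℝ) : ℂ) *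
        Complex.exp (-Complex.I * (((lam * w ^ 2).im / 2 : ℝ) : ℂ))) := by
    intro w; rw [integral_const_mul, annulusKernel, zero_sub, neg_sq]
  simp_rw [e]
  rw [integral_integral_swap]
  · refine setIntegral_congr_fun (measurableSet_annulus R) fun lam _ => ?_
    simp_rw [mul_left_comm (gaussianBump _)]
    rw [integral_const_mul, integral_gaussianBump_mul_cexp]
    push_cast; rfl
  · refine (integrable_gaussianBump.norm.mul_prod (integrable_inv_norm_annulus hR).norm).mono'
      ?_ (Eventually.of_forall fun p => ?_)
    · have := continuous_gaussianBump
      exact Measurable.aestronglyMeasurable (by unfold Function.uncurry; fun_prop)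
    · simp only [Function.uncurry]
      rw [norm_mul, norm_mul, norm_cexp_neg_I_mul, mul_one]

/-- The integrand is squeezed between `2π / r` and the same times `(1 + 4 / R²) ^ (-1/2)`, and `1 /
r` integrates to `log 2` over every dyadic interval. -/
lemma tendsto_integral_inv_sqrt :
    Tendsto (fun R : ℝ => ∫ r in R..2 * R, Real.pi * (√(1 + r ^ 2 / 4))⁻¹) atTop
      (𝓝 (2 * Real.pi * Real.log 2)) := by
  have hup : ∀ R : ℝ, 0 < R → ∫ r in R..2 * R, 2 * Real.pi * r⁻¹ = 2 * Real.pi * Real.log 2 := by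
    intro R hR
    rw [intervalIntegral.integral_const_mul, integral_inv_of_pos hR (by linarith),
      mul_div_cancel_right₀ _ hR.ne']
  have hcont : Continuous fun r : ℝ => Real.pi * (√(1 + r ^ 2 / 4))⁻¹ := by
    refine continuous_const.mul (Continuous.inv₀ (by fun_prop) fun r => ?_)
    exact (Real.sqrt_pos.2 (by positivity)).ne'
  have hii : ∀ (R a : ℝ), 0 < R → IntervalIntegrable (fun r => a * r⁻¹) volume R (2 * R) := by
    intro R a hR
    refine (intervalIntegral.intervalIntegrable_inv (fun x hx => ?_) continuousOn_id).const_mul a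
    rw [Set.uIcc_of_le (by linarith)] at hx
    exact (hR.trans_le hx.1).ne'
  refine tendsto_of_tendsto_of_tendsto_of_le_of_le' (g := fun R : ℝ =>
      (√(1 + 4 / R ^ 2))⁻¹ * (2 * Real.pi * Real.log 2)) ?_ tendsto_const_nhds ?_ ?_
  · have h1 : Tendsto (fun R : ℝ => 4 / R ^ 2) atTop (𝓝 0) :=
      Tendsto.const_div_atTop (tendsto_pow_atTop two_ne_zero) _
    have h2 : Tendsto (fun R : ℝ => (√(1 + 4 / R ^ 2))⁻¹) atTop (𝓝 (√(1 + 0))⁻¹) :=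
      ((Real.continuous_sqrt.tendsto _).comp (tendsto_const_nhds.add h1)).inv₀ (by simp)
    simpa using h2.mul_const (2 * Real.pi * Real.log 2)
  · filter_upwards [eventually_gt_atTop 0] with R hR
    rw [← hup R hR, ← intervalIntegral.integral_const_mul]
    refine intervalIntegral.integral_mono_on (by linarith) ?_ (hcont.intervalIntegrable _ _) ?_
    · exact ((hii R _ hR).const_mul _)
    · intro r hr
      have hr0 : 0 < r := hR.trans_le hr.1
      have : √(1 + r ^ 2 / 4) ≤ √(1 + 4 / R ^ 2) * (r / 2) := by
        rw [← Real.sqrt_sq (show 0 ≤ r / 2 by positivity), ← Real.sqrt_mul (by positivity)]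
        refine Real.sqrt_le_sqrt ?_
        have : 1 ≤ r ^ 2 / R ^ 2 := by
          rw [one_le_div (by positivity)]; gcongr; exact hr.1
        calc 1 + r ^ 2 / 4 ≤ r ^ 2 / R ^ 2 + r ^ 2 / 4 := by gcongr
          _ = _ := by field_simp; ring
      have h3 := inv_anti₀ (Real.sqrt_pos.2 (by positivity)) this
      rw [mul_inv, inv_div] at h3
      calc _ = Real.pi * ((√(1 + 4 / R ^ 2))⁻¹ * (2 / r)) := by rw [div_eq_mul_inv]; ring
        _ ≤ _ := by gcongr
  · filter_upwards [eventually_gt_atTop 0] with R hR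
    rw [← hup R hR]
    refine intervalIntegral.integral_mono_on (by linarith) (hcont.intervalIntegrable _ _)
      (hii R _ hR) ?_
    intro r hr
    have hr0 : 0 < r := hR.trans_le hr.1
    have : r / 2 ≤ √(1 + r ^ 2 / 4) := by
      refine Real.le_sqrt_of_sq_le ?_
      nlinarith
    have h3 := inv_anti₀ (by positivity) this
    rw [inv_div] at h3
    calc _ ≤ Real.pi * (2 / r) := by gcongr
      _ = _ := by rw [div_eq_mul_inv]; ring

/-- The limit of the Gaussian test at `z = 0` is known twice: as the mass, by the approximate
identity, and explicitly, by Fubini and the radial integral. -/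
lemma integral_annulusKernel_one_sq :
    ∫ v, annulusKernel 1 (v ^ 2) = ((4 * Real.pi ^ 2 * Real.log 2 : ℝ) : ℂ) := by
  have h1 := tendsto_integral_mul_annulusKernel_sq_aux continuous_gaussianBump norm_gaussianBump_le 0
  have h2 := ((Complex.continuous_ofReal.tendsto _).comp
    (tendsto_integral_inv_sqrt.const_mul (2 * Real.pi)))
  have h3 : Tendsto (fun R => ∫ w, gaussianBump w * annulusKernel R ((0 - w) ^ 2)) atTop
      (𝓝 ((2 * Real.pi * (2 * Real.pi * Real.log 2) : ℝ) : ℂ)) := by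
    refine h2.congr' ?_
    filter_upwards [eventually_gt_atTop 0] with R hR
    rw [integral_gaussianBump_mul_annulusKernel hR]; rfl
  have := tendsto_nhds_unique h1 h3
  rw [show gaussianBump 0 = 1 by simp [gaussianBump], one_mul] at this
  rw [this]
  congr 1; ring

lemma tendsto_integral_mul_annulusKernel_sq {g : ℂ → ℂ} (hg : Continuous g) {A : ℝ}
    (hA : ∀ w, ‖g w‖ ≤ A) (z : ℂ) :
    Tendsto (fun R => ∫ w, g w * annulusKernel R ((z - w) ^ 2)) atTop
      (𝓝 (g z * ((4 * Real.pi ^ 2 * Real.log 2 : ℝ) : ℂ))) := by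
  rw [← integral_annulusKernel_one_sq]
  exact tendsto_integral_mul_annulusKernel_sq_aux hg hA z

/-! ### The quadratic phase and a Riemann-Lebesgue lemma uniform in `w`. -/

lemma norm_oscPhase (lam w z : ℂ) : ‖oscPhase lam w z‖ = 1 := norm_cexp_neg_I_mul _

lemma enorm_oscPhase (lam w z : ℂ) : ‖oscPhase lam w z‖ₑ = 1 := by
  rw [← ofReal_norm, norm_oscPhase, ENNReal.ofReal_one]

lemma continuous_oscPhase : Continuous fun p : ℂ × ℂ × ℂ => oscPhase p.1 p.2.1 p.2.2 := by
  unfold oscPhase; fun_prop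

@[fun_prop]
lemma continuous_oscPhase_comp {X : Type*} [TopologicalSpace X] {f g h : X → ℂ} (hf : Continuous f)
    (hg : Continuous g) (hh : Continuous h) : Continuous fun x => oscPhase (f x) (g x) (h x) :=
  continuous_oscPhase.comp (hf.prodMk (hg.prodMk hh))

@[fun_prop]
lemma measurable_oscPhase_comp {X : Type*} [MeasurableSpace X] {f g h : X → ℂ} (hf : Measurable f)
    (hg : Measurable g) (hh : Measurable h) : Measurable (fun x => oscPhase (f x) (g x) (h x)) := by
  unfold oscPhase
  fun_prop

/-- The terms quadratic in `y` cancel. What remains is a phase linear in `y` of frequency `lam * u`,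
times a unimodular factor that carries all dependence on `w`. -/
lemma oscPhase_mul_conj (lam w u y : ℂ) :
    oscPhase lam w (y + u) * conj (oscPhase lam w y) =
      Complex.exp (-Complex.I * (((lam * (u * (u - 2 * w))).im / 2 : ℝ) : ℂ)) *
        Complex.exp (-Complex.I * (((lam * u * y).im : ℝ) : ℂ)) := by
  unfold oscPhase
  rw [← Complex.exp_conj, ← Complex.exp_add, ← Complex.exp_add]
  congr 1
  simp only [map_mul, map_neg, Complex.conj_I, neg_neg, Complex.conj_ofReal]
  have : ((lam * (y + u - w) ^ 2).im / 2 : ℝ) = (lam * (y - w) ^ 2).im / 2 +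
      (lam * (u * (u - 2 * w))).im / 2 + (lam * u * y).im := by
    have e : lam * (y + u - w) ^ 2 = lam * (y - w) ^ 2 + lam * (u * (u - 2 * w)) +
      2 * (lam * u * y) := by ring
    rw [e, Complex.add_im, Complex.add_im]
    simp only [Complex.mul_im (2:ℂ)]
    simp; ring
  rw [this]; push_cast; ring

/-- The filter `lam → ∞`, uniformly in `w`, on pairs `(lam, w)`. -/
def largeParam : Filter (ℂ × ℂ) := comap (fun p => ‖p.1‖) atTop

instance : largeParam.IsCountablyGenerated := by unfold largeParam; infer_instance

lemma tendsto_norm_largeParam : Tendsto (fun p : ℂ × ℂ => ‖p.1‖) largeParam atTop := tendsto_comap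

lemma eventually_largeParam {P : ℂ × ℂ → Prop} (h : ∀ᶠ p in largeParam, P p) :
    ∃ R : ℝ, 0 < R ∧ ∀ lam w : ℂ, R < ‖lam‖ → P (lam, w) := by
  rw [largeParam, eventually_comap, eventually_atTop] at h
  obtain ⟨R, hR⟩ := h
  exact ⟨max R 1, by positivity, fun lam w hl =>
    hR ‖lam‖ ((le_max_left _ _).trans hl.le) (lam, w) rfl⟩

lemma tendsto_integral_cexp_im (u : ℂ) (hu : u ≠ 0) (f : ℂ → ℂ) :
    Tendsto (fun p : ℂ × ℂ => ∫ t, Complex.exp (Complex.I * (((p.1 * u * t).im : ℝ) : ℂ)) * f t)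
      largeParam (𝓝 0) := by
  have h := tendsto_integral_exp_inner_smul_cocompact f
  -- The conjugate, the factor `I` and the `2π` make the real inner product with `t` equal to `-(lam
  -- * u * t).im / (2π)`, as the Fourier convention requires.
  have hm : Tendsto (fun p : ℂ × ℂ => conj (Complex.I * (p.1 * u)) / (2 * Real.pi)) largeParam
      (cocompact ℂ) := by
    rw [← Metric.cobounded_eq_cocompact, ← tendsto_norm_atTop_iff_cobounded]
    have : (fun p : ℂ × ℂ => ‖conj (Complex.I * (p.1 * u)) / (2 * Real.pi)‖) =
        fun p => ‖p.1‖ * (‖u‖ / (2 * Real.pi)) := by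
      ext p
      simp [abs_of_pos Real.pi_pos]; ring
    rw [this]
    exact tendsto_norm_largeParam.atTop_mul_const (by have := norm_pos_iff.2 hu; positivity)
  refine (h.comp hm).congr fun p => ?_
  refine integral_congr_ae (Eventually.of_forall fun t => ?_)
  simp only [Circle.smul_def, Real.fourierChar_apply, smul_eq_mul]
  congr 2
  rw [mul_comm _ Complex.I]
  congr 2
  rw [Complex.inner]
  have : conj t * (conj (Complex.I * (p.1 * u)) / (2 * Real.pi)) =
      conj (Complex.I * (p.1 * u * t)) * (((2 * Real.pi)⁻¹ : ℝ) : ℂ) := by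
    simp only [map_mul]; push_cast; ring
  rw [mul_comm _ (conj t), this, Complex.re_mul_ofReal, Complex.conj_re]
  simp
  field_simp
  ring

/-- A `T T*` argument. The squared modulus is a double integral in which, for a fixed difference `u
≠ 0` of the variables, the phase is linear and the ordinary Riemann-Lebesgue lemma applies; the
autocorrelation of `‖F‖` dominates. The limit is uniform in `w` because `w` survives only in a
unimodular factor. -/
lemma tendsto_integral_oscPhase_mul {F : ℂ → ℂ} (hF : Integrable F) :
    Tendsto (fun p : ℂ × ℂ => ∫ z, oscPhase p.1 p.2 z * F z) largeParam (𝓝 0) := by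
  set f : ℂ × ℂ → ℂ → ℂ := fun p z => oscPhase p.1 p.2 z * F z with hf
  have hfi : ∀ p, Integrable (f p) := fun p =>
    hF.bdd_mul (c := 1) (Continuous.aestronglyMeasurable (by fun_prop))
      (Eventually.of_forall fun z => (norm_oscPhase _ _ _).le)
  have hFn : Integrable fun t => conj (F (-t)) :=
    (Complex.conjLIE.toContinuousLinearEquiv.toContinuousLinearMap.integrable_comp hF.comp_neg)
  have hconv : Integrable (fun q : ℂ × ℂ => conj (F (-q.2)) * F (q.1 - q.2))
      ((volume : Measure ℂ).prod volume) :=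
    hFn.convolution_integrand (ContinuousLinearMap.mul ℂ ℂ) hF
  have hconv' : ∀ p, Integrable (fun q : ℂ × ℂ => conj (f p (-q.2)) * f p (q.1 - q.2))
      ((volume : Measure ℂ).prod volume) := by
    intro p
    have : Integrable fun t => conj (f p (-t)) :=
      (Complex.conjLIE.toContinuousLinearEquiv.toContinuousLinearMap.integrable_comp (hfi p).comp_neg)
    exact this.convolution_integrand (ContinuousLinearMap.mul ℂ ℂ) (hfi p)
  have key : ∀ p, (∫ z, f p z) * conj (∫ z, f p z) =
      ∫ u, ∫ t, conj (f p (-t)) * f p (u - t) := by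
    intro p
    rw [integral_integral_swap (hconv' p)]
    simp_rw [integral_const_mul, integral_sub_right_eq_self (f p)]
    rw [integral_mul_const, mul_comm]
    congr 1
    rw [integral_neg_eq_self (fun t => conj (f p t)), integral_conj]
  have lim : Tendsto (fun p => ∫ u, ∫ t, conj (f p (-t)) * f p (u - t)) largeParam (𝓝 0) := by
    rw [← integral_zero ℂ ℂ (μ := volume)]
    refine tendsto_integral_filter_of_dominated_convergence
      (fun u => ∫ t, ‖conj (F (-t)) * F (u - t)‖) ?_ ?_ ?_ ?_
    · exact Eventually.of_forall fun p => (hconv' p).integral_prod_left.aestronglyMeasurable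
    · refine Eventually.of_forall fun p => Eventually.of_forall fun u => ?_
      refine (norm_integral_le_integral_norm _).trans (le_of_eq ?_)
      refine integral_congr_ae (Eventually.of_forall fun t => ?_)
      simp only [hf, norm_mul, RCLike.norm_conj, norm_oscPhase, one_mul]
    · exact hconv.norm.integral_prod_left
    · have h0 : ∀ᵐ u : ℂ, u ≠ 0 := by simp [ae_iff, measure_singleton]
      filter_upwards [h0] with u hu
      have h1 := tendsto_integral_cexp_im u hu fun t => conj (F (-t)) * F (u - t)
      rw [tendsto_zero_iff_norm_tendsto_zero] at h1 ⊢
      refine h1.congr fun p => ?_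
      have : ∀ t, conj (f p (-t)) * f p (u - t) =
          Complex.exp (-Complex.I * (((p.1 * (u * (u - 2 * p.2))).im / 2 : ℝ) : ℂ)) *
          (Complex.exp (Complex.I * (((p.1 * u * t).im : ℝ) : ℂ)) * (conj (F (-t)) * F (u - t))) := by
        intro t
        have := oscPhase_mul_conj p.1 p.2 u (-t)
        rw [neg_add_eq_sub] at this
        simp only [hf, map_mul]
        calc _ = (oscPhase p.1 p.2 (u - t) * conj (oscPhase p.1 p.2 (-t))) *
              (conj (F (-t)) * F (u - t)) := by ring
          _ = _ := by
            rw [this, mul_neg, Complex.neg_im]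
            push_cast
            rw [show -Complex.I * -(((p.1 * u * t).im : ℝ) : ℂ) =
              Complex.I * (((p.1 * u * t).im : ℝ) : ℂ) by ring]
            ring
      simp_rw [this]
      rw [integral_const_mul, norm_mul, norm_cexp_neg_I_mul, one_mul]
  have h2 : Tendsto (fun p => ‖∫ z, f p z‖ ^ 2) largeParam (𝓝 0) := by
    have := lim.norm
    rw [norm_zero] at this
    refine this.congr fun p => ?_
    rw [← key, norm_mul, RCLike.norm_conj, sq]
  rw [tendsto_zero_iff_norm_tendsto_zero]
  have h3 := h2.sqrt
  rw [Real.sqrt_zero] at h3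
  refine h3.congr fun p => Real.sqrt_sq (norm_nonneg _)

/-! ### Bounded potentials and the scalar Lippmann-Schwinger operator. -/

/-- Bounded measurable functions vanishing outside a ball. -/
structure IsBddPotential (ρ A : ℝ) (q : ℂ → ℂ) : Prop where
  measurable : Measurable q
  norm_le : ∀ z, ‖q z‖ ≤ A
  eq_zero : ∀ z, z ∉ Metric.ball (0 : ℂ) ρ → q z = 0

namespace IsBddPotential

variable {ρ A : ℝ} {q : ℂ → ℂ}

lemma nonneg (hq : IsBddPotential ρ A q) : 0 ≤ A := (norm_nonneg _).trans (hq.norm_le 0)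

lemma enorm_le (hq : IsBddPotential ρ A q) (z : ℂ) : ‖q z‖ₑ ≤ ENNReal.ofReal A := by
  rw [← ofReal_norm]; exact ENNReal.ofReal_le_ofReal (hq.norm_le z)

lemma lintegral_mul_le (hq : IsBddPotential ρ A q) (f : ℂ → ℝ≥0∞) :
    ∫⁻ z, ‖q z‖ₑ * f z ≤ ENNReal.ofReal A * ∫⁻ z in Metric.ball 0 ρ, f z := by
  rw [← lintegral_const_mul' _ _ ENNReal.ofReal_ne_top, ← lintegral_indicator measurableSet_ball]
  refine lintegral_mono fun z => ?_
  by_cases hz : z ∈ Metric.ball (0 : ℂ) ρ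
  · rw [Set.indicator_of_mem hz]; gcongr; exact hq.enorm_le z
  · simp [hq.eq_zero z hz]

lemma integrable (hq : IsBddPotential ρ A q) : Integrable q := by
  refine ⟨hq.measurable.aestronglyMeasurable, ?_⟩
  have := hq.lintegral_mul_le fun _ => 1
  simp only [mul_one, setLIntegral_one] at this
  exact this.trans_lt (ENNReal.mul_lt_top ENNReal.ofReal_lt_top measure_ball_lt_top)

end IsBddPotential

section

/-- The resolvent identity. If `x` hits one of two distinct poles the right side is `∞`, so the
value `0⁻¹ = 0` on the left does no harm. -/
lemma enorm_inv_sub_sub_inv_sub_le (z₁ z₂ x : ℂ) :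
    ‖(z₁ - x)⁻¹ - (z₂ - x)⁻¹‖ₑ ≤ ‖z₁ - z₂‖ₑ * (rieszKernel 1 (x - z₁) * rieszKernel 1 (x - z₂)) := by
  by_cases h : z₁ = z₂
  · simp [h]
  have hd : ‖z₁ - z₂‖ₑ ≠ 0 := by simpa [sub_eq_zero] using h
  by_cases h1 : x = z₁
  · subst h1
    have : rieszKernel 1 (x - z₂) ≠ 0 := by simp [rieszKernel_one]
    have h0 : rieszKernel 1 (x - x) = ⊤ := by simp [rieszKernel_one]
    rw [h0, ENNReal.top_mul this, ENNReal.mul_top hd]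
    exact le_top
  by_cases h2 : x = z₂
  · subst h2
    have : rieszKernel 1 (x - z₁) ≠ 0 := by simp [rieszKernel_one]
    have h0 : rieszKernel 1 (x - x) = ⊤ := by simp [rieszKernel_one]
    rw [h0, ENNReal.mul_top this, ENNReal.mul_top hd]
    exact le_top
  have a1 : z₁ - x ≠ 0 := sub_ne_zero.2 (Ne.symm h1)
  have a2 : z₂ - x ≠ 0 := sub_ne_zero.2 (Ne.symm h2)
  rw [rieszKernel_sub_comm 1 x z₁, rieszKernel_sub_comm 1 x z₂, rieszKernel_one, rieszKernel_one,
    ← enorm_inv a1, ← enorm_inv a2, ← enorm_mul, ← enorm_mul, ← enorm_neg ((z₁ - z₂) * _)]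
  apply le_of_eq
  congr 1
  field_simp
  ring

lemma exists_setLIntegral_inv_sub_le (ρ : ℝ) :
    ∃ D : ℝ≥0, ∀ z₁ z₂ : ℂ, ∫⁻ x in Metric.ball (0 : ℂ) ρ, ‖(z₁ - x)⁻¹ - (z₂ - x)⁻¹‖ₑ ≤
      D * ‖z₁ - z₂‖ₑ ^ (1 / 2 : ℝ) := by
  obtain ⟨D, hD⟩ := exists_setLIntegral_rieszKernel_mul_le ρ (s := 1) (t := 1) (κ := 1 / 2)
    (by norm_num) (by norm_num) (by norm_num) (by norm_num)
  refine ⟨D, fun z₁ z₂ => ?_⟩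
  by_cases h : z₁ = z₂
  · simp [h]
  have hd : ‖z₁ - z₂‖ₑ ≠ 0 := by simpa [sub_eq_zero] using h
  have hd' : ‖z₁ - z₂‖ₑ ≠ ⊤ := enorm_ne_top
  calc _ ≤ ∫⁻ x in Metric.ball (0 : ℂ) ρ, ‖z₁ - z₂‖ₑ *
        (rieszKernel 1 (x - z₁) * rieszKernel 1 (x - z₂)) :=
        lintegral_mono fun x => enorm_inv_sub_sub_inv_sub_le _ _ _
    _ ≤ ‖z₁ - z₂‖ₑ * (D * rieszKernel (1 / 2) (z₁ - z₂)) := by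
        rw [lintegral_const_mul' _ _ hd']; gcongr; exact hD _ _
    _ = D * (‖z₁ - z₂‖ₑ ^ (1:ℝ) * ‖z₁ - z₂‖ₑ ^ (-(1 / 2) : ℝ)) := by
        rw [rieszKernel, ENNReal.inv_rpow, ENNReal.rpow_neg, ENNReal.rpow_one]; ring
    _ = _ := by rw [← ENNReal.rpow_add _ _ hd hd']; norm_num

lemma tendsto_setLIntegral_rieszKernel_one (ρ : ℝ) :
    Tendsto (fun z => ∫⁻ x in Metric.ball (0 : ℂ) ρ, rieszKernel 1 (x - z)) (cocompact ℂ) (𝓝 0) := by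
  have h1 : Tendsto (fun z : ℂ => volume (Metric.ball (0 : ℂ) ρ) / ENNReal.ofReal (‖z‖ - ρ))
      (cocompact ℂ) (𝓝 0) := by
    have : Tendsto (fun z : ℂ => ENNReal.ofReal (‖z‖ - ρ)) (cocompact ℂ) (𝓝 ⊤) :=
      ENNReal.tendsto_ofReal_atTop.comp
        (tendsto_atTop_add_const_right _ (-ρ) (tendsto_norm_cocompact_atTop (E := ℂ)))
    have := ENNReal.Tendsto.const_div (a := volume (Metric.ball (0 : ℂ) ρ)) this
      (Or.inr measure_ball_lt_top.ne)
    simpa using this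
  refine tendsto_of_tendsto_of_tendsto_of_le_of_le tendsto_const_nhds h1 (fun z => zero_le) fun z => ?_
  calc _ ≤ ∫⁻ x in Metric.ball (0 : ℂ) ρ, (ENNReal.ofReal (‖z‖ - ρ))⁻¹ := by
        refine setLIntegral_mono measurable_const fun x hx => ?_
        rw [rieszKernel_one]
        refine ENNReal.inv_le_inv.2 ?_
        rw [← ofReal_norm]
        refine ENNReal.ofReal_le_ofReal ?_
        have hx' : ‖x‖ < ρ := by simpa using hx
        have := norm_sub_norm_le z x
        rw [norm_sub_rev x z]; linarith
    _ = _ := by rw [setLIntegral_const, div_eq_mul_inv, mul_comm]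

/-- The scalar Lippmann–Schwinger operator
`f ↦ π⁻¹ ∫ exp (-i Im [lam (z' - w)²] / 2) / (z - z') * (q z' * f z')`. -/
def lsOp (q : ℂ → ℂ) (lam w : ℂ) (f : ℂ → ℂ) (z : ℂ) : ℂ :=
  (1 / (Real.pi : ℂ)) * ∫ z', oscPhase lam w z' / (z - z') * (q z' * f z')

lemma enorm_one_div_pi_le : ‖(1 / (Real.pi : ℂ))‖ₑ ≤ 1 := by
  rw [← ofReal_norm]
  refine ENNReal.ofReal_le_one.2 ?_
  rw [norm_div, norm_one, Complex.norm_real, Real.norm_of_nonneg Real.pi_pos.le,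
    div_le_one Real.pi_pos]
  linarith [Real.pi_gt_three]

lemma enorm_oscPhase_div_le (lam w z x : ℂ) : ‖oscPhase lam w x / (z - x)‖ₑ ≤ rieszKernel 1 (x - z) := by
  rw [rieszKernel_sub_comm]
  exact enorm_div_sub_le _ _ (norm_oscPhase _ _ _).le

variable {ρ A : ℝ} {q p : ℂ → ℂ}

lemma lintegral_ls_le (hq : IsBddPotential ρ A q) (lam w : ℂ) (f : ℂ → ℂ) (z : ℂ) :
    ∫⁻ z', ‖oscPhase lam w z' / (z - z') * (q z' * f z')‖ₑ ≤
      ENNReal.ofReal A * ∫⁻ x in Metric.ball 0 ρ, rieszKernel 1 (x - z) * ‖f x‖ₑ := by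
  refine le_trans (lintegral_mono fun x => ?_)
    (hq.lintegral_mul_le fun x => rieszKernel 1 (x - z) * ‖f x‖ₑ)
  rw [enorm_mul, enorm_mul, mul_left_comm]
  gcongr
  exact enorm_oscPhase_div_le _ _ _ _

lemma enorm_lsOp_le (hq : IsBddPotential ρ A q) (lam w : ℂ) (f : ℂ → ℂ) (z : ℂ) :
    ‖lsOp q lam w f z‖ₑ ≤
      ENNReal.ofReal A * ∫⁻ x in Metric.ball 0 ρ, rieszKernel 1 (x - z) * ‖f x‖ₑ := by
  rw [lsOp, enorm_mul]
  calc _ ≤ 1 * ∫⁻ z', ‖oscPhase lam w z' / (z - z') * (q z' * f z')‖ₑ := by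
        gcongr
        · exact enorm_one_div_pi_le
        · exact enorm_integral_le_lintegral_enorm _
    _ ≤ _ := by rw [one_mul]; exact lintegral_ls_le hq lam w f z

lemma enorm_lsOp_le_of_bdd (hq : IsBddPotential ρ A q) (lam w : ℂ) {f : ℂ → ℂ} {C : ℝ}
    (hf : ∀ z, ‖f z‖ ≤ C) (z : ℂ) :
    ‖lsOp q lam w f z‖ₑ ≤ ENNReal.ofReal A * ENNReal.ofReal C *
      ∫⁻ x in Metric.ball 0 ρ, rieszKernel 1 (x - z) := by
  refine (enorm_lsOp_le hq lam w f z).trans ?_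
  rw [mul_assoc]
  gcongr
  rw [← lintegral_const_mul' _ _ ENNReal.ofReal_ne_top]
  refine lintegral_mono fun x => ?_
  rw [mul_comm]
  gcongr
  rw [← ofReal_norm]; exact ENNReal.ofReal_le_ofReal (hf x)

lemma exists_norm_lsOp_le (ρ : ℝ) : ∃ C₀ : ℝ, 0 ≤ C₀ ∧ ∀ {A : ℝ} {q : ℂ → ℂ},
    IsBddPotential ρ A q → ∀ (lam w : ℂ) {f : ℂ → ℂ} {C : ℝ}, (∀ z, ‖f z‖ ≤ C) → ∀ z,
    ‖lsOp q lam w f z‖ ≤ A * C * C₀ := by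
  obtain ⟨K, hK⟩ := exists_setLIntegral_rieszKernel_le ρ (s := 1) (by norm_num) (by norm_num)
  refine ⟨K, K.2, fun {A q} hq lam w f C hf z => ?_⟩
  have hA := hq.nonneg
  have hC : 0 ≤ C := (norm_nonneg _).trans (hf 0)
  have : ‖lsOp q lam w f z‖ₑ ≤ ENNReal.ofReal A * ENNReal.ofReal C * K :=
    (enorm_lsOp_le_of_bdd hq lam w hf z).trans (by gcongr; exact hK z)
  rw [← ofReal_norm, ← ENNReal.ofReal_coe_nnreal, ← ENNReal.ofReal_mul hA,
    ← ENNReal.ofReal_mul (by positivity)] at this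
  exact (ENNReal.ofReal_le_ofReal_iff (by positivity)).1 this

lemma integrable_ls (hq : IsBddPotential ρ A q) (lam w : ℂ) {f : ℂ → ℂ} (hfm : Measurable f) {C : ℝ}
    (hf : ∀ z, ‖f z‖ ≤ C) (z : ℂ) :
    Integrable fun z' => oscPhase lam w z' / (z - z') * (q z' * f z') := by
  have hqm := hq.measurable
  refine ⟨Measurable.aestronglyMeasurable (by fun_prop), ?_⟩
  obtain ⟨K, hK⟩ := exists_setLIntegral_rieszKernel_le ρ (s := 1) (by norm_num) (by norm_num)
  refine (lintegral_ls_le hq lam w f z).trans_lt (ENNReal.mul_lt_top ENNReal.ofReal_lt_top ?_)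
  calc _ ≤ ∫⁻ x in Metric.ball 0 ρ, ENNReal.ofReal C * rieszKernel 1 (x - z) := by
        refine lintegral_mono fun x => ?_
        rw [mul_comm]
        gcongr
        rw [← ofReal_norm]; exact ENNReal.ofReal_le_ofReal (hf x)
    _ = ENNReal.ofReal C * ∫⁻ x in Metric.ball 0 ρ, rieszKernel 1 (x - z) :=
        lintegral_const_mul' _ _ ENNReal.ofReal_ne_top
    _ < ⊤ := ENNReal.mul_lt_top ENNReal.ofReal_lt_top ((hK z).trans_lt ENNReal.coe_lt_top)

lemma lsOp_sub (hq : IsBddPotential ρ A q) (lam w : ℂ) {f g : ℂ → ℂ} (hfm : Measurable f)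
    (hgm : Measurable g) {C C' : ℝ} (hf : ∀ z, ‖f z‖ ≤ C) (hg : ∀ z, ‖g z‖ ≤ C') (z : ℂ) :
    lsOp q lam w (fun z => f z - g z) z = lsOp q lam w f z - lsOp q lam w g z := by
  unfold lsOp
  rw [← mul_sub, ← integral_sub (integrable_ls hq lam w hfm hf z) (integrable_ls hq lam w hgm hg z)]
  congr 2; ext x; ring

/-- The operator maps bounded functions to functions Hölder of order `1/2`, by integrating the
resolvent identity. This is what allows a fixed point to be sought among bounded continuous
functions. -/
lemma continuous_lsOp (hq : IsBddPotential ρ A q) (lam w : ℂ) {f : ℂ → ℂ} (hfm : Measurable f) {C : ℝ}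
    (hf : ∀ z, ‖f z‖ ≤ C) : Continuous (lsOp q lam w f) := by
  obtain ⟨D, hD⟩ := exists_setLIntegral_inv_sub_le ρ
  have : HolderWith (A.toNNReal * C.toNNReal * D) (1 / 2) (lsOp q lam w f) := by
    intro z₁ z₂
    rw [edist_eq_enorm_sub, edist_eq_enorm_sub, lsOp, lsOp, ← mul_sub,
      ← integral_sub (integrable_ls hq lam w hfm hf z₁) (integrable_ls hq lam w hfm hf z₂), enorm_mul]
    calc _ ≤ 1 * ∫⁻ x, ‖q x‖ₑ * (ENNReal.ofReal C * ‖(z₁ - x)⁻¹ - (z₂ - x)⁻¹‖ₑ) := by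
          gcongr
          · exact enorm_one_div_pi_le
          · refine (enorm_integral_le_lintegral_enorm _).trans (lintegral_mono fun x => ?_)
            rw [show oscPhase lam w x / (z₁ - x) * (q x * f x) - oscPhase lam w x / (z₂ - x) * (q x * f x)
              = oscPhase lam w x * (q x * (f x * ((z₁ - x)⁻¹ - (z₂ - x)⁻¹))) by
              simp only [div_eq_mul_inv]; ring, enorm_mul, enorm_oscPhase, one_mul, enorm_mul, enorm_mul]
            gcongr
            rw [← ofReal_norm]; exact ENNReal.ofReal_le_ofReal (hf x)
      _ ≤ 1 * (ENNReal.ofReal A * ∫⁻ x in Metric.ball 0 ρ,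
            ENNReal.ofReal C * ‖(z₁ - x)⁻¹ - (z₂ - x)⁻¹‖ₑ) := by
          gcongr
          exact hq.lintegral_mul_le _
      _ ≤ 1 * (ENNReal.ofReal A * (ENNReal.ofReal C * (D * ‖z₁ - z₂‖ₑ ^ (1 / 2 : ℝ)))) := by
          rw [lintegral_const_mul' _ _ ENNReal.ofReal_ne_top]
          gcongr
          exact hD _ _
      _ = _ := by
          push_cast
          simp only [ENNReal.ofReal]
          ring
  exact this.continuous (by norm_num)

lemma tendsto_lsOp_cocompact (hq : IsBddPotential ρ A q) (lam w : ℂ) {f : ℂ → ℂ} {C : ℝ}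
    (hf : ∀ z, ‖f z‖ ≤ C) : Tendsto (lsOp q lam w f) (cocompact ℂ) (𝓝 0) := by
  rw [tendsto_zero_iff_enorm_tendsto_zero]
  have h := ENNReal.Tendsto.const_mul (a := ENNReal.ofReal A * ENNReal.ofReal C)
    (tendsto_setLIntegral_rieszKernel_one ρ)
    (Or.inr (ENNReal.mul_ne_top ENNReal.ofReal_ne_top ENNReal.ofReal_ne_top))
  rw [mul_zero] at h
  exact tendsto_of_tendsto_of_tendsto_of_le_of_le tendsto_const_nhds h (fun _ => zero_le)
    (enorm_lsOp_le_of_bdd hq lam w hf)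

/-! ### The kernel of the iterated operator and its smallness for large `lam`. -/

/-- The kernel of the composition of two scalar Lippmann–Schwinger operators. -/
def crossKernel (q : ℂ → ℂ) (lam w z y : ℂ) : ℂ :=
  ∫ x, oscPhase lam w x / (z - x) * (q x * conj (1 / (x - y)))

lemma lintegral_crossKernel_le (hq : IsBddPotential ρ A q) (lam w z y : ℂ) :
    ∫⁻ x, ‖oscPhase lam w x / (z - x) * (q x * conj (1 / (x - y)))‖ₑ ≤
      ENNReal.ofReal A * ∫⁻ x in Metric.ball 0 ρ, rieszKernel 1 (x - z) * rieszKernel 1 (x - y) := by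
  refine (lintegral_ls_le hq lam w _ z).trans ?_
  gcongr
  rw [RCLike.enorm_conj]
  exact enorm_div_sub_le _ _ (by simp)

lemma exists_enorm_crossKernel_le (ρ : ℝ) : ∃ D : ℝ≥0, ∀ {A : ℝ} {q : ℂ → ℂ},
    IsBddPotential ρ A q → ∀ lam w z y : ℂ,
      (∫⁻ x, ‖oscPhase lam w x / (z - x) * (q x * conj (1 / (x - y)))‖ₑ) ≤
        ENNReal.ofReal A * (D * rieszKernel (1 / 2) (z - y)) := by
  obtain ⟨D, hD⟩ := exists_setLIntegral_rieszKernel_mul_le ρ (s := 1) (t := 1) (κ := 1 / 2)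
    (by norm_num) (by norm_num) (by norm_num) (by norm_num)
  refine ⟨D, fun {A q} hq lam w z y => (lintegral_crossKernel_le hq lam w z y).trans ?_⟩
  gcongr
  exact hD z y

lemma stronglyMeasurable_crossKernel (hq : IsBddPotential ρ A q) (lam w z : ℂ) :
    StronglyMeasurable (crossKernel q lam w z) := by
  have hqm := hq.measurable
  refine StronglyMeasurable.integral_prod_right
    (f := fun y x => oscPhase lam w x / (z - x) * (q x * conj (1 / (x - y)))) ?_
  refine Measurable.stronglyMeasurable ?_
  unfold Function.uncurry
  have : Measurable (fun z : ℂ => conj z) := Complex.continuous_conj.measurable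
  have h2 : Measurable fun a : ℂ × ℂ => conj (1 / (a.2 - a.1)) := this.comp (by fun_prop)
  fun_prop

/-- Fubini. The two conjugations make the composition complex linear in `f`, and the oscillation in
the intermediate variable is isolated in `crossKernel`. -/
lemma lsOp_conj_lsOp_conj (hq : IsBddPotential ρ A q) (hp : IsBddPotential ρ A p) (lam w : ℂ)
    {f : ℂ → ℂ} (hfm : Measurable f) {C : ℝ} (hf : ∀ z, ‖f z‖ ≤ C) (z : ℂ) :
    lsOp q lam w (fun x => conj (lsOp p lam w (fun y => conj (f y)) x)) z =
      (1 / (Real.pi : ℂ)) ^ 2 * ∫ y, conj (oscPhase lam w y * p y) * f y * crossKernel q lam w z y := by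
  have hqm := hq.measurable
  have hpm := hp.measurable
  have hcm : Measurable (fun z : ℂ => conj z) := Complex.continuous_conj.measurable
  obtain ⟨D, hD⟩ := exists_enorm_crossKernel_le ρ
  obtain ⟨K, hK⟩ := exists_setLIntegral_rieszKernel_le ρ (s := 1 / 2) (by norm_num) (by norm_num)
  unfold lsOp crossKernel
  have e1 : ∀ x, oscPhase lam w x / (z - x) * (q x * conj ((1 / (Real.pi : ℂ)) *
      ∫ y, oscPhase lam w y / (x - y) * (p y * conj (f y)))) = (1 / (Real.pi : ℂ)) *
      ∫ y, conj (oscPhase lam w y * p y) * f y *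
        (oscPhase lam w x / (z - x) * (q x * conj (1 / (x - y)))) := by
    intro x
    have : ∀ y, conj (oscPhase lam w y * p y) * f y *
        (oscPhase lam w x / (z - x) * (q x * conj (1 / (x - y)))) =
        oscPhase lam w x / (z - x) * (q x * conj (oscPhase lam w y / (x - y) * (p y * conj (f y)))) := by
      intro y
      simp only [map_mul, map_div₀, Complex.conj_conj, map_one]
      ring
    simp_rw [this]
    rw [integral_const_mul, integral_const_mul, integral_conj, map_mul, map_div₀, map_one,
      Complex.conj_ofReal]
    ring
  simp_rw [e1]
  rw [integral_const_mul, integral_integral_swap, sq, mul_assoc]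
  · simp_rw [integral_const_mul]
  · refine (integrable_prod_iff' ?_).2 ⟨?_, ?_⟩
    · refine Measurable.aestronglyMeasurable ?_
      unfold Function.uncurry
      have h2 : Measurable fun a : ℂ × ℂ => conj (1 / (a.1 - a.2)) := hcm.comp (by fun_prop)
      have h3 : Measurable fun a : ℂ × ℂ => conj (oscPhase lam w a.2 * p a.2) := hcm.comp (by fun_prop)
      fun_prop
    -- At `y = z` the two Cauchy poles merge and the available bound is infinite, but this is a null
    -- set of `y`.
    · have h0 : ∀ᵐ y : ℂ, y ≠ z := by simp [ae_iff, measure_singleton]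
      filter_upwards [h0] with y hy
      simp only [Function.uncurry]
      refine Integrable.const_mul ⟨?_, ?_⟩ _
      · have h2 : Measurable fun a : ℂ => conj (1 / (a - y)) := hcm.comp (by fun_prop)
        exact Measurable.aestronglyMeasurable (by fun_prop)
      · refine (hD hq lam w z y).trans_lt (ENNReal.mul_lt_top ENNReal.ofReal_lt_top
          (ENNReal.mul_lt_top ENNReal.coe_lt_top ?_))
        have : z - y ≠ 0 := sub_ne_zero.2 (Ne.symm hy)
        exact ENNReal.rpow_lt_top_of_nonneg (by norm_num) (by simpa using this)
    · refine ⟨?_, ?_⟩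
      · refine StronglyMeasurable.aestronglyMeasurable (StronglyMeasurable.integral_prod_right'
          (f := fun a : ℂ × ℂ => ‖conj (oscPhase lam w a.1 * p a.1) * f a.1 *
          (oscPhase lam w a.2 / (z - a.2) * (q a.2 * conj (1 / (a.2 - a.1))))‖) ?_)
        refine Measurable.stronglyMeasurable ?_
        have h2 : Measurable fun a : ℂ × ℂ => conj (1 / (a.2 - a.1)) := hcm.comp (by fun_prop)
        have h3 : Measurable fun a : ℂ × ℂ => conj (oscPhase lam w a.1 * p a.1) :=
          hcm.comp (by fun_prop)
        fun_prop
      · have hb : ∀ y : ℂ, ‖∫ x, ‖Function.uncurry (fun x y => conj (oscPhase lam w y * p y) * f y *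
            (oscPhase lam w x / (z - x) * (q x * conj (1 / (x - y))))) (x, y)‖‖ₑ ≤
            ‖p y‖ₑ * (ENNReal.ofReal C * (ENNReal.ofReal A * (D * rieszKernel (1 / 2) (y - z)))) := by
          intro y
          refine (enorm_integral_le_lintegral_enorm _).trans ?_
          simp only [Function.uncurry, enorm_norm]
          simp_rw [enorm_mul (conj (oscPhase lam w y * p y) * f y)]
          rw [lintegral_const_mul' _ _ enorm_ne_top, enorm_mul, RCLike.enorm_conj, enorm_mul,
            enorm_oscPhase, one_mul, mul_assoc, rieszKernel_sub_comm]
          gcongr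
          · rw [← ofReal_norm]; exact ENNReal.ofReal_le_ofReal (hf y)
          · exact hD hq lam w z y
        refine lt_of_le_of_lt (lintegral_mono hb) ?_
        refine (hp.lintegral_mul_le _).trans_lt (ENNReal.mul_lt_top ENNReal.ofReal_lt_top ?_)
        rw [lintegral_const_mul' _ _ ENNReal.ofReal_ne_top,
          lintegral_const_mul' _ _ ENNReal.ofReal_ne_top, lintegral_const_mul' _ _ ENNReal.coe_ne_top]
        exact ENNReal.mul_lt_top ENNReal.ofReal_lt_top (ENNReal.mul_lt_top ENNReal.ofReal_lt_top
          (ENNReal.mul_lt_top ENNReal.coe_lt_top ((hK z).trans_lt ENNReal.coe_lt_top)))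

end

section

variable {ρ A : ℝ} {q p : ℂ → ℂ}

lemma integrable_crossKernel (hq : IsBddPotential ρ A q) (lam w : ℂ) {z y : ℂ} (h : y ≠ z) :
    Integrable fun x => oscPhase lam w x / (z - x) * (q x * conj (1 / (x - y))) := by
  have hqm := hq.measurable
  have hcm : Measurable (fun z : ℂ => conj z) := Complex.continuous_conj.measurable
  obtain ⟨D, hD⟩ := exists_enorm_crossKernel_le ρ
  refine ⟨?_, ?_⟩
  · have h2 : Measurable fun a : ℂ => conj (1 / (a - y)) := hcm.comp (by fun_prop)
    exact Measurable.aestronglyMeasurable (by fun_prop)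
  · refine (hD hq lam w z y).trans_lt (ENNReal.mul_lt_top ENNReal.ofReal_lt_top
      (ENNReal.mul_lt_top ENNReal.coe_lt_top ?_))
    have : z - y ≠ 0 := sub_ne_zero.2 (Ne.symm h)
    exact ENNReal.rpow_lt_top_of_nonneg (by norm_num) (by simpa using this)

/-- For `y ≠ z` the cross kernel is an oscillatory integral of a fixed integrable function, so the
Riemann-Lebesgue lemma applies; the Riesz kernel of order `1/2` dominates in `y`. -/
lemma tendsto_lintegral_crossKernel (hq : IsBddPotential ρ A q) (z : ℂ) :
    Tendsto (fun p : ℂ × ℂ => ∫⁻ y in Metric.ball (0 : ℂ) ρ, ‖crossKernel q p.1 p.2 z y‖ₑ)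
      largeParam (𝓝 0) := by
  obtain ⟨D, hD⟩ := exists_enorm_crossKernel_le ρ
  obtain ⟨K, hK⟩ := exists_setLIntegral_rieszKernel_le ρ (s := 1 / 2) (by norm_num) (by norm_num)
  rw [← lintegral_zero (μ := volume.restrict (Metric.ball (0 : ℂ) ρ))]
  refine tendsto_lintegral_filter_of_dominated_convergence
    (fun y => ENNReal.ofReal A * (D * rieszKernel (1 / 2) (y - z))) ?_ ?_ ?_ ?_
  · exact Eventually.of_forall fun p =>
      (stronglyMeasurable_crossKernel hq p.1 p.2 z).measurable.enorm
  · refine Eventually.of_forall fun p => Eventually.of_forall fun y => ?_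
    rw [rieszKernel_sub_comm]
    exact (enorm_integral_le_lintegral_enorm _).trans (hD hq _ _ _ _)
  · rw [lintegral_const_mul' _ _ ENNReal.ofReal_ne_top, lintegral_const_mul' _ _ ENNReal.coe_ne_top]
    exact (ENNReal.mul_lt_top ENNReal.ofReal_lt_top
      (ENNReal.mul_lt_top ENNReal.coe_lt_top ((hK z).trans_lt ENNReal.coe_lt_top))).ne
  · have h0 : ∀ᵐ y : ℂ, y ≠ z := by simp [ae_iff, measure_singleton]
    filter_upwards [ae_restrict_of_ae h0] with y hy
    have hF : Integrable fun x => 1 / (z - x) * (q x * conj (1 / (x - y))) := by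
      -- With `lam = 0` and `w = 0` the phase is identically one.
      have := integrable_crossKernel hq 0 0 hy
      simpa [oscPhase] using this
    have := (tendsto_integral_oscPhase_mul hF).enorm
    rw [enorm_zero] at this
    refine this.congr fun p => ?_
    rw [crossKernel]
    congr 2; ext x; ring

/-- Equicontinuity in `z`, uniform in `lam` and `w`: the phase has modulus one, so only the
increment of the outer Cauchy kernel matters. -/
lemma exists_lintegral_crossKernel_le_add (hq : IsBddPotential ρ A q) : ∃ D : ℝ≥0, ∀ lam w z₁ z₂ : ℂ,
    ∫⁻ y in Metric.ball (0 : ℂ) ρ, ‖crossKernel q lam w z₂ y‖ₑ ≤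
      (∫⁻ y in Metric.ball (0 : ℂ) ρ, ‖crossKernel q lam w z₁ y‖ₑ) + D * ‖z₂ - z₁‖ₑ ^ (1 / 2 : ℝ) := by
  obtain ⟨D, hD⟩ := exists_setLIntegral_inv_sub_le ρ
  obtain ⟨K, hK⟩ := exists_setLIntegral_rieszKernel_le ρ (s := 1) (by norm_num) (by norm_num)
  have hqm := hq.measurable
  refine ⟨A.toNNReal * (K * D), fun lam w z₁ z₂ => ?_⟩
  have hae : ∀ᵐ y : ℂ, ‖crossKernel q lam w z₂ y‖ₑ ≤ ‖crossKernel q lam w z₁ y‖ₑ +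
      ∫⁻ x, ‖q x‖ₑ * (‖(z₂ - x)⁻¹ - (z₁ - x)⁻¹‖ₑ * rieszKernel 1 (y - x)) := by
    have h1 : ∀ᵐ y : ℂ, y ≠ z₁ := by simp [ae_iff, measure_singleton]
    have h2 : ∀ᵐ y : ℂ, y ≠ z₂ := by simp [ae_iff, measure_singleton]
    filter_upwards [h1, h2] with y hy1 hy2
    have : crossKernel q lam w z₂ y = crossKernel q lam w z₁ y +
        (crossKernel q lam w z₂ y - crossKernel q lam w z₁ y) := by ring
    rw [this]
    refine (enorm_add_le _ _).trans ?_
    gcongr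
    rw [crossKernel, crossKernel, ← integral_sub (integrable_crossKernel hq lam w hy2)
      (integrable_crossKernel hq lam w hy1)]
    refine (enorm_integral_le_lintegral_enorm _).trans (lintegral_mono fun x => ?_)
    rw [show oscPhase lam w x / (z₂ - x) * (q x * conj (1 / (x - y))) -
      oscPhase lam w x / (z₁ - x) * (q x * conj (1 / (x - y))) =
      oscPhase lam w x * (q x * (((z₂ - x)⁻¹ - (z₁ - x)⁻¹) * conj (1 / (x - y)))) by
        simp only [div_eq_mul_inv]; ring, enorm_mul, enorm_oscPhase, one_mul, enorm_mul, enorm_mul,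
      RCLike.enorm_conj]
    gcongr
    rw [rieszKernel_sub_comm]
    exact enorm_div_sub_le _ _ (by simp)
  calc _ ≤ ∫⁻ y in Metric.ball (0 : ℂ) ρ, (‖crossKernel q lam w z₁ y‖ₑ +
      ∫⁻ x, ‖q x‖ₑ * (‖(z₂ - x)⁻¹ - (z₁ - x)⁻¹‖ₑ * rieszKernel 1 (y - x))) :=
        lintegral_mono_ae (ae_restrict_of_ae hae)
    _ = (∫⁻ y in Metric.ball (0 : ℂ) ρ, ‖crossKernel q lam w z₁ y‖ₑ) +
      ∫⁻ y in Metric.ball (0 : ℂ) ρ,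
        ∫⁻ x, ‖q x‖ₑ * (‖(z₂ - x)⁻¹ - (z₁ - x)⁻¹‖ₑ * rieszKernel 1 (y - x)) :=
        lintegral_add_left (stronglyMeasurable_crossKernel hq _ _ _).measurable.enorm _
    _ = (∫⁻ y in Metric.ball (0 : ℂ) ρ, ‖crossKernel q lam w z₁ y‖ₑ) +
      ∫⁻ x, ‖q x‖ₑ * (‖(z₂ - x)⁻¹ - (z₁ - x)⁻¹‖ₑ *
        ∫⁻ y in Metric.ball (0 : ℂ) ρ, rieszKernel 1 (y - x)) := by
        rw [lintegral_lintegral_swap]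
        · congr 2; ext x
          rw [lintegral_const_mul' _ _ enorm_ne_top, lintegral_const_mul' _ _ enorm_ne_top]
        · refine Measurable.aemeasurable ?_
          unfold Function.uncurry
          fun_prop
    _ ≤ (∫⁻ y in Metric.ball (0 : ℂ) ρ, ‖crossKernel q lam w z₁ y‖ₑ) +
      ENNReal.ofReal A * (K * (D * ‖z₂ - z₁‖ₑ ^ (1 / 2 : ℝ))) := by
        gcongr
        refine (hq.lintegral_mul_le _).trans ?_
        gcongr
        calc _ ≤ ∫⁻ x in Metric.ball (0 : ℂ) ρ, K * ‖(z₂ - x)⁻¹ - (z₁ - x)⁻¹‖ₑ := by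
              refine lintegral_mono fun x => ?_
              rw [mul_comm]; gcongr; exact hK x
          _ ≤ _ := by
              rw [lintegral_const_mul' _ _ ENNReal.coe_ne_top]; gcongr; exact hD _ _
    _ = _ := by
        push_cast
        simp only [ENNReal.ofReal]
        ring

lemma exists_lintegral_crossKernel_le_far (hq : IsBddPotential ρ A q) : ∃ D : ℝ≥0, ∀ lam w z : ℂ,
    ∫⁻ y in Metric.ball (0 : ℂ) ρ, ‖crossKernel q lam w z y‖ₑ ≤
      D * ∫⁻ x in Metric.ball (0 : ℂ) ρ, rieszKernel 1 (x - z) := by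
  obtain ⟨K, hK⟩ := exists_setLIntegral_rieszKernel_le ρ (s := 1) (by norm_num) (by norm_num)
  refine ⟨A.toNNReal * K, fun lam w z => ?_⟩
  calc _ ≤ ∫⁻ y in Metric.ball (0 : ℂ) ρ, ENNReal.ofReal A *
        ∫⁻ x in Metric.ball 0 ρ, rieszKernel 1 (x - z) * rieszKernel 1 (y - x) := by
        refine lintegral_mono fun y => (enorm_integral_le_lintegral_enorm _).trans ?_
        simp_rw [rieszKernel_sub_comm 1 y]
        exact lintegral_crossKernel_le hq lam w z y
    _ = ENNReal.ofReal A * ∫⁻ x in Metric.ball (0 : ℂ) ρ, rieszKernel 1 (x - z) *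
        ∫⁻ y in Metric.ball (0 : ℂ) ρ, rieszKernel 1 (y - x) := by
        rw [lintegral_const_mul' _ _ ENNReal.ofReal_ne_top, lintegral_lintegral_swap]
        · congr 2; ext x
          rw [lintegral_const_mul _ (by fun_prop)]
        · refine Measurable.aemeasurable ?_
          unfold Function.uncurry
          fun_prop
    _ ≤ ENNReal.ofReal A * ∫⁻ x in Metric.ball (0 : ℂ) ρ, K * rieszKernel 1 (x - z) := by
        gcongr ENNReal.ofReal A * ?_
        refine lintegral_mono fun x => ?_
        rw [mul_comm]; gcongr; exact hK x
    _ = _ := by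
        rw [lintegral_const_mul' _ _ ENNReal.coe_ne_top]
        push_cast
        simp only [ENNReal.ofReal]
        ring

/-- Smallness for each `z` becomes uniform: far away the Cauchy kernel is small for all parameters,
and on the remaining compact set equicontinuity reduces the claim to finitely many points. -/
lemma eventually_lintegral_crossKernel_le (hq : IsBddPotential ρ A q) {ε : ℝ≥0∞} (hε : 0 < ε) :
    ∀ᶠ p in largeParam, ∀ z, ∫⁻ y in Metric.ball (0 : ℂ) ρ, ‖crossKernel q p.1 p.2 z y‖ₑ ≤ ε := by
  obtain ⟨D₁, hD₁⟩ := exists_lintegral_crossKernel_le_far hq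
  obtain ⟨D₂, hD₂⟩ := exists_lintegral_crossKernel_le_add hq
  have hfar : ∀ᶠ z in cocompact ℂ, ∀ lam w : ℂ,
      ∫⁻ y in Metric.ball (0 : ℂ) ρ, ‖crossKernel q lam w z y‖ₑ ≤ ε := by
    have h := ENNReal.Tendsto.const_mul (a := (D₁ : ℝ≥0∞))
      (tendsto_setLIntegral_rieszKernel_one ρ) (Or.inr ENNReal.coe_ne_top)
    rw [mul_zero] at h
    filter_upwards [h.eventually (ge_mem_nhds hε)] with z hz lam w
    exact (hD₁ lam w z).trans hz
  obtain ⟨K, hK, hKs⟩ := (hasBasis_cocompact.eventually_iff).1 hfar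
  have hK' : IsCompact K := hK
  have hnear : ∀ᶠ p in largeParam, ∀ z ∈ K,
      ∫⁻ y in Metric.ball (0 : ℂ) ρ, ‖crossKernel q p.1 p.2 z y‖ₑ ≤ ε := by
    have hε2 : 0 < ε / 2 := ENNReal.half_pos hε.ne'
    have hc : ∀ z₀ : ℂ, ∀ᶠ z in 𝓝 z₀, (D₂ : ℝ≥0∞) * ‖z - z₀‖ₑ ^ (1 / 2 : ℝ) ≤ ε / 2 := by
      intro z₀
      have h1 : Tendsto (fun z : ℂ => ‖z - z₀‖ₑ) (𝓝 z₀) (𝓝 0) := by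
        have : Continuous fun z : ℂ => ‖z - z₀‖ₑ := by fun_prop
        simpa using this.tendsto z₀
      have h2 : Tendsto (fun z : ℂ => (D₂ : ℝ≥0∞) * ‖z - z₀‖ₑ ^ (1 / 2 : ℝ)) (𝓝 z₀) (𝓝 0) := by
        have := ENNReal.Tendsto.const_mul (a := (D₂ : ℝ≥0∞))
          (h1.ennrpow_const (1 / 2 : ℝ)) (Or.inr ENNReal.coe_ne_top)
        rwa [ENNReal.zero_rpow_of_pos (by norm_num), mul_zero] at this
      exact h2.eventually (ge_mem_nhds hε2)
    obtain ⟨t, _, ht⟩ := hK'.elim_nhds_subcover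
      (fun z₀ => {z | (D₂ : ℝ≥0∞) * ‖z - z₀‖ₑ ^ (1 / 2 : ℝ) ≤ ε / 2}) fun z₀ _ => hc z₀
    have hfin : ∀ᶠ p in largeParam, ∀ z₀ ∈ t,
        ∫⁻ y in Metric.ball (0 : ℂ) ρ, ‖crossKernel q p.1 p.2 z₀ y‖ₑ ≤ ε / 2 :=
      (eventually_all_finset t).2 fun z₀ _ =>
        (tendsto_lintegral_crossKernel hq z₀).eventually (ge_mem_nhds hε2)
    filter_upwards [hfin] with p hp z hz
    obtain ⟨z₀, hz₀, hzz⟩ := Set.mem_iUnion₂.1 (ht hz)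
    calc _ ≤ _ := hD₂ p.1 p.2 z₀ z
      _ ≤ ε / 2 + ε / 2 := add_le_add (hp z₀ hz₀) hzz
      _ = ε := ENNReal.add_halves ε
  filter_upwards [hnear] with p hp z
  by_cases hz : z ∈ K
  · exact hp z hz
  · exact hKs hz p.1 p.2

/-! ### Contraction, and unique solvability of the scalar system. -/

/-- The smallness condition making the iterated Lippmann–Schwinger operator a contraction. -/
def IsContractive (ρ A : ℝ) (q : ℂ → ℂ) (lam w : ℂ) : Prop :=
  ∀ z, ENNReal.ofReal A * ∫⁻ y in Metric.ball (0 : ℂ) ρ, ‖crossKernel q lam w z y‖ₑ ≤ 1 / 2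

lemma exists_isContractive (hq : IsBddPotential ρ A q) :
    ∃ R : ℝ, 0 < R ∧ ∀ lam w : ℂ, R < ‖lam‖ → IsContractive ρ A q lam w := by
  -- Adding `1` keeps the divisor nonzero when `A = 0`.
  have hpos : 0 < (1 / 2 : ℝ≥0∞) / (ENNReal.ofReal A + 1) :=
    ENNReal.div_pos (by simp) (by simp)
  refine eventually_largeParam (P := fun p => IsContractive ρ A q p.1 p.2) ?_
  filter_upwards [eventually_lintegral_crossKernel_le hq hpos] with p hp z
  calc _ ≤ (ENNReal.ofReal A + 1) * ((1 / 2 : ℝ≥0∞) / (ENNReal.ofReal A + 1)) := by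
        gcongr
        · exact le_self_add
        · exact hp z
    _ = 1 / 2 := ENNReal.mul_div_cancel (by simp) (by simp)

/-- The iterated Lippmann–Schwinger operator, which is complex linear. -/
def lsSq (q p : ℂ → ℂ) (lam w : ℂ) (f : ℂ → ℂ) (z : ℂ) : ℂ :=
  lsOp q lam w (fun x => conj (lsOp p lam w (fun y => conj (f y)) x)) z

lemma norm_lsSq_le (hq : IsBddPotential ρ A q) (hp : IsBddPotential ρ A p) {lam w : ℂ}
    (hc : IsContractive ρ A q lam w) {f : ℂ → ℂ} (hfm : Measurable f) {C : ℝ}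
    (hf : ∀ z, ‖f z‖ ≤ C) (z : ℂ) : ‖lsSq q p lam w f z‖ ≤ C / 2 := by
  have hC : 0 ≤ C := (norm_nonneg _).trans (hf 0)
  have : ‖lsSq q p lam w f z‖ₑ ≤ ENNReal.ofReal C * (1 / 2) := by
    rw [lsSq, lsOp_conj_lsOp_conj hq hp lam w hfm hf, enorm_mul, enorm_pow]
    calc _ ≤ 1 ^ 2 * ∫⁻ y, ‖p y‖ₑ * (ENNReal.ofReal C * ‖crossKernel q lam w z y‖ₑ) := by
          gcongr
          · exact enorm_one_div_pi_le
          · refine (enorm_integral_le_lintegral_enorm _).trans (lintegral_mono fun y => ?_)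
            rw [enorm_mul, enorm_mul, RCLike.enorm_conj, enorm_mul, enorm_oscPhase, one_mul, mul_assoc]
            gcongr
            rw [← ofReal_norm]; exact ENNReal.ofReal_le_ofReal (hf y)
      _ ≤ ENNReal.ofReal A * ∫⁻ y in Metric.ball 0 ρ,
            ENNReal.ofReal C * ‖crossKernel q lam w z y‖ₑ := by
          rw [one_pow, one_mul]; exact hp.lintegral_mul_le _
      _ = ENNReal.ofReal C * (ENNReal.ofReal A * ∫⁻ y in Metric.ball 0 ρ,
            ‖crossKernel q lam w z y‖ₑ) := by
          rw [lintegral_const_mul' _ _ ENNReal.ofReal_ne_top]; ring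
      _ ≤ _ := by gcongr; exact hc z
  rw [← ofReal_norm, show (1 / 2 : ℝ≥0∞) = ENNReal.ofReal (1 / 2) by
    rw [ENNReal.ofReal_div_of_pos (by norm_num)]; simp, ← ENNReal.ofReal_mul hC] at this
  have := (ENNReal.ofReal_le_ofReal_iff (by positivity)).1 this
  linarith

lemma measurable_conj_comp {X : Type*} [MeasurableSpace X] {f : X → ℂ} (hf : Measurable f) : Measurable fun x => conj (f x) :=
  Complex.continuous_conj.measurable.comp hf

lemma norm_conj_le {f : ℂ → ℂ} {C : ℝ} (hf : ∀ z, ‖f z‖ ≤ C) (z : ℂ) : ‖conj (f z)‖ ≤ C := by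
  rw [RCLike.norm_conj]; exact hf z

lemma exists_norm_lsOp_conj_le (hp : IsBddPotential ρ A p) (lam w : ℂ) {f : ℂ → ℂ} {C : ℝ}
    (hf : ∀ z, ‖f z‖ ≤ C) : ∃ C', ∀ z, ‖conj (lsOp p lam w (fun y => conj (f y)) z)‖ ≤ C' := by
  obtain ⟨C₀, _, h⟩ := exists_norm_lsOp_le ρ
  exact ⟨_, norm_conj_le (h hp lam w (norm_conj_le hf))⟩

lemma measurable_lsOp (hq : IsBddPotential ρ A q) (lam w : ℂ) {f : ℂ → ℂ} (hfm : Measurable f) {C : ℝ}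
    (hf : ∀ z, ‖f z‖ ≤ C) : Measurable (lsOp q lam w f) :=
  (continuous_lsOp hq lam w hfm hf).measurable

lemma continuous_lsSq (hq : IsBddPotential ρ A q) (hp : IsBddPotential ρ A p) (lam w : ℂ)
    {f : ℂ → ℂ} (hfm : Measurable f) {C : ℝ} (hf : ∀ z, ‖f z‖ ≤ C) :
    Continuous (lsSq q p lam w f) := by
  obtain ⟨C', h'⟩ := exists_norm_lsOp_conj_le hp lam w hf
  exact continuous_lsOp hq lam w (measurable_conj_comp
    (measurable_lsOp hp lam w (measurable_conj_comp hfm) (norm_conj_le hf))) h'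

lemma lsSq_sub (hq : IsBddPotential ρ A q) (hp : IsBddPotential ρ A p) (lam w : ℂ)
    {f g : ℂ → ℂ} (hfm : Measurable f) (hgm : Measurable g) {C C' : ℝ} (hf : ∀ z, ‖f z‖ ≤ C)
    (hg : ∀ z, ‖g z‖ ≤ C') (z : ℂ) :
    lsSq q p lam w (fun z => f z - g z) z = lsSq q p lam w f z - lsSq q p lam w g z := by
  obtain ⟨D, hD⟩ := exists_norm_lsOp_conj_le hp lam w hf
  obtain ⟨D', hD'⟩ := exists_norm_lsOp_conj_le hp lam w hg
  unfold lsSq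
  rw [← lsOp_sub hq lam w (measurable_conj_comp
    (measurable_lsOp hp lam w (measurable_conj_comp hfm) (norm_conj_le hf)))
    (measurable_conj_comp
    (measurable_lsOp hp lam w (measurable_conj_comp hgm) (norm_conj_le hg))) hD hD']
  congr 1; ext x
  rw [← map_sub, ← lsOp_sub hp lam w (measurable_conj_comp hfm) (measurable_conj_comp hgm)
    (norm_conj_le hf) (norm_conj_le hg)]
  simp only [map_sub]

/-- The absorption argument, with `C` the supremum of `‖d‖`. The a priori bound `C₀` serves only to
make this supremum finite and does not enter the conclusion. -/
lemma norm_le_of_forall_norm_le_half {d : ℂ → ℂ} {C₀ : ℝ} (hb : ∀ z, ‖d z‖ ≤ C₀) {E : ℝ}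
    (h : ∀ C, (∀ z, ‖d z‖ ≤ C) → ∀ z, ‖d z‖ ≤ E + C / 2) (z : ℂ) : ‖d z‖ ≤ 2 * E := by
  have hbdd : BddAbove (Set.range fun z => ‖d z‖) := ⟨C₀, by rintro _ ⟨z, rfl⟩; exact hb z⟩
  have h1 := h (⨆ z, ‖d z‖) fun z => le_ciSup hbdd z
  have h2 : (⨆ z, ‖d z‖) ≤ E + (⨆ z, ‖d z‖) / 2 := ciSup_le h1
  have h3 := le_ciSup hbdd z
  linarith

/-- A bounded solution of the scalar Lippmann–Schwinger system satisfied by a column of `μ`. -/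
structure IsScalarSolution (q p : ℂ → ℂ) (lam w : ℂ) (a b : ℂ → ℂ) : Prop where
  measurable_fst : Measurable a
  measurable_snd : Measurable b
  bdd_fst : ∃ C : ℝ, ∀ z, ‖a z‖ ≤ C
  bdd_snd : ∃ C : ℝ, ∀ z, ‖b z‖ ≤ C
  fst_eq : ∀ z, a z = 1 + lsOp q lam w (fun x => conj (b x)) z
  snd_eq : ∀ z, b z = lsOp p lam w (fun x => conj (a x)) z

namespace IsScalarSolution

variable {lam w : ℂ} {a b : ℂ → ℂ}

lemma fst_eq_lsSq (h : IsScalarSolution q p lam w a b) (z : ℂ) : a z = 1 + lsSq q p lam w a z := by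
  rw [h.fst_eq, lsSq]
  simp_rw [h.snd_eq]

lemma norm_fst_le (h : IsScalarSolution q p lam w a b) (hq : IsBddPotential ρ A q)
    (hp : IsBddPotential ρ A p) (hc : IsContractive ρ A q lam w) (z : ℂ) : ‖a z‖ ≤ 2 := by
  obtain ⟨C₀, hC₀⟩ := h.bdd_fst
  have := norm_le_of_forall_norm_le_half hC₀ (E := 1) (fun C hC z => by
    rw [h.fst_eq_lsSq]
    refine (norm_add_le _ _).trans ?_
    rw [norm_one]
    gcongr
    exact norm_lsSq_le hq hp hc h.measurable_fst hC z) z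
  linarith

end IsScalarSolution

/-- The difference of two first components is fixed by the linear operator `lsSq`, which halves sup
norms. The second component is a function of the first. -/
lemma IsScalarSolution.unique {lam w : ℂ} {a b a' b' : ℂ → ℂ} (h : IsScalarSolution q p lam w a b)
    (h' : IsScalarSolution q p lam w a' b') (hq : IsBddPotential ρ A q)
    (hp : IsBddPotential ρ A p) (hc : IsContractive ρ A q lam w) : a = a' ∧ b = b' := by
  have ha : a = a' := by
    obtain ⟨C₀, hC₀⟩ := h.bdd_fst
    obtain ⟨C₁, hC₁⟩ := h'.bdd_fst
    have key := norm_le_of_forall_norm_le_half (d := fun z => a z - a' z) (C₀ := C₀ + C₁)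
      (fun z => (norm_sub_le _ _).trans (add_le_add (hC₀ z) (hC₁ z))) (E := 0) (fun C hC z => by
        have e : a z - a' z = lsSq q p lam w (fun z => a z - a' z) z := by
          rw [lsSq_sub hq hp lam w h.measurable_fst h'.measurable_fst hC₀ hC₁]
          conv_lhs => rw [h.fst_eq_lsSq, h'.fst_eq_lsSq]
          ring
        rw [zero_add, e]
        exact norm_lsSq_le hq hp hc (h.measurable_fst.sub h'.measurable_fst) hC z)
    ext z
    have := key z
    rw [mul_zero, norm_le_zero_iff, sub_eq_zero] at this
    exact this
  refine ⟨ha, ?_⟩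
  ext z
  rw [h.snd_eq, h'.snd_eq, ha]

open BoundedContinuousFunction in
-- Banach's fixed point theorem gives `a`; then `b` is defined by the second equation. Smallness is
-- needed only for the cross kernel of `q`.
lemma exists_isScalarSolution (hq : IsBddPotential ρ A q) (hp : IsBddPotential ρ A p) {lam w : ℂ}
    (hc : IsContractive ρ A q lam w) : ∃ a b, IsScalarSolution q p lam w a b := by
  have hbd : ∀ f : ℂ →ᵇ ℂ, ∀ z, ‖f z‖ ≤ ‖f‖ := fun f z => f.norm_coe_le_norm z
  let T : (ℂ →ᵇ ℂ) → (ℂ →ᵇ ℂ) := fun f =>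
    BoundedContinuousFunction.ofNormedAddCommGroup (fun z => 1 + lsSq q p lam w f z)
      (continuous_const.add (continuous_lsSq hq hp lam w f.continuous.measurable (hbd f)))
      (1 + ‖f‖ / 2) (fun z => by
        refine (norm_add_le _ _).trans ?_
        rw [norm_one]
        gcongr
        exact norm_lsSq_le hq hp hc f.continuous.measurable (hbd f) z)
  have hT : ContractingWith (1 / 2 : ℝ≥0) T := by
    refine ⟨by rw [← NNReal.coe_lt_coe]; norm_num, LipschitzWith.of_dist_le_mul fun f g => ?_⟩
    rw [BoundedContinuousFunction.dist_le (by positivity)]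
    intro z
    rw [dist_eq_norm]
    have e : T f z - T g z = lsSq q p lam w (fun z => f z - g z) z := by
      rw [lsSq_sub hq hp lam w f.continuous.measurable g.continuous.measurable (hbd f) (hbd g)]
      simp [T]
    rw [e]
    have := norm_lsSq_le hq hp hc (f.continuous.measurable.sub g.continuous.measurable)
      (C := dist f g) (fun z => (dist_eq_norm (f z) (g z)).symm.trans_le (f.dist_coe_le_dist z)) z
    refine this.trans (le_of_eq ?_)
    push_cast; ring
  obtain ⟨a, ha⟩ : ∃ a : ℂ →ᵇ ℂ, T a = a := ⟨_, hT.fixedPoint_isFixedPt⟩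
  have ham := a.continuous.measurable
  obtain ⟨C₀, _, hL⟩ := exists_norm_lsOp_le ρ
  refine ⟨a, lsOp p lam w fun x => conj (a x), ham,
    measurable_lsOp hp lam w (measurable_conj_comp ham) (norm_conj_le (hbd a)), ⟨_, hbd a⟩,
    ⟨_, hL hp lam w (norm_conj_le (hbd a))⟩, fun z => ?_, fun z => rfl⟩
  conv_lhs => rw [← ha]
  rfl

end

/-! ### Measurable dependence of the solution on the parameters. -/

section

variable {ρ A : ℝ} {q p : ℂ → ℂ}

lemma measurable_lsOp_param (hq : IsBddPotential ρ A q) {F : ℂ × ℂ → ℂ → ℂ}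
    (hF : Measurable fun t : (ℂ × ℂ) × ℂ => F t.1 t.2) :
    Measurable fun t : (ℂ × ℂ) × ℂ => lsOp q t.1.1 t.1.2 (F t.1) t.2 := by
  have hqm := hq.measurable
  refine (StronglyMeasurable.measurable ?_).const_mul _
  refine StronglyMeasurable.integral_prod_right'
    (f := fun s : ((ℂ × ℂ) × ℂ) × ℂ => oscPhase s.1.1.1 s.1.1.2 s.2 / (s.1.2 - s.2) *
      (q s.2 * F s.1.1 s.2)) ?_
  refine Measurable.stronglyMeasurable ?_
  have : Measurable fun s : ((ℂ × ℂ) × ℂ) × ℂ => F s.1.1 s.2 :=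
    hF.comp (measurable_fst.fst.prodMk measurable_snd)
  fun_prop

/-- The Neumann iterates of the Lippmann–Schwinger equation. -/
def lsIter (q p : ℂ → ℂ) : ℕ → ℂ × ℂ → ℂ → ℂ
  | 0, _, _ => 1
  | n + 1, P, z => 1 + lsSq q p P.1 P.2 (lsIter q p n P) z

lemma measurable_lsIter (hq : IsBddPotential ρ A q) (hp : IsBddPotential ρ A p) (n : ℕ) :
    Measurable fun t : (ℂ × ℂ) × ℂ => lsIter q p n t.1 t.2 := by
  induction n with
  | zero => exact measurable_const
  | succ n ih =>
    have h1 := measurable_lsOp_param (F := fun P x => conj (lsIter q p n P x)) hp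
      (measurable_conj_comp ih)
    exact (measurable_lsOp_param (F := fun P x => conj (lsOp p P.1 P.2
      (fun y => conj (lsIter q p n P y)) x)) hq (measurable_conj_comp h1)).const_add 1

lemma norm_lsIter_sub_le (hq : IsBddPotential ρ A q) (hp : IsBddPotential ρ A p) {P : ℂ × ℂ}
    (hc : IsContractive ρ A q P.1 P.2) {a b : ℂ → ℂ} (h : IsScalarSolution q p P.1 P.2 a b) (n : ℕ)
    (z : ℂ) : ‖lsIter q p n P z - a z‖ ≤ 3 * (1 / 2) ^ n := by
  have ha := h.norm_fst_le hq hp hc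
  induction n generalizing z with
  | zero =>
    refine (norm_sub_le _ _).trans ?_
    have := ha z
    simp only [lsIter, norm_one]
    linarith
  | succ n ih =>
    have hm : Measurable (lsIter q p n P) := (measurable_lsIter hq hp n).comp measurable_prodMk_left
    have hb : ∀ z, ‖lsIter q p n P z‖ ≤ 3 * (1 / 2) ^ n + 2 := fun z => by
      have := norm_add_le (lsIter q p n P z - a z) (a z)
      rw [sub_add_cancel] at this
      linarith [ih z, ha z]
    have e : lsIter q p (n + 1) P z - a z =
        lsSq q p P.1 P.2 (fun z => lsIter q p n P z - a z) z := by
      rw [lsSq_sub hq hp _ _ hm h.measurable_fst hb ha, lsIter]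
      conv_lhs => rw [h.fst_eq_lsSq]
      ring
    rw [e]
    refine (norm_lsSq_le hq hp hc (hm.sub h.measurable_fst) ih z).trans (le_of_eq ?_)
    rw [pow_succ]; ring

lemma measurableSet_param (R : ℝ) : MeasurableSet {t : (ℂ × ℂ) × ℂ | R < ‖t.1.1‖} :=
  measurableSet_lt measurable_const (by fun_prop)

/-- A solution is given separately for each parameter, so joint measurability has to be proved. It
holds because the solution is the limit of the Neumann iterates, which are explicit parametric
integrals. -/
lemma measurable_fst_param (hq : IsBddPotential ρ A q) (hp : IsBddPotential ρ A p) {R : ℝ}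
    (hc : ∀ P : ℂ × ℂ, R < ‖P.1‖ → IsContractive ρ A q P.1 P.2) {a b : ℂ × ℂ → ℂ → ℂ}
    (h : ∀ P : ℂ × ℂ, R < ‖P.1‖ → IsScalarSolution q p P.1 P.2 (a P) (b P)) :
    Measurable fun t : (ℂ × ℂ) × ℂ => {t : (ℂ × ℂ) × ℂ | R < ‖t.1.1‖}.indicator
      (fun t => a t.1 t.2) t := by
  refine measurable_of_tendsto_metrizable (f := fun n t =>
    {t : (ℂ × ℂ) × ℂ | R < ‖t.1.1‖}.indicator (fun t => lsIter q p n t.1 t.2) t)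
    (fun n => (measurable_lsIter hq hp n).indicator (measurableSet_param R)) ?_
  rw [tendsto_pi_nhds]
  intro t
  by_cases ht : R < ‖t.1.1‖
  · simp only [Set.indicator_of_mem (show t ∈ {t : (ℂ × ℂ) × ℂ | R < ‖t.1.1‖} from ht)]
    rw [tendsto_iff_norm_sub_tendsto_zero]
    have hz : Tendsto (fun n : ℕ => (3:ℝ) * (1 / 2) ^ n) atTop (𝓝 (3 * 0)) :=
      (tendsto_pow_atTop_nhds_zero_of_lt_one (by norm_num) (by norm_num)).const_mul 3
    rw [mul_zero] at hz
    exact squeeze_zero (fun _ => norm_nonneg _)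
      (fun n => norm_lsIter_sub_le hq hp (hc _ ht) (h _ ht) n t.2) hz
  · simp only [Set.indicator_of_notMem (show t ∉ {t : (ℂ × ℂ) × ℂ | R < ‖t.1.1‖} from ht)]
    exact tendsto_const_nhds

lemma measurable_snd_param (hq : IsBddPotential ρ A q) (hp : IsBddPotential ρ A p) {R : ℝ}
    (hc : ∀ P : ℂ × ℂ, R < ‖P.1‖ → IsContractive ρ A q P.1 P.2) {a b : ℂ × ℂ → ℂ → ℂ}
    (h : ∀ P : ℂ × ℂ, R < ‖P.1‖ → IsScalarSolution q p P.1 P.2 (a P) (b P)) :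
    Measurable fun t : (ℂ × ℂ) × ℂ => {t : (ℂ × ℂ) × ℂ | R < ‖t.1.1‖}.indicator
      (fun t => b t.1 t.2) t := by
  have h1 := (measurable_lsOp_param (F := fun P x => conj
    ({t : (ℂ × ℂ) × ℂ | R < ‖t.1.1‖}.indicator (fun t => a t.1 t.2) (P, x))) hp
    (measurable_conj_comp (measurable_fst_param hq hp hc h))).indicator (measurableSet_param R)
  convert h1 using 1
  ext t
  by_cases ht : R < ‖t.1.1‖
  · rw [Set.indicator_of_mem (show t ∈ {t : (ℂ × ℂ) × ℂ | R < ‖t.1.1‖} from ht),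
      Set.indicator_of_mem (show t ∈ {t : (ℂ × ℂ) × ℂ | R < ‖t.1.1‖} from ht), (h _ ht).snd_eq]
    congr 1
    ext x
    rw [Set.indicator_of_mem (show (t.1, x) ∈ {t : (ℂ × ℂ) × ℂ | R < ‖t.1.1‖} from ht)]
  · rw [Set.indicator_of_notMem (show t ∉ {t : (ℂ × ℂ) × ℂ | R < ‖t.1.1‖} from ht),
      Set.indicator_of_notMem (show t ∉ {t : (ℂ × ℂ) × ℂ | R < ‖t.1.1‖} from ht)]

/-! ### Bounding the solution by its first Neumann term. -/

/-- The Riesz potential over a ball of a nonnegative function. -/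
def rieszPot (ρ s : ℝ) (f : ℂ → ℝ≥0∞) (z : ℂ) : ℝ≥0∞ :=
  ∫⁻ x in Metric.ball (0 : ℂ) ρ, rieszKernel s (x - z) * f x

lemma rieszPot_mono {s : ℝ} {f g : ℂ → ℝ≥0∞} (h : ∀ x ∈ Metric.ball (0 : ℂ) ρ, f x ≤ g x) (z : ℂ) :
    rieszPot ρ s f z ≤ rieszPot ρ s g z :=
  setLIntegral_mono' measurableSet_ball fun x hx => by gcongr; exact h x hx

lemma rieszPot_const_mul {s : ℝ} {f : ℂ → ℝ≥0∞} (hf : Measurable f) (c : ℝ≥0∞) (z : ℂ) :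
    rieszPot ρ s (fun x => c * f x) z = c * rieszPot ρ s f z := by
  unfold rieszPot
  simp_rw [mul_left_comm _ c]
  rw [lintegral_const_mul _ (by fun_prop)]

lemma measurable_rieszPot {s : ℝ} {f : ℂ → ℝ≥0∞} (hf : Measurable f) : Measurable (rieszPot ρ s f) := by
  refine Measurable.lintegral_prod_right' (f := fun t : ℂ × ℂ => rieszKernel s (t.2 - t.1) * f t.2) ?_
  fun_prop

lemma exists_rieszPot_rieszPot_le (ρ : ℝ) {s t κ : ℝ} (hκ : 0 ≤ κ) (hs : κ ≤ s)
    (ht : κ ≤ t) (hst : s + t - κ < 2) : ∃ C : ℝ≥0, ∀ f : ℂ → ℝ≥0∞, Measurable f → ∀ z,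
      rieszPot ρ s (rieszPot ρ t f) z ≤ C * rieszPot ρ κ f z := by
  obtain ⟨C, hC⟩ := exists_setLIntegral_rieszKernel_mul_le ρ hκ hs ht hst
  refine ⟨C, fun f hf z => ?_⟩
  calc rieszPot ρ s (rieszPot ρ t f) z
      = ∫⁻ y in Metric.ball (0 : ℂ) ρ, ∫⁻ x in Metric.ball (0 : ℂ) ρ,
        rieszKernel s (y - z) * (rieszKernel t (x - y) * f x) := by
        unfold rieszPot
        congr 1; ext y
        rw [lintegral_const_mul _ (by fun_prop)]
    _ = ∫⁻ x in Metric.ball (0 : ℂ) ρ, ∫⁻ y in Metric.ball (0 : ℂ) ρ,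
        rieszKernel s (y - z) * (rieszKernel t (x - y) * f x) := by
        rw [lintegral_lintegral_swap]
        refine Measurable.aemeasurable ?_
        unfold Function.uncurry
        fun_prop
    _ ≤ ∫⁻ x in Metric.ball (0 : ℂ) ρ, C * (rieszKernel κ (x - z) * f x) := by
        refine lintegral_mono fun x => ?_
        simp_rw [rieszKernel_sub_comm t x, ← mul_assoc]
        rw [lintegral_mul_const _ (by fun_prop), rieszKernel_sub_comm κ x z]
        gcongr
        exact hC z x
    _ = _ := lintegral_const_mul _ (by fun_prop)

lemma rieszKernel_le_of_mem_ball {s t : ℝ} (hs : 0 ≤ s) (hst : s ≤ t) {x z : ℂ}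
    (hx : x ∈ Metric.ball (0 : ℂ) ρ) (hz : z ∈ Metric.ball (0 : ℂ) ρ) :
    rieszKernel s (x - z) ≤ ENNReal.ofReal (2 * ρ) ^ (t - s) * rieszKernel t (x - z) := by
  have h1 : 1 ≤ ENNReal.ofReal (2 * ρ) ^ (t - s) * rieszKernel (t - s) (x - z) := by
    rw [rieszKernel, ← ENNReal.mul_rpow_of_nonneg _ _ (by linarith)]
    rw [← ENNReal.one_rpow (t - s)]
    refine ENNReal.rpow_le_rpow ?_ (by linarith)
    have hx' : ‖x‖ < ρ := by simpa using hx
    have hz' : ‖z‖ < ρ := by simpa using hz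
    have hle : ‖x - z‖ₑ ≤ ENNReal.ofReal (2 * ρ) := by
      rw [← ofReal_norm]
      exact ENNReal.ofReal_le_ofReal ((norm_sub_le _ _).trans (by linarith))
    have hpos : ENNReal.ofReal (2 * ρ) ≠ 0 := by
      have := norm_nonneg x
      simp; linarith
    calc (1 : ℝ≥0∞) = ENNReal.ofReal (2 * ρ) * (ENNReal.ofReal (2 * ρ))⁻¹ :=
          (ENNReal.mul_inv_cancel hpos ENNReal.ofReal_ne_top).symm
      _ ≤ _ := by gcongr
  have h2 : rieszKernel t (x - z) = rieszKernel (t - s) (x - z) * rieszKernel s (x - z) := by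
    rw [← rieszKernel_add (by linarith) hs]; congr 1; ring
  rw [h2, ← mul_assoc]
  exact le_mul_of_one_le_left' h1

lemma rieszPot_le_of_mem_ball {s t : ℝ} (hs : 0 ≤ s) (hst : s ≤ t) (f : ℂ → ℝ≥0∞) {z : ℂ}
    (hz : z ∈ Metric.ball (0 : ℂ) ρ) :
    rieszPot ρ s f z ≤ ENNReal.ofReal (2 * ρ) ^ (t - s) * rieszPot ρ t f z := by
  unfold rieszPot
  rw [← lintegral_const_mul' _ _ (ENNReal.rpow_ne_top_of_nonneg (by linarith) ENNReal.ofReal_ne_top)]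
  refine setLIntegral_mono' measurableSet_ball fun x hx => ?_
  rw [← mul_assoc]
  gcongr
  exact rieszKernel_le_of_mem_ball hs hst hx hz

lemma ennreal_mul_le_sq_add_sq (a b : ℝ≥0∞) : a * b ≤ a ^ 2 + b ^ 2 := by
  rw [sq, sq]
  rcases le_total a b with h | h
  · exact le_add_left (by gcongr)
  · exact le_add_right (by gcongr)

/-- Schur's test: after `f * g ≤ f² + g²`, either variable of the kernel integrates to at most `K`.
-/
lemma exists_lintegral_mul_rieszPot_le (ρ : ℝ) : ∃ C : ℝ≥0, ∀ f g : ℂ → ℝ≥0∞, Measurable f →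
    Measurable g → ∫⁻ z in Metric.ball (0 : ℂ) ρ, f z * rieszPot ρ 1 g z ≤
      C * ((∫⁻ z in Metric.ball (0 : ℂ) ρ, f z ^ 2) + ∫⁻ z in Metric.ball (0 : ℂ) ρ, g z ^ 2) := by
  obtain ⟨K, hK⟩ := exists_setLIntegral_rieszKernel_le ρ (s := 1) (by norm_num) (by norm_num)
  refine ⟨K, fun f g hf hg => ?_⟩
  calc _ = ∫⁻ z in Metric.ball (0 : ℂ) ρ, ∫⁻ x in Metric.ball (0 : ℂ) ρ,
        rieszKernel 1 (x - z) * (f z * g x) := by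
        refine lintegral_congr fun z => ?_
        rw [rieszPot, ← lintegral_const_mul _ (by fun_prop)]
        congr 1; ext x; ring
    _ ≤ ∫⁻ z in Metric.ball (0 : ℂ) ρ, ∫⁻ x in Metric.ball (0 : ℂ) ρ,
        (rieszKernel 1 (x - z) * f z ^ 2 + rieszKernel 1 (x - z) * g x ^ 2) := by
        gcongr with z x
        rw [← mul_add]; gcongr; exact ennreal_mul_le_sq_add_sq _ _
    _ = (∫⁻ z in Metric.ball (0 : ℂ) ρ, ∫⁻ x in Metric.ball (0 : ℂ) ρ,
        rieszKernel 1 (x - z) * f z ^ 2) + ∫⁻ z in Metric.ball (0 : ℂ) ρ,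
        ∫⁻ x in Metric.ball (0 : ℂ) ρ, rieszKernel 1 (x - z) * g x ^ 2 := by
        rw [← lintegral_add_left]
        · refine lintegral_congr fun z => ?_
          rw [lintegral_add_left (by fun_prop)]
        · exact Measurable.lintegral_prod_right'
            (f := fun t : ℂ × ℂ => rieszKernel 1 (t.2 - t.1) * f t.1 ^ 2) (by fun_prop)
    _ ≤ (∫⁻ z in Metric.ball (0 : ℂ) ρ, K * f z ^ 2) + ∫⁻ x in Metric.ball (0 : ℂ) ρ, K * g x ^ 2 := by
        refine add_le_add ?_ ?_
        · refine lintegral_mono fun z => ?_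
          rw [lintegral_mul_const _ (by fun_prop)]
          gcongr
          exact hK z
        · rw [lintegral_lintegral_swap]
          · refine lintegral_mono fun x => ?_
            rw [lintegral_mul_const _ (by fun_prop)]
            gcongr
            simp_rw [rieszKernel_sub_comm 1 x]
            exact hK x
          · refine Measurable.aemeasurable ?_
            unfold Function.uncurry
            fun_prop
    _ = _ := by
        rw [lintegral_const_mul _ (by fun_prop), lintegral_const_mul _ (by fun_prop), mul_add]

lemma enorm_lsSq_le (hq : IsBddPotential ρ A q) (hp : IsBddPotential ρ A p) (lam w : ℂ)
    {f : ℂ → ℂ} (hfm : Measurable f) (z : ℂ) : ‖lsSq q p lam w f z‖ₑ ≤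
      ENNReal.ofReal A * (ENNReal.ofReal A * rieszPot ρ 1 (rieszPot ρ 1 fun y => ‖f y‖ₑ) z) := by
  refine (enorm_lsOp_le hq lam w _ z).trans ?_
  gcongr
  rw [← rieszPot_const_mul (measurable_rieszPot hfm.enorm)]
  refine rieszPot_mono (fun x _ => ?_) z
  rw [RCLike.enorm_conj]
  refine (enorm_lsOp_le hp lam w _ x).trans (le_of_eq ?_)
  simp only [RCLike.enorm_conj]
  rfl

/-- Let `M` be `lsSq`, `b₁ = L_p 1` and `m = M 1`, so that `m` is bounded by the Riesz potential of
`b₁`. Since `a - 1 - m = M m + M (a - 1 - m)`, contraction bounds this error by `2 * sup ‖M m‖`.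
Three Cauchy kernels compose to a bounded one, so `M m` is bounded by the `L¹` norm of `b₁` over the
ball, and there that norm is at most a multiple of the Riesz potential. The bound on `b` follows
from `b - b₁ = L_p (conj (a - 1))`. -/
lemma exists_enorm_solution_le (ρ A : ℝ) : ∃ C : ℝ≥0, ∀ {q p : ℂ → ℂ}, IsBddPotential ρ A q →
    IsBddPotential ρ A p → ∀ {lam w : ℂ}, IsContractive ρ A q lam w → ∀ {a b : ℂ → ℂ},
    IsScalarSolution q p lam w a b → ∀ z ∈ Metric.ball (0 : ℂ) ρ,
      ‖a z - 1‖ₑ ≤ C * rieszPot ρ 1 (fun x => ‖lsOp p lam w (fun _ => 1) x‖ₑ) z ∧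
      ‖b z‖ₑ ≤ ‖lsOp p lam w (fun _ => 1) z‖ₑ +
        C * rieszPot ρ 1 (fun x => ‖lsOp p lam w (fun _ => 1) x‖ₑ) z := by
  obtain ⟨D, hD⟩ := exists_rieszPot_rieszPot_le ρ (s := 1) (t := 1) (κ := 1 / 2)
    (by norm_num) (by norm_num) (by norm_num) (by norm_num)
  -- Two compositions leave order `1/2`; with the third, `1/2 + 1 < 2` permits order `0`, that is, a
  -- bounded kernel.
  obtain ⟨D', hD'⟩ := exists_rieszPot_rieszPot_le ρ (s := 1 / 2) (t := 1) (κ := 0)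
    (by norm_num) (by norm_num) (by norm_num) (by norm_num)
  obtain ⟨C₀, hC₀, hL⟩ := exists_norm_lsOp_le ρ
  set α : ℝ≥0 := A.toNNReal with hα
  set τ : ℝ≥0 := (2 * ρ).toNNReal with hτ
  set C₁ : ℝ≥0 := α + 2 * (α * (α * (D * (α * D')))) * τ with hC₁
  refine ⟨C₁ + α * (C₁ * (D * τ ^ (1 / 2 : ℝ))), fun {q p} hq hp {lam w} hc {a b} h z hz => ?_⟩
  set b₁ : ℂ → ℂ := lsOp p lam w fun _ => 1 with hb₁
  have hone : ∀ _ : ℂ, ‖(1 : ℂ)‖ ≤ 1 := fun _ => by simp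
  have hb₁m : Measurable b₁ := measurable_lsOp hp lam w measurable_const hone
  have hb₁b : ∀ z, ‖b₁ z‖ ≤ A * 1 * C₀ := hL hp lam w hone
  set m : ℂ → ℂ := lsSq q p lam w fun _ => 1 with hm
  have hmm : Measurable m := (continuous_lsSq hq hp lam w measurable_const hone).measurable
  have hmb : ∀ z, ‖m z‖ ≤ 1 / 2 := norm_lsSq_le hq hp hc measurable_const hone
  have hmJ : ∀ z, ‖m z‖ₑ ≤ α * rieszPot ρ 1 (fun x => ‖b₁ x‖ₑ) z := by
    intro z
    refine (enorm_lsOp_le hq lam w _ z).trans (le_of_eq ?_)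
    simp only [RCLike.enorm_conj, map_one]
    rfl
  set N : ℝ≥0∞ := ∫⁻ x in Metric.ball (0 : ℂ) ρ, ‖b₁ x‖ₑ with hN
  have hNfin : N ≠ ⊤ := by
    have : N ≤ ∫⁻ x in Metric.ball (0 : ℂ) ρ, ENNReal.ofReal (A * 1 * C₀) :=
      lintegral_mono fun x => by rw [← ofReal_norm]; exact ENNReal.ofReal_le_ofReal (hb₁b x)
    refine ne_top_of_le_ne_top ?_ this
    rw [setLIntegral_const]
    exact ENNReal.mul_ne_top ENNReal.ofReal_ne_top measure_ball_lt_top.ne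
  have hpot0 : ∀ z, rieszPot ρ 0 (fun x => ‖b₁ x‖ₑ) z = N := by
    intro z; simp [rieszPot, rieszKernel, hN]
  have hmm2 : ∀ z, ‖lsSq q p lam w m z‖ₑ ≤ (α * (α * (D * (α * D'))) : ℝ≥0) * N := by
    intro z
    refine (enorm_lsSq_le hq hp lam w hmm z).trans ?_
    calc _ ≤ ENNReal.ofReal A * (ENNReal.ofReal A * (D * rieszPot ρ (1 / 2) (fun y => ‖m y‖ₑ) z)) := by
          gcongr
          exact hD _ hmm.enorm z
      _ ≤ ENNReal.ofReal A * (ENNReal.ofReal A * (D * (α * rieszPot ρ (1 / 2)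
          (rieszPot ρ 1 fun x => ‖b₁ x‖ₑ) z))) := by
          gcongr
          rw [← rieszPot_const_mul (measurable_rieszPot hb₁m.enorm)]
          exact rieszPot_mono (fun x _ => hmJ x) z
      _ ≤ ENNReal.ofReal A * (ENNReal.ofReal A * (D * (α * (D' * N)))) := by
          gcongr
          rw [← hpot0 z]
          exact hD' _ hb₁m.enorm z
      _ = _ := by
          push_cast
          simp only [hα, ENNReal.ofReal]
          ring
  have hab := h.norm_fst_le hq hp hc
  have ham := h.measurable_fst
  have hdb : ∀ z, ‖a z - 1 - m z‖ ≤ 2 + 1 + 1 / 2 := fun z =>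
    (norm_sub_le _ _).trans (add_le_add ((norm_sub_le _ _).trans (add_le_add (hab z) (hone z))) (hmb z))
  have hdm : Measurable fun z => a z - 1 - m z := (ham.sub_const 1).sub hmm
  have hMa : ∀ z, lsSq q p lam w (fun z => a z - 1) z = a z - 1 - m z := by
    intro z
    rw [lsSq_sub hq hp lam w ham measurable_const hab hone]
    conv_rhs => rw [h.fst_eq_lsSq]
    ring
  have hd : ∀ z, ‖a z - 1 - m z‖ ≤ 2 * ((α * (α * (D * (α * D'))) : ℝ≥0) * N).toReal := by
    refine norm_le_of_forall_norm_le_half hdb fun C hC z => ?_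
    have e : a z - 1 - m z = lsSq q p lam w m z + lsSq q p lam w (fun z => a z - 1 - m z) z := by
      rw [lsSq_sub hq hp lam w (ham.sub_const 1) hmm
        (fun z => (norm_sub_le _ _).trans (add_le_add (hab z) (hone z))) hmb, hMa]
      ring
    rw [e]
    refine (norm_add_le _ _).trans (add_le_add ?_ (norm_lsSq_le hq hp hc hdm hC z))
    rw [← toReal_enorm]
    exact ENNReal.toReal_mono (ENNReal.mul_ne_top ENNReal.coe_ne_top hNfin) (hmm2 z)
  have hd' : ∀ z, ‖a z - 1 - m z‖ₑ ≤ 2 * ((α * (α * (D * (α * D'))) : ℝ≥0) * N) := by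
    intro z
    have := ENNReal.ofReal_le_ofReal (hd z)
    rwa [ofReal_norm, ENNReal.ofReal_mul (by norm_num), ENNReal.ofReal_toReal
      (ENNReal.mul_ne_top ENNReal.coe_ne_top hNfin), ENNReal.ofReal_ofNat] at this
  have ha1 : ∀ z ∈ Metric.ball (0 : ℂ) ρ, ‖a z - 1‖ₑ ≤ C₁ * rieszPot ρ 1 (fun x => ‖b₁ x‖ₑ) z := by
    -- Points of the ball are less than `2 * ρ` apart, so the kernel of order one is bounded below
    -- there and its potential dominates the `L¹` norm.
    intro z hz
    have hNJ : N ≤ τ * rieszPot ρ 1 (fun x => ‖b₁ x‖ₑ) z := by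
      rw [← hpot0 z]
      have := rieszPot_le_of_mem_ball (s := 0) (t := 1) le_rfl zero_le_one (fun x => ‖b₁ x‖ₑ) hz
      rwa [sub_zero, ENNReal.rpow_one] at this
    calc ‖a z - 1‖ₑ = ‖m z + (a z - 1 - m z)‖ₑ := by congr 1; ring
      _ ≤ ‖m z‖ₑ + ‖a z - 1 - m z‖ₑ := enorm_add_le _ _
      _ ≤ α * rieszPot ρ 1 (fun x => ‖b₁ x‖ₑ) z + 2 * ((α * (α * (D * (α * D'))) : ℝ≥0) *
          (τ * rieszPot ρ 1 (fun x => ‖b₁ x‖ₑ) z)) := by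
          gcongr
          · exact hmJ z
          · exact (hd' z).trans (by gcongr)
      _ = _ := by rw [hC₁]; push_cast; ring
  have hJm : Measurable (rieszPot ρ 1 fun x => ‖b₁ x‖ₑ) := measurable_rieszPot hb₁m.enorm
  refine ⟨(ha1 z hz).trans ?_, ?_⟩
  · gcongr
    exact le_self_add
  · have e : b z = b₁ z + lsOp p lam w (fun x => conj (a x - 1)) z := by
      have : (fun x => conj (a x - 1)) = fun x => conj (a x) - 1 := by ext x; simp
      rw [this, lsOp_sub hp lam w (measurable_conj_comp ham) measurable_const (norm_conj_le hab) hone,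
        h.snd_eq]
      ring
    rw [e]
    refine (enorm_add_le _ _).trans ?_
    gcongr
    calc _ ≤ ENNReal.ofReal A * rieszPot ρ 1 (fun x => ‖conj (a x - 1)‖ₑ) z := enorm_lsOp_le hp lam w _ z
      _ ≤ ENNReal.ofReal A * (C₁ * rieszPot ρ 1 (rieszPot ρ 1 fun x => ‖b₁ x‖ₑ) z) := by
          gcongr
          rw [← rieszPot_const_mul hJm]
          refine rieszPot_mono (fun x hx => ?_) z
          rw [RCLike.enorm_conj]
          exact ha1 x hx
      _ ≤ ENNReal.ofReal A * (C₁ * (D * (ENNReal.ofReal (2 * ρ) ^ (1 - 1 / 2 : ℝ) *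
            rieszPot ρ 1 (fun x => ‖b₁ x‖ₑ) z))) := by
          gcongr
          refine (hD _ hb₁m.enorm z).trans ?_
          gcongr
          exact rieszPot_le_of_mem_ball (by norm_num) (by norm_num) _ hz
      _ = (α * (C₁ * (D * τ ^ (1 / 2 : ℝ))) : ℝ≥0) * rieszPot ρ 1 (fun x => ‖b₁ x‖ₑ) z := by
          push_cast
          rw [ENNReal.coe_rpow_of_nonneg _ (by norm_num)]
          simp only [hα, hτ, ENNReal.ofReal]
          norm_num
          ring
      _ ≤ _ := by
          gcongr
          exact le_add_self

/-- Pairings of the deviation of a solution from `(1, 0)` are controlled by squares. -/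
lemma exists_lintegral_mul_solution_le (ρ A : ℝ) : ∃ C : ℝ≥0, ∀ {q p : ℂ → ℂ}, IsBddPotential ρ A q →
    IsBddPotential ρ A p → ∀ {lam w : ℂ}, IsContractive ρ A q lam w → ∀ {a b : ℂ → ℂ},
    IsScalarSolution q p lam w a b → ∀ f : ℂ → ℝ≥0∞, Measurable f →
      ∫⁻ z in Metric.ball (0 : ℂ) ρ, f z * ‖a z - 1‖ₑ ≤
        C * ((∫⁻ z in Metric.ball (0 : ℂ) ρ, f z ^ 2) +
          ∫⁻ z in Metric.ball (0 : ℂ) ρ, ‖lsOp p lam w (fun _ => 1) z‖ₑ ^ 2) ∧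
      ∫⁻ z in Metric.ball (0 : ℂ) ρ, f z * ‖b z‖ₑ ≤
        C * ((∫⁻ z in Metric.ball (0 : ℂ) ρ, f z ^ 2) +
          ∫⁻ z in Metric.ball (0 : ℂ) ρ, ‖lsOp p lam w (fun _ => 1) z‖ₑ ^ 2) := by
  obtain ⟨C, hC⟩ := exists_enorm_solution_le ρ A
  obtain ⟨K, hK⟩ := exists_lintegral_mul_rieszPot_le ρ
  refine ⟨1 + C * K, fun {q p} hq hp {lam w} hc {a b} h f hf => ?_⟩
  set b₁ : ℂ → ℂ := lsOp p lam w fun _ => 1 with hb₁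
  have hb₁m : Measurable b₁ := measurable_lsOp hp lam w measurable_const (C := 1) fun _ => by simp
  have hJm : Measurable (rieszPot ρ 1 fun x => ‖b₁ x‖ₑ) := measurable_rieszPot hb₁m.enorm
  have key : ∫⁻ z in Metric.ball (0 : ℂ) ρ, f z * (C * rieszPot ρ 1 (fun x => ‖b₁ x‖ₑ) z) ≤
      C * K * ((∫⁻ z in Metric.ball (0 : ℂ) ρ, f z ^ 2) +
          ∫⁻ z in Metric.ball (0 : ℂ) ρ, ‖b₁ z‖ₑ ^ 2) := by
    simp_rw [mul_left_comm _ (C : ℝ≥0∞)]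
    rw [lintegral_const_mul' _ _ ENNReal.coe_ne_top, mul_assoc]
    gcongr
    exact hK _ _ hf hb₁m.enorm
  constructor
  · calc _ ≤ ∫⁻ z in Metric.ball (0 : ℂ) ρ, f z * (C * rieszPot ρ 1 (fun x => ‖b₁ x‖ₑ) z) :=
          setLIntegral_mono' measurableSet_ball fun z hz => by
            gcongr; exact (hC hq hp hc h z hz).1
      _ ≤ _ := key
      _ ≤ _ := by
          gcongr
          push_cast
          exact le_add_self
  · calc _ ≤ ∫⁻ z in Metric.ball (0 : ℂ) ρ, (f z * ‖b₁ z‖ₑ +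
            f z * (C * rieszPot ρ 1 (fun x => ‖b₁ x‖ₑ) z)) :=
          setLIntegral_mono' measurableSet_ball fun z hz => by
            rw [← mul_add]; gcongr; exact (hC hq hp hc h z hz).2
      _ = (∫⁻ z in Metric.ball (0 : ℂ) ρ, f z * ‖b₁ z‖ₑ) +
          ∫⁻ z in Metric.ball (0 : ℂ) ρ, f z * (C * rieszPot ρ 1 (fun x => ‖b₁ x‖ₑ) z) :=
          lintegral_add_left (hf.mul hb₁m.enorm) _
      _ ≤ (∫⁻ z in Metric.ball (0 : ℂ) ρ, (f z ^ 2 + ‖b₁ z‖ₑ ^ 2)) + _ :=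
          add_le_add (lintegral_mono fun z => ennreal_mul_le_sq_add_sq _ _) key
      _ = _ := by
          rw [lintegral_add_left (by fun_prop)]
          push_cast
          ring

end

/-! ### Averages over annuli and mean-square decay of oscillatory potentials. -/

section

variable {ρ A : ℝ} {q p : ℂ → ℂ}

section Fubini

variable {X : Type*} [MeasurableSpace X] {ν : Measure X} {R : ℝ} {H : X → ℂ} {ζ : X → ℂ}

lemma integrable_annulus_prod (hR : 0 < R) (hH : Integrable H ν) (hζ : Measurable ζ) :
    Integrable (fun t : ℂ × X => ((‖t.1‖⁻¹ : ℝ) : ℂ) *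
      (Complex.exp (-Complex.I * (((t.1 * ζ t.2).im / 2 : ℝ) : ℂ)) * H t.2))
      ((volume.restrict (annulus R)).prod ν) := by
  refine ((integrable_inv_norm_annulus hR).mul_prod hH).norm.mono' ?_
    (Eventually.of_forall fun t => ?_)
  · have h1 : AEStronglyMeasurable (fun t : ℂ × X => H t.2) ((volume.restrict (annulus R)).prod ν) :=
      hH.aestronglyMeasurable.comp_snd
    have h2 : Measurable fun t : ℂ × X => ((‖t.1‖⁻¹ : ℝ) : ℂ) := by fun_prop
    have h3 : Measurable fun t : ℂ × X =>
      Complex.exp (-Complex.I * (((t.1 * ζ t.2).im / 2 : ℝ) : ℂ)) := by fun_prop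
    exact h2.aestronglyMeasurable.mul (h3.aestronglyMeasurable.mul h1)
  · rw [norm_mul, norm_mul, norm_mul, norm_cexp_neg_I_mul, one_mul]

lemma integral_annulus_cexp_mul [SFinite ν] (hR : 0 < R) (hH : Integrable H ν) (hζ : Measurable ζ) :
    ∫ lam in annulus R, ((‖lam‖⁻¹ : ℝ) : ℂ) *
      ∫ x, Complex.exp (-Complex.I * (((lam * ζ x).im / 2 : ℝ) : ℂ)) * H x ∂ν =
      ∫ x, H x * annulusKernel R (ζ x) ∂ν := by
  simp_rw [← integral_const_mul]
  rw [integral_integral_swap (integrable_annulus_prod hR hH hζ)]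
  refine integral_congr_ae (Eventually.of_forall fun x => ?_)
  simp only [annulusKernel]
  rw [← integral_const_mul]
  congr 1; ext lam; ring

lemma integrable_annulus_cexp_mul [SFinite ν] (hR : 0 < R) (hH : Integrable H ν) (hζ : Measurable ζ) :
    IntegrableOn (fun lam => ((‖lam‖⁻¹ : ℝ) : ℂ) *
      ∫ x, Complex.exp (-Complex.I * (((lam * ζ x).im / 2 : ℝ) : ℂ)) * H x ∂ν) (annulus R) := by
  simp_rw [← integral_const_mul]
  exact (integrable_annulus_prod hR hH hζ).integral_prod_left

end Fubini

lemma oscPhase_mul (lam w z x : ℂ) : oscPhase lam w z * oscPhase lam w x =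
    Complex.exp (-Complex.I * (((lam * ((z - w) ^ 2 + (x - w) ^ 2)).im / 2 : ℝ) : ℂ)) := by
  rw [oscPhase, oscPhase, ← Complex.exp_add, mul_add lam, Complex.add_im]
  congr 1; push_cast; ring

lemma oscPhase_mul_conj_eq (lam w z x : ℂ) : oscPhase lam w z * conj (oscPhase lam w x) =
    Complex.exp (-Complex.I * (((lam * ((z - w) ^ 2 - (x - w) ^ 2)).im / 2 : ℝ) : ℂ)) := by
  rw [oscPhase, oscPhase, ← Complex.exp_conj, ← Complex.exp_add, mul_sub lam, Complex.sub_im]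
  congr 1
  simp only [map_mul, map_neg, Complex.conj_I, Complex.conj_ofReal]
  push_cast; ring

lemma annulusKernel_neg (R : ℝ) (hR : 0 < R) (ζ : ℂ) : annulusKernel R (-ζ) = annulusKernel R ζ := by
  rw [annulusKernel_eq hR, annulusKernel_eq hR, norm_neg]

lemma rieszKernel_mul_le_right {s : ℝ} (hs : 0 ≤ s) {c : ℂ} (hc : 1 ≤ ‖c‖) (x : ℂ) :
    rieszKernel s (c * x) ≤ rieszKernel s x := by
  rw [rieszKernel_mul s hs]
  refine mul_le_of_le_one_left' (ENNReal.rpow_le_one ?_ hs)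
  rw [ENNReal.inv_le_one, ← ofReal_norm]
  exact ENNReal.one_le_ofReal.2 hc

lemma sq_sub_sq_factor (w z x : ℂ) :
    (z - w) ^ 2 - (x - w) ^ 2 = (z - x) * (z - (2 * w - x)) := by ring

lemma sq_add_sq_factor (w z x : ℂ) :
    (z - w) ^ 2 + (x - w) ^ 2 =
      (z - (w - Complex.I * (x - w))) * (z - (w + Complex.I * (x - w))) := by
  linear_combination ((x - w) ^ 2) * Complex.I_sq

/-- The rate `β = 5/4` yields `R ^ (-1/4)`. Of the zeros `x` and `2 w - x` of the phase in `z`, the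
first already carries order `1/2`, giving `7/4 < 2`. Their separation `2 (x - w)` leaves order `5/4`
for the outer integral. -/
lemma exists_lintegral_sq_sub_sq_le (ρ : ℝ) : ∃ C : ℝ≥0, ∀ {R : ℝ}, 0 < R → ∀ w : ℂ,
    ∫⁻ x in Metric.ball (0 : ℂ) ρ, ∫⁻ z in Metric.ball (0 : ℂ) ρ,
      rieszKernel (1 / 2) (z - x) * ‖annulusKernel R ((z - w) ^ 2 - (x - w) ^ 2)‖ₑ ≤
        C * ENNReal.ofReal R ^ (-(1 / 4) : ℝ) := by
  obtain ⟨C, hC⟩ := exists_enorm_annulusKernel_le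
  obtain ⟨D, hD⟩ := exists_setLIntegral_rieszKernel_mul_le ρ (s := 7 / 4) (t := 5 / 4) (κ := 5 / 4)
    (by norm_num) (by norm_num) (by norm_num) (by norm_num)
  obtain ⟨K, hK⟩ := exists_setLIntegral_rieszKernel_le ρ (s := 5 / 4) (by norm_num) (by norm_num)
  refine ⟨C * (D * K), fun {R} hR w => ?_⟩
  have hRp : ENNReal.ofReal R ^ (-(1 / 4) : ℝ) ≠ ⊤ := by
    simp [ENNReal.rpow_eq_top_iff, hR]
  set r := ENNReal.ofReal R ^ (-(1 / 4) : ℝ) with hr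
  have pt : ∀ x z : ℂ, rieszKernel (1 / 2) (z - x) * ‖annulusKernel R ((z - w) ^ 2 - (x - w) ^ 2)‖ₑ ≤
      C * r * (rieszKernel (7 / 4) (z - x) * rieszKernel (5 / 4) (z - (2 * w - x))) := by
    intro x z
    have := hC R hR (5 / 4) (by norm_num) (by norm_num) ((z - w) ^ 2 - (x - w) ^ 2)
    rw [sq_sub_sq_factor, rieszKernel_mul _ (by norm_num),
      show (1 - 5 / 4 : ℝ) = -(1 / 4) by norm_num, ← hr] at this
    rw [sq_sub_sq_factor]
    calc _ ≤ rieszKernel (1 / 2) (z - x) * (C * r *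
          (rieszKernel (5 / 4) (z - x) * rieszKernel (5 / 4) (z - (2 * w - x)))) := by gcongr
      _ = _ := by
          rw [show (7 / 4 : ℝ) = 1 / 2 + 5 / 4 by norm_num, rieszKernel_add (by norm_num) (by norm_num)]
          ring
  calc _ ≤ ∫⁻ x in Metric.ball (0 : ℂ) ρ, C * r * (D * rieszKernel (5 / 4) (x - w)) := by
        refine lintegral_mono fun x => ?_
        refine (lintegral_mono fun z => pt x z).trans ?_
        rw [lintegral_const_mul' _ _ (ENNReal.mul_ne_top ENNReal.coe_ne_top hRp)]
        gcongr
        refine (hD x (2 * w - x)).trans ?_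
        gcongr
        rw [show x - (2 * w - x) = 2 * (x - w) by ring]
        exact rieszKernel_mul_le_right (by norm_num) (by simp) _
    _ ≤ C * r * (D * K) := by
        rw [lintegral_const_mul' _ _ (ENNReal.mul_ne_top ENNReal.coe_ne_top hRp),
          lintegral_const_mul' _ _ ENNReal.coe_ne_top]
        gcongr
        exact hK w
    _ = _ := by push_cast; ring

/-- Again `β = 5/4`. The zeros in `z` are `w ± I * (x - w)`; they are `2 ‖x - w‖` apart and `√2 ‖x -
w‖` from `x`. Separating them costs order `5/4` in `x - w`, and separating each from the pole at `x`
costs `1/2`: together `7/4`, still integrable. -/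
lemma exists_lintegral_sq_add_sq_le (ρ : ℝ) : ∃ C : ℝ≥0, ∀ {R : ℝ}, 0 < R → ∀ w : ℂ,
    ∫⁻ x in Metric.ball (0 : ℂ) ρ, ∫⁻ z in Metric.ball (0 : ℂ) ρ,
      rieszKernel 1 (z - x) * ‖annulusKernel R ((z - w) ^ 2 + (x - w) ^ 2)‖ₑ ≤
        C * ENNReal.ofReal R ^ (-(1 / 4) : ℝ) := by
  obtain ⟨C, hC⟩ := exists_enorm_annulusKernel_le
  obtain ⟨D, hD⟩ := exists_setLIntegral_rieszKernel_mul_le ρ (s := 5 / 4) (t := 1) (κ := 1 / 2)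
    (by norm_num) (by norm_num) (by norm_num) (by norm_num)
  obtain ⟨K, hK⟩ := exists_setLIntegral_rieszKernel_le ρ (s := 7 / 4) (by norm_num) (by norm_num)
  refine ⟨C * (2 ^ (5 / 4 : ℝ) * (2 * (D * K))), fun {R} hR w => ?_⟩
  have hRp : ENNReal.ofReal R ^ (-(1 / 4) : ℝ) ≠ ⊤ := by
    simp [ENNReal.rpow_eq_top_iff, hR]
  set r := ENNReal.ofReal R ^ (-(1 / 4) : ℝ) with hr
  have pt : ∀ x z : ℂ, rieszKernel 1 (z - x) * ‖annulusKernel R ((z - w) ^ 2 + (x - w) ^ 2)‖ₑ ≤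
      C * r * (2 ^ (5 / 4 : ℝ) * rieszKernel (5 / 4) (x - w)) *
      (rieszKernel (5 / 4) (z - (w - Complex.I * (x - w))) * rieszKernel 1 (z - x) +
        rieszKernel (5 / 4) (z - (w + Complex.I * (x - w))) * rieszKernel 1 (z - x)) := by
    intro x z
    have h1 := hC R hR (5 / 4) (by norm_num) (by norm_num) ((z - w) ^ 2 + (x - w) ^ 2)
    rw [sq_add_sq_factor, rieszKernel_mul _ (by norm_num),
      show (1 - 5 / 4 : ℝ) = -(1 / 4) by norm_num, ← hr] at h1
    have h2 := rieszKernel_mul_le (s := 5 / 4) (t := 5 / 4) (κ := 5 / 4) (by norm_num) le_rfl le_rfl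
      (z - (w - Complex.I * (x - w))) (z - (w + Complex.I * (x - w)))
      ((2 * Complex.I) * (x - w)) (by
        rw [show (2 * Complex.I) * (x - w) = (z - (w - Complex.I * (x - w))) -
          (z - (w + Complex.I * (x - w))) by ring]
        exact norm_sub_le _ _)
    rw [show (5 / 4 + 5 / 4 - 5 / 4 : ℝ) = 5 / 4 by norm_num] at h2
    have h3 := rieszKernel_mul_le_right (s := 5 / 4) (by norm_num) (c := 2 * Complex.I) (by simp)
      (x - w)
    rw [sq_add_sq_factor]
    calc _ ≤ rieszKernel 1 (z - x) * (C * r * (2 ^ (5 / 4 : ℝ) * rieszKernel (5 / 4) (x - w) *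
          (rieszKernel (5 / 4) (z - (w - Complex.I * (x - w))) +
            rieszKernel (5 / 4) (z - (w + Complex.I * (x - w)))))) := by
          refine mul_le_mul' le_rfl (h1.trans (mul_le_mul' le_rfl (h2.trans ?_)))
          exact mul_le_mul' (mul_le_mul' le_rfl h3) le_rfl
      _ = _ := by ring
  have hshift : ∀ (x c : ℂ), 1 ≤ ‖c‖ → ∀ y, y = c * (x - w) → 
      rieszKernel (1 / 2) y ≤ rieszKernel (1 / 2) (x - w) := by
    rintro x c hc _ rfl
    exact rieszKernel_mul_le_right (by norm_num) hc _
  -- For `s = ±1` these are the ratios of `w ± I * (x - w) - x` to `x - w`.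
  have hnorm : ∀ s : ℝ, s ^ 2 = 1 → 1 ≤ ‖(-1 + s * Complex.I : ℂ)‖ := by
    intro s hs
    rw [← sq_le_sq₀ zero_le_one (norm_nonneg _), Complex.sq_norm, Complex.normSq_apply]
    simp; nlinarith
  calc _ ≤ ∫⁻ x in Metric.ball (0 : ℂ) ρ, C * r *
        (2 ^ (5 / 4 : ℝ) * (2 * (D * rieszKernel (7 / 4) (x - w)))) := by
        refine lintegral_mono fun x => ?_
        refine (lintegral_mono fun z => pt x z).trans ?_
        rw [lintegral_const_mul _ (by fun_prop), lintegral_add_left (by fun_prop)]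
        calc _ ≤ C * r * (2 ^ (5 / 4 : ℝ) * rieszKernel (5 / 4) (x - w)) *
            (D * rieszKernel (1 / 2) (x - w) + D * rieszKernel (1 / 2) (x - w)) := by
              gcongr
              · refine (hD _ _).trans ?_
                gcongr
                refine hshift x (-1 + ((-1 : ℝ) : ℂ) * Complex.I) (hnorm (-1) (by norm_num)) _ ?_
                push_cast; ring
              · refine (hD _ _).trans ?_
                gcongr
                refine hshift x (-1 + ((1 : ℝ) : ℂ) * Complex.I) (hnorm 1 (by norm_num)) _ ?_
                push_cast; ring
          _ = _ := by
              rw [show (7 / 4 : ℝ) = 5 / 4 + 1 / 2 by norm_num,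
                rieszKernel_add (by norm_num) (by norm_num)]
              ring
    _ ≤ C * r * (2 ^ (5 / 4 : ℝ) * (2 * (D * K))) := by
        rw [lintegral_const_mul' _ _ (ENNReal.mul_ne_top ENNReal.coe_ne_top hRp),
          lintegral_const_mul' _ _ (by simp), lintegral_const_mul' _ _ (by simp),
          lintegral_const_mul' _ _ ENNReal.coe_ne_top]
        gcongr
        exact hK w
    _ = _ := by
        push_cast
        rw [ENNReal.coe_rpow_of_nonneg _ (by norm_num)]
        push_cast
        ring

/-- Oscillatory potentials with a kernel of Cauchy type. -/
def oscPot (σ q : ℂ → ℂ) (lam w y : ℂ) : ℂ := ∫ x, oscPhase lam w x * (q x * σ (x - y))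

lemma integrable_mul_cauchyType (hq : IsBddPotential ρ A q) {σ : ℂ → ℂ} (hσm : Measurable σ)
    (hσ : ∀ u, ‖σ u‖ₑ ≤ rieszKernel 1 u) (y : ℂ) : Integrable fun x => q x * σ (x - y) := by
  have hqm := hq.measurable
  obtain ⟨K, hK⟩ := exists_setLIntegral_rieszKernel_le ρ (s := 1) (by norm_num) (by norm_num)
  refine ⟨Measurable.aestronglyMeasurable (by fun_prop), ?_⟩
  calc ∫⁻ x, ‖q x * σ (x - y)‖ₑ ≤ ∫⁻ x, ‖q x‖ₑ * rieszKernel 1 (x - y) := by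
        refine lintegral_mono fun x => ?_
        rw [enorm_mul]; gcongr; exact hσ _
    _ ≤ ENNReal.ofReal A * K := (hq.lintegral_mul_le _).trans (by gcongr; exact hK y)
    _ < ⊤ := ENNReal.mul_lt_top ENNReal.ofReal_lt_top ENNReal.coe_lt_top

lemma measurable_oscPot (hq : IsBddPotential ρ A q) {σ : ℂ → ℂ} (hσm : Measurable σ) (w : ℂ) :
    Measurable fun t : ℂ × ℂ => oscPot σ q t.1 w t.2 := by
  have hqm := hq.measurable
  refine StronglyMeasurable.measurable (StronglyMeasurable.integral_prod_right'
    (f := fun s : (ℂ × ℂ) × ℂ => oscPhase s.1.1 w s.2 * (q s.2 * σ (s.2 - s.1.2))) ?_)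
  exact Measurable.stronglyMeasurable (by fun_prop)

/-- `T T*` again: the squared modulus is a double integral with the difference of the phases. The
average of a nonnegative function equals the modulus of its integral, so Fubini may be applied
before taking absolute values. -/
lemma lintegral_annulus_sq_oscIntegral_le {R : ℝ} (hR : 0 < R) (w : ℂ) {F : ℂ → ℂ}
    (hF : Integrable F) (hFm : Measurable F) :
    ∫⁻ lam in annulus R, ‖lam‖ₑ⁻¹ * ‖∫ x, oscPhase lam w x * F x‖ₑ ^ 2 ≤
      ∫⁻ x, ∫⁻ z, ‖F z‖ₑ * ‖F x‖ₑ * ‖annulusKernel R ((z - w) ^ 2 - (x - w) ^ 2)‖ₑ := by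
  have hH : Integrable (fun t : ℂ × ℂ => F t.1 * conj (F t.2)) (volume.prod volume) :=
    hF.mul_prod (Complex.conjLIE.toContinuousLinearEquiv.toContinuousLinearMap.integrable_comp hF)
  have e : ∀ lam : ℂ, ∫ t : ℂ × ℂ, Complex.exp (-Complex.I *
      (((lam * ((t.1 - w) ^ 2 - (t.2 - w) ^ 2)).im / 2 : ℝ) : ℂ)) * (F t.1 * conj (F t.2)) =
      (∫ x, oscPhase lam w x * F x) * conj (∫ x, oscPhase lam w x * F x) := by
    intro lam
    rw [← integral_conj, ← integral_prod_mul, Measure.volume_eq_prod]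
    congr 1; ext t
    rw [← oscPhase_mul_conj_eq, map_mul]; ring
  have h1 := integral_annulus_cexp_mul hR hH
    (ζ := fun t : ℂ × ℂ => (t.1 - w) ^ 2 - (t.2 - w) ^ 2) (by fun_prop)
  have h2 := integrable_annulus_cexp_mul hR hH
    (ζ := fun t : ℂ × ℂ => (t.1 - w) ^ 2 - (t.2 - w) ^ 2) (by fun_prop)
  rw [← Measure.volume_eq_prod] at h1 h2
  simp_rw [e] at h1 h2
  have e2 : ∀ lam : ℂ, ((‖lam‖⁻¹ : ℝ) : ℂ) * ((∫ x, oscPhase lam w x * F x) *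
      conj (∫ x, oscPhase lam w x * F x)) =
      ((‖lam‖⁻¹ * ‖∫ x, oscPhase lam w x * F x‖ ^ 2 : ℝ) : ℂ) := by
    intro lam
    rw [Complex.mul_conj, Complex.normSq_eq_norm_sq]; push_cast; rfl
  simp_rw [e2] at h1 h2
  have h3 : Integrable (fun lam : ℂ => ‖lam‖⁻¹ * ‖∫ x, oscPhase lam w x * F x‖ ^ 2)
      (volume.restrict (annulus R)) := by
    have := h2.re
    simpa only [RCLike.re_to_complex, Complex.ofReal_re] using this
  calc ∫⁻ lam in annulus R, ‖lam‖ₑ⁻¹ * ‖∫ x, oscPhase lam w x * F x‖ₑ ^ 2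
      = ∫⁻ lam in annulus R, ENNReal.ofReal (‖lam‖⁻¹ * ‖∫ x, oscPhase lam w x * F x‖ ^ 2) := by
        refine setLIntegral_congr_fun (measurableSet_annulus R) fun lam hl => ?_
        have : 0 < ‖lam‖ := hR.trans hl.1
        rw [ENNReal.ofReal_mul (by positivity), ENNReal.ofReal_inv_of_pos this, ofReal_norm,
          ENNReal.ofReal_pow (by positivity), ofReal_norm]
    _ = ‖∫ lam in annulus R, ((‖lam‖⁻¹ * ‖∫ x, oscPhase lam w x * F x‖ ^ 2 : ℝ) : ℂ)‖ₑ := by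
        rw [← ofReal_integral_eq_lintegral_ofReal h3
          (Eventually.of_forall fun _ => by positivity), integral_complex_ofReal, ← ofReal_norm,
          Complex.norm_real, Real.norm_of_nonneg (integral_nonneg fun _ => by positivity)]
    _ ≤ ∫⁻ t : ℂ × ℂ, ‖F t.1 * conj (F t.2) *
          annulusKernel R ((t.1 - w) ^ 2 - (t.2 - w) ^ 2)‖ₑ := by
        rw [h1]; exact enorm_integral_le_lintegral_enorm _
    _ = _ := by
        have hc : Continuous (annulusKernel R) := by
          have : annulusKernel R = fun ζ => R * annulusKernel 1 (R * ζ) :=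
            funext (annulusKernel_scale hR)
          rw [this]
          have := continuous_annulusKernel_one
          fun_prop
        have hcm := hc.measurable
        rw [Measure.volume_eq_prod, lintegral_prod_symm]
        · simp_rw [enorm_mul, RCLike.enorm_conj]
        · refine (Measurable.enorm ?_).aemeasurable
          have h4 : Measurable fun t : ℂ × ℂ => conj (F t.2) :=
            measurable_conj_comp (hFm.comp measurable_snd)
          fun_prop

lemma measurable_annulusKernel {R : ℝ} (hR : 0 < R) : Measurable (annulusKernel R) := by
  have : annulusKernel R = fun ζ => R * annulusKernel 1 (R * ζ) := funext (annulusKernel_scale hR)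
  rw [this]
  have := continuous_annulusKernel_one.measurable
  fun_prop

lemma lintegral_annulus_swap {ρ R : ℝ} {G : ℂ → ℂ → ℂ} (hG : Measurable fun t : ℂ × ℂ => G t.1 t.2) :
    ∫⁻ lam in annulus R, ‖lam‖ₑ⁻¹ * ∫⁻ y in Metric.ball (0 : ℂ) ρ, ‖G lam y‖ₑ ^ 2 =
      ∫⁻ y in Metric.ball (0 : ℂ) ρ, ∫⁻ lam in annulus R, ‖lam‖ₑ⁻¹ * ‖G lam y‖ₑ ^ 2 := by
  rw [lintegral_lintegral_swap]
  · refine lintegral_congr fun lam => ?_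
    have : Measurable fun y => ‖G lam y‖ₑ ^ 2 := (hG.comp measurable_prodMk_left).enorm.pow_const 2
    rw [lintegral_const_mul _ this]
  · refine Measurable.aemeasurable ?_
    have h1 : Measurable fun t : ℂ × ℂ => G t.2 t.1 :=
      hG.comp (measurable_snd.prodMk measurable_fst)
    have h2 : Measurable fun t : ℂ × ℂ => ‖t.2‖ₑ⁻¹ := by fun_prop
    exact h2.mul (h1.enorm.pow_const 2)

/-- Integrating in `y` before the other variables composes the two Cauchy kernels into order `1/2`
in `z - x`, the weight allowed by `exists_lintegral_sq_sub_sq_le`. -/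
lemma exists_lintegral_annulus_sq_oscPot_le (ρ A : ℝ) : ∃ C : ℝ≥0, ∀ {q : ℂ → ℂ},
    IsBddPotential ρ A q → ∀ {σ : ℂ → ℂ}, Measurable σ → (∀ u, ‖σ u‖ₑ ≤ rieszKernel 1 u) →
    ∀ {R : ℝ}, 0 < R → ∀ w : ℂ, ∫⁻ lam in annulus R, ‖lam‖ₑ⁻¹ *
      ∫⁻ y in Metric.ball (0 : ℂ) ρ, ‖oscPot σ q lam w y‖ₑ ^ 2 ≤
        C * ENNReal.ofReal R ^ (-(1 / 4) : ℝ) := by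
  obtain ⟨D, hD⟩ := exists_setLIntegral_rieszKernel_mul_le ρ (s := 1) (t := 1) (κ := 1 / 2)
    (by norm_num) (by norm_num) (by norm_num) (by norm_num)
  obtain ⟨C, hC⟩ := exists_lintegral_sq_sub_sq_le ρ
  refine ⟨A.toNNReal * (A.toNNReal * (D * C)), fun {q} hq {σ} hσm hσ {R} hR w => ?_⟩
  have hqm := hq.measurable
  have hom := measurable_oscPot hq hσm w
  have hkm := measurable_annulusKernel hR
  calc _ = ∫⁻ y in Metric.ball (0 : ℂ) ρ, ∫⁻ lam in annulus R, ‖lam‖ₑ⁻¹ *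
        ‖oscPot σ q lam w y‖ₑ ^ 2 := by
        exact lintegral_annulus_swap (G := fun lam y => oscPot σ q lam w y) hom
    _ ≤ ∫⁻ y in Metric.ball (0 : ℂ) ρ, ∫⁻ x, ‖q x‖ₑ * ∫⁻ z, ‖q z‖ₑ * 
        (rieszKernel 1 (y - z) * rieszKernel 1 (y - x) *
          ‖annulusKernel R ((z - w) ^ 2 - (x - w) ^ 2)‖ₑ) := by
        refine lintegral_mono fun y => ?_
        refine (lintegral_annulus_sq_oscIntegral_le hR w (integrable_mul_cauchyType hq hσm hσ y)
          (by fun_prop)).trans ?_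
        refine lintegral_mono fun x => ?_
        rw [← lintegral_const_mul' _ _ enorm_ne_top]
        refine lintegral_mono fun z => ?_
        rw [enorm_mul, enorm_mul]
        calc _ ≤ ‖q z‖ₑ * rieszKernel 1 (z - y) * (‖q x‖ₑ * rieszKernel 1 (x - y)) *
            ‖annulusKernel R ((z - w) ^ 2 - (x - w) ^ 2)‖ₑ := by
              gcongr <;> exact hσ _
          _ = _ := by
              rw [rieszKernel_sub_comm 1 y z, rieszKernel_sub_comm 1 y x]; ring
    _ ≤ ∫⁻ y in Metric.ball (0 : ℂ) ρ, ENNReal.ofReal A * (ENNReal.ofReal A *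
        ∫⁻ x in Metric.ball (0 : ℂ) ρ, ∫⁻ z in Metric.ball (0 : ℂ) ρ,
        (rieszKernel 1 (y - z) * rieszKernel 1 (y - x) *
          ‖annulusKernel R ((z - w) ^ 2 - (x - w) ^ 2)‖ₑ)) := by
        refine lintegral_mono fun y => (hq.lintegral_mul_le _).trans ?_
        gcongr
        rw [← lintegral_const_mul' _ _ ENNReal.ofReal_ne_top]
        exact lintegral_mono fun x => hq.lintegral_mul_le _
    _ = ENNReal.ofReal A * (ENNReal.ofReal A * ∫⁻ x in Metric.ball (0 : ℂ) ρ,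
        ∫⁻ z in Metric.ball (0 : ℂ) ρ, ∫⁻ y in Metric.ball (0 : ℂ) ρ,
        (rieszKernel 1 (y - z) * rieszKernel 1 (y - x) *
          ‖annulusKernel R ((z - w) ^ 2 - (x - w) ^ 2)‖ₑ)) := by
        rw [lintegral_const_mul' _ _ ENNReal.ofReal_ne_top,
          lintegral_const_mul' _ _ ENNReal.ofReal_ne_top, lintegral_lintegral_swap]
        · congr 2
          refine lintegral_congr fun x => ?_
          rw [lintegral_lintegral_swap]
          refine Measurable.aemeasurable ?_
          unfold Function.uncurry
          fun_prop
        · refine Measurable.aemeasurable ?_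
          refine Measurable.lintegral_prod_right' (f := fun s : (ℂ × ℂ) × ℂ =>
            rieszKernel 1 (s.1.1 - s.2) * rieszKernel 1 (s.1.1 - s.1.2) *
            ‖annulusKernel R ((s.2 - w) ^ 2 - (s.1.2 - w) ^ 2)‖ₑ) ?_
          fun_prop
    _ ≤ ENNReal.ofReal A * (ENNReal.ofReal A * (D * ∫⁻ x in Metric.ball (0 : ℂ) ρ,
        ∫⁻ z in Metric.ball (0 : ℂ) ρ, rieszKernel (1 / 2) (z - x) *
          ‖annulusKernel R ((z - w) ^ 2 - (x - w) ^ 2)‖ₑ)) := by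
        gcongr
        rw [← lintegral_const_mul' _ _ ENNReal.coe_ne_top]
        refine lintegral_mono fun x => ?_
        rw [← lintegral_const_mul' _ _ ENNReal.coe_ne_top]
        refine lintegral_mono fun z => ?_
        rw [lintegral_mul_const _ (by fun_prop), ← mul_assoc]
        gcongr
        exact hD z x
    _ ≤ _ := by
        refine (mul_le_mul_right (mul_le_mul_right (mul_le_mul_right (hC hR w) _) _) _).trans
          (le_of_eq ?_)
        push_cast
        simp only [ENNReal.ofReal]
        ring

end

/-! ### The borderline estimate, uniform in `R`. -/

section

variable {ρ A : ℝ} {q p : ℂ → ℂ}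

lemma lintegral_rieszKernel_mul_min_lt_top :
    ∫⁻ u : ℂ, rieszKernel 1 u * min 1 (rieszKernel (3 / 2) u) < ⊤ := by
  obtain ⟨K, hK⟩ := exists_setLIntegral_rieszKernel_le 1 (s := 1) (by norm_num) (by norm_num)
  have h2 : (2 : ℝ≥0∞) ^ (5 / 2 : ℝ) < ⊤ := ENNReal.rpow_lt_top_of_nonneg (by norm_num) (by norm_num)
  have hJ : ∫⁻ u : ℂ, ENNReal.ofReal ((1 + ‖u‖) ^ (-(5 / 2) : ℝ)) < ⊤ :=
    finite_integral_one_add_norm (by simp; norm_num)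
  calc _ ≤ ∫⁻ u : ℂ, ((Metric.ball (0 : ℂ) 1).indicator (rieszKernel 1) u +
        2 ^ (5 / 2 : ℝ) * ENNReal.ofReal ((1 + ‖u‖) ^ (-(5 / 2) : ℝ))) := by
        refine lintegral_mono fun u => ?_
        by_cases hu : u ∈ Metric.ball (0 : ℂ) 1
        · rw [Set.indicator_of_mem hu]
          exact le_add_right (mul_le_of_le_one_right' (min_le_left _ _))
        · rw [Set.indicator_of_notMem hu, zero_add]
          have hu1 : 1 ≤ ‖u‖ := by simpa using hu
          refine (mul_le_mul_right (min_le_right _ _) _).trans ?_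
          rw [← rieszKernel_add (by norm_num) (by norm_num), rieszKernel, ← ofReal_norm,
            ← ENNReal.ofReal_inv_of_pos (by positivity), ENNReal.ofReal_rpow_of_pos (by positivity),
            show (2 : ℝ≥0∞) = ENNReal.ofReal 2 by simp, ENNReal.ofReal_rpow_of_pos (by norm_num),
            ← ENNReal.ofReal_mul (by positivity), show (1 + 3 / 2 : ℝ) = 5 / 2 by norm_num]
          refine ENNReal.ofReal_le_ofReal ?_
          rw [Real.rpow_neg (by positivity), ← Real.inv_rpow (by positivity),
            ← Real.mul_rpow (by positivity) (by positivity)]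
          refine Real.rpow_le_rpow (by positivity) ?_ (by norm_num)
          rw [← div_eq_mul_inv, inv_le_comm₀ (by positivity) (by positivity), inv_div]
          linarith
    _ < ⊤ := by
        rw [lintegral_add_left ((measurable_rieszKernel 1).indicator measurableSet_ball),
          lintegral_indicator measurableSet_ball, lintegral_const_mul' (2 ^ (5 / 2 : ℝ)) _ h2.ne]
        refine ENNReal.add_lt_top.2 ⟨?_, ENNReal.mul_lt_top h2 hJ⟩
        have := hK 0
        simp only [sub_zero] at this
        exact this.trans_lt ENNReal.coe_lt_top

lemma lintegral_comp_real_smul {F : ℂ → ℝ≥0∞} (hF : Measurable F) {m : ℝ} (hm : 0 < m) :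
    ∫⁻ u, F (m • u) = ENNReal.ofReal (m⁻¹ ^ 2) * ∫⁻ u, F u := by
  rw [← lintegral_map hF (measurable_const_smul m), Measure.map_addHaar_smul _ hm.ne',
    lintegral_smul_measure, Complex.finrank_real_complex, abs_of_pos (by positivity), inv_pow]
  rfl

lemma rieszKernel_ofReal_mul {s m : ℝ} (hs : 0 ≤ s) (hm : 0 < m) (x : ℂ) :
    rieszKernel s (m • x) = ENNReal.ofReal (m⁻¹ ^ s) * rieszKernel s x := by
  rw [Complex.real_smul, rieszKernel_mul s hs, rieszKernel, ← ofReal_norm, Complex.norm_real,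
    Real.norm_of_nonneg hm.le, ← ENNReal.ofReal_inv_of_pos hm,
    ENNReal.ofReal_rpow_of_pos (by positivity)]

lemma rieszKernel_anti {s : ℝ} (hs : 0 ≤ s) {x y : ℂ} (h : ‖x‖ ≤ ‖y‖) :
    rieszKernel s y ≤ rieszKernel s x := by
  refine ENNReal.rpow_le_rpow (ENNReal.inv_le_inv.2 ?_) hs
  rw [← ofReal_norm, ← ofReal_norm]
  exact ENNReal.ofReal_le_ofReal h

/-- With weight `1 / ‖z - x‖` no rate `β ≥ 1` is integrable at `x = z`, so near that point the cap
of the kernel at size `R` must be used. The outcome has no decay in `R`, only uniformity. -/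
lemma exists_lintegral_rieszKernel_mul_annulusKernel_le (ρ : ℝ) : ∃ C : ℝ≥0, ∀ {R : ℝ}, 0 < R →
    ∀ w z : ℂ, z ≠ w → ∫⁻ x in Metric.ball (0 : ℂ) ρ,
      rieszKernel 1 (z - x) * ‖annulusKernel R ((z - w) ^ 2 - (x - w) ^ 2)‖ₑ ≤
        C * (rieszKernel 1 (z - w) + rieszKernel (3 / 2) (z - w)) := by
  obtain ⟨C, hC⟩ := exists_enorm_annulusKernel_le
  obtain ⟨D, hD⟩ := exists_setLIntegral_rieszKernel_mul_le ρ (s := 1) (t := 1) (κ := 1 / 2)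
    (by norm_num) (by norm_num) (by norm_num) (by norm_num)
  obtain ⟨M, hM⟩ : ∃ M : ℝ≥0, M = ∫⁻ u : ℂ, rieszKernel 1 u * min 1 (rieszKernel (3 / 2) u) :=
    ⟨_, ENNReal.coe_toNNReal lintegral_rieszKernel_mul_min_lt_top.ne⟩
  refine ⟨C * M + C * D, fun {R} hR w z hzw => ?_⟩
  have hc : 0 < ‖z - w‖ := norm_pos_iff.2 (sub_ne_zero.2 hzw)
  set c := z - w with hcdef
  set m : ℝ := R * ‖c‖ with hm
  have hmpos : 0 < m := by positivity
  set F : ℂ → ℝ≥0∞ := fun u => rieszKernel 1 u * min 1 (rieszKernel (3 / 2) u) with hF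
  have hFm : Measurable F := by
    have h1 := measurable_rieszKernel 1
    have h2 := measurable_rieszKernel (3 / 2)
    fun_prop
  have e : ∀ x, c ^ 2 - (x - w) ^ 2 = (z - x) * (z + x - 2 * w) := by intro x; rw [hcdef]; ring
  have pt : ∀ x, rieszKernel 1 (z - x) * ‖annulusKernel R (c ^ 2 - (x - w) ^ 2)‖ₑ ≤
      C * ENNReal.ofReal (R * m) * F (m • (z - x)) +
      C * rieszKernel 1 c * (rieszKernel 1 (x - z) * rieszKernel 1 (x - (2 * w - z))) := by
    intro x
    rw [e]
    -- If `‖z - x‖ ≤ ‖c‖`, the other factor of the phase has length at least `‖c‖`, so the kernel is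
    -- at most `R` times a profile in `m • (z - x)` with `m = R * ‖c‖`; rescaling gives `R * m * m⁻²
    -- = ‖c‖⁻¹`. Otherwise the weight is at most `‖c‖⁻¹`, and `β = 1` suffices.
    rcases le_or_gt ‖z - x‖ ‖c‖ with h | h
    · refine le_add_right ?_
      have hv : ‖c‖ ≤ ‖z + x - 2 * w‖ := by
        have : ‖(2 : ℂ) * c‖ ≤ ‖z - x‖ + ‖z + x - 2 * w‖ := by
          rw [show 2 * c = (z - x) + (z + x - 2 * w) by rw [hcdef]; ring]
          exact norm_add_le _ _
        rw [norm_mul, Complex.norm_ofNat] at this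
        linarith
      have h0 := hC 1 one_pos 0 le_rfl (by norm_num) (R * ((z - x) * (z + x - 2 * w)))
      have h1 := hC 1 one_pos (3 / 2) (by norm_num) le_rfl (R * ((z - x) * (z + x - 2 * w)))
      simp only [ENNReal.ofReal_one, ENNReal.one_rpow, mul_one, rieszKernel, ENNReal.rpow_zero]
        at h0
      rw [ENNReal.ofReal_one, ENNReal.one_rpow, mul_one] at h1
      have h2 : rieszKernel (3 / 2) (R * ((z - x) * (z + x - 2 * w))) ≤
          rieszKernel (3 / 2) (m • (z - x)) := by
        refine rieszKernel_anti (by norm_num) ?_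
        rw [norm_smul, Real.norm_of_nonneg hmpos.le, norm_mul, Complex.norm_real,
          Real.norm_of_nonneg hR.le, norm_mul, hm, mul_assoc, mul_comm ‖c‖]
        gcongr
      have h3 : ‖annulusKernel 1 (R * ((z - x) * (z + x - 2 * w)))‖ₑ ≤
          C * min 1 (rieszKernel (3 / 2) (m • (z - x))) := by
        rcases min_choice 1 (rieszKernel (3 / 2) (m • (z - x))) with h4 | h4 <;> rw [h4]
        · rwa [mul_one]
        · exact h1.trans (by gcongr)
      rw [annulusKernel_scale hR, enorm_mul]
      have e1 : ‖(R : ℂ)‖ₑ = ENNReal.ofReal R := by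
        rw [← ofReal_norm, Complex.norm_real, Real.norm_of_nonneg hR.le]
      rw [e1]
      calc _ ≤ rieszKernel 1 (z - x) * (ENNReal.ofReal R *
            (C * min 1 (rieszKernel (3 / 2) (m • (z - x))))) := by gcongr
        _ = _ := by
            simp only [hF]
            rw [rieszKernel_ofReal_mul zero_le_one hmpos (z - x), Real.rpow_one,
              ENNReal.ofReal_mul hR.le]
            have : ENNReal.ofReal m * ENNReal.ofReal m⁻¹ = 1 := by
              rw [← ENNReal.ofReal_mul hmpos.le, mul_inv_cancel₀ hmpos.ne', ENNReal.ofReal_one]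
            calc _ = (ENNReal.ofReal m * ENNReal.ofReal m⁻¹) * (rieszKernel 1 (z - x) *
                (ENNReal.ofReal R * (C * min 1 (rieszKernel (3 / 2) (m • (z - x)))))) := by
                  rw [this, one_mul]
              _ = _ := by ring
    · refine le_add_left ?_
      have h1 := hC R hR 1 zero_le_one (by norm_num) ((z - x) * (z + x - 2 * w))
      rw [sub_self, ENNReal.rpow_zero, mul_one, rieszKernel_mul _ zero_le_one] at h1
      calc _ ≤ rieszKernel 1 c * (C * (rieszKernel 1 (z - x) * rieszKernel 1 (z + x - 2 * w))) := by
            gcongr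
            exact rieszKernel_anti zero_le_one h.le
        _ = _ := by
            rw [rieszKernel_sub_comm 1 x z, show x - (2 * w - z) = z + x - 2 * w by ring]
            ring
  have hr := measurable_rieszKernel 1
  calc _ ≤ ∫⁻ x in Metric.ball (0 : ℂ) ρ, (C * ENNReal.ofReal (R * m) * F (m • (z - x)) +
        C * rieszKernel 1 c * (rieszKernel 1 (x - z) * rieszKernel 1 (x - (2 * w - z)))) :=
        lintegral_mono fun x => pt x
    _ ≤ C * M * rieszKernel 1 c + C * D * rieszKernel (3 / 2) c := by
        rw [lintegral_add_left (by fun_prop), lintegral_const_mul _ (by fun_prop),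
          lintegral_const_mul _ (by fun_prop)]
        refine add_le_add ?_ ?_
        · calc _ ≤ C * ENNReal.ofReal (R * m) * ∫⁻ x, F (m • (z - x)) := by
                gcongr; exact Measure.restrict_le_self
            _ = C * ENNReal.ofReal (R * m) * (ENNReal.ofReal (m⁻¹ ^ 2) * M) := by
                rw [lintegral_sub_left_eq_self (fun u => F (m • u)) z,
                  lintegral_comp_real_smul hFm hmpos, hM]
            _ = C * M * (ENNReal.ofReal (R * m) * ENNReal.ofReal (m⁻¹ ^ 2)) := by ring
            _ ≤ _ := by
                rw [← ENNReal.ofReal_mul (by positivity), rieszKernel_one, ← ofReal_norm,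
                  ← ENNReal.ofReal_inv_of_pos hc]
                gcongr
                rw [hm]
                field_simp
                exact le_rfl
        · calc _ ≤ C * rieszKernel 1 c * (D * rieszKernel (1 / 2) c) := by
                gcongr
                refine (hD _ _).trans ?_
                gcongr
                rw [show z - (2 * w - z) = 2 * c by rw [hcdef]; ring]
                exact rieszKernel_mul_le_right (by norm_num) (by simp) _
            _ = _ := by
                rw [show (3 / 2 : ℝ) = 1 + 1 / 2 by norm_num,
                  rieszKernel_add (by norm_num) (by norm_num)]
                ring
    _ ≤ _ := by
        push_cast
        rw [mul_add]
        gcongr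
        · exact le_self_add
        · exact le_add_self

/-- Hölder with exponents `5` and `5/4`; the first is large enough that `(3/2) * (5/4) = 15/8`
remains below two. -/
lemma exists_setLIntegral_mul_rieszKernel_le (ρ : ℝ) {s : ℝ} (hs0 : 0 ≤ s) (hs : s ≤ 3 / 2) :
    ∃ C : ℝ≥0, ∀ f : ℂ → ℂ, Measurable f → ∀ w : ℂ,
      ∫⁻ z in Metric.ball (0 : ℂ) ρ, ‖f z‖ₑ * rieszKernel s (z - w) ≤
        C * eLpNorm f 5 (volume.restrict (Metric.ball (0 : ℂ) ρ)) := by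
  obtain ⟨K, hK⟩ := exists_setLIntegral_rieszKernel_le ρ (s := s * (5 / 4)) (by positivity)
    (by linarith)
  refine ⟨K ^ (4 / 5 : ℝ), fun f hf w => ?_⟩
  have hr := measurable_rieszKernel s
  have := ENNReal.lintegral_mul_le_Lp_mul_Lq (volume.restrict (Metric.ball (0 : ℂ) ρ))
    (p := 5) (q := 5 / 4) (by rw [Real.holderConjugate_iff]; norm_num) (f := fun z => ‖f z‖ₑ)
    (g := fun z => rieszKernel s (z - w)) (by fun_prop) (by fun_prop)
  simp only [Pi.mul_apply] at this
  refine this.trans ?_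
  rw [eLpNorm_eq_lintegral_rpow_enorm_toReal (by norm_num) (by norm_num), mul_comm]
  simp only [ENNReal.toReal_ofNat]
  gcongr
  rw [ENNReal.coe_rpow_of_nonneg _ (by norm_num), show (1 / (5 / 4) : ℝ) = 4 / 5 by norm_num]
  gcongr
  refine le_trans (le_of_eq ?_) (hK w)
  refine lintegral_congr fun z => ?_
  rw [rieszKernel, rieszKernel, ENNReal.rpow_mul]

end

/-! ### The antisymmetric kernel and its cancellation. -/

section

variable {ρ A : ℝ} {q p : ℂ → ℂ}

/-- The kernel arising from averaging the antiholomorphic second-order term over an annulus. -/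
def skewKernel (R : ℝ) (w : ℂ) (t : ℂ × ℂ) : ℂ :=
  conj ((t.1 - t.2)⁻¹) * annulusKernel R ((t.1 - w) ^ 2 - (t.2 - w) ^ 2)

lemma measurable_skewKernel {R : ℝ} (hR : 0 < R) (w : ℂ) : Measurable (skewKernel R w) := by
  have h1 : Measurable fun t : ℂ × ℂ => conj ((t.1 - t.2)⁻¹) :=
    measurable_conj_comp (by fun_prop)
  have h2 := measurable_annulusKernel hR
  unfold skewKernel
  fun_prop

/-- The annulus kernel is even, so the sign comes from the Cauchy factor alone. -/
lemma skewKernel_swap {R : ℝ} (hR : 0 < R) (w : ℂ) (t : ℂ × ℂ) :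
    skewKernel R w t.swap = -skewKernel R w t := by
  simp only [skewKernel, Prod.fst_swap, Prod.snd_swap]
  rw [← annulusKernel_neg R hR, neg_sub, ← neg_sub t.1 t.2, inv_neg, map_neg, neg_mul]

lemma enorm_skewKernel_le (R : ℝ) (w : ℂ) (t : ℂ × ℂ) : ‖skewKernel R w t‖ₑ ≤
    rieszKernel 1 (t.1 - t.2) * ‖annulusKernel R ((t.1 - w) ^ 2 - (t.2 - w) ^ 2)‖ₑ := by
  rw [skewKernel, enorm_mul, RCLike.enorm_conj]
  gcongr
  exact enorm_inv_le_rieszKernel _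

lemma exists_lintegral_mul_skewKernel_le (ρ : ℝ) : ∃ C : ℝ≥0, ∀ {R : ℝ}, 0 < R →
    ∀ w : ℂ, ∀ f : ℂ → ℂ, Measurable f →
      ∫⁻ t, ‖f t.1‖ₑ * ‖skewKernel R w t‖ₑ ∂((volume.restrict (Metric.ball (0 : ℂ) ρ)).prod
        (volume.restrict (Metric.ball (0 : ℂ) ρ))) ≤
        C * eLpNorm f 5 (volume.restrict (Metric.ball (0 : ℂ) ρ)) := by
  obtain ⟨C, hC⟩ := exists_lintegral_rieszKernel_mul_annulusKernel_le ρ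
  obtain ⟨D, hD⟩ := exists_setLIntegral_mul_rieszKernel_le ρ (s := 1) (by norm_num) (by norm_num)
  obtain ⟨E, hE⟩ := exists_setLIntegral_mul_rieszKernel_le ρ (s := 3 / 2) (by norm_num) le_rfl
  refine ⟨C * (D + E), fun {R} hR w f hf => ?_⟩
  have hk := measurable_skewKernel hR w
  have h1 := measurable_rieszKernel 1
  have h2 := measurable_rieszKernel (3 / 2)
  rw [lintegral_prod _ (by fun_prop)]
  have hw : ∀ᵐ z ∂(volume.restrict (Metric.ball (0 : ℂ) ρ)), z ≠ w :=
    ae_restrict_of_ae (Measure.ae_ne volume w)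
  calc _ ≤ ∫⁻ z in Metric.ball (0 : ℂ) ρ, C * (‖f z‖ₑ * rieszKernel 1 (z - w) +
        ‖f z‖ₑ * rieszKernel (3 / 2) (z - w)) := by
        refine lintegral_mono_ae (hw.mono fun z hz => ?_)
        simp only
        rw [lintegral_const_mul' _ _ enorm_ne_top, ← mul_add, mul_left_comm]
        refine mul_le_mul_right ?_ _
        exact (lintegral_mono fun x => enorm_skewKernel_le R w (z, x)).trans (hC hR w z hz)
    _ ≤ C * (D * eLpNorm f 5 (volume.restrict (Metric.ball (0 : ℂ) ρ)) +
          E * eLpNorm f 5 (volume.restrict (Metric.ball (0 : ℂ) ρ))) := by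
        rw [lintegral_const_mul' _ _ ENNReal.coe_ne_top, lintegral_add_left (by fun_prop)]
        gcongr
        · exact hD f hf w
        · exact hE f hf w
    _ = _ := by push_cast; ring

lemma lintegral_mul_skewKernel_swap {R : ℝ} (hR : 0 < R) (w : ℂ) {f : ℂ → ℂ}
    (ν : Measure ℂ) [SFinite ν] :
    ∫⁻ t, ‖f t.2‖ₑ * ‖skewKernel R w t‖ₑ ∂(ν.prod ν) =
      ∫⁻ t, ‖f t.1‖ₑ * ‖skewKernel R w t‖ₑ ∂(ν.prod ν) := by
  rw [← lintegral_prod_swap]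
  refine lintegral_congr fun t => ?_
  rw [skewKernel_swap hR, enorm_neg, Prod.snd_swap]

lemma integrable_mul_skewKernel {R : ℝ} (hR : 0 < R) (w : ℂ) {f g : ℂ → ℂ} (hf : Measurable f)
    (hg : Measurable g) {M N : ℝ} (hM : ∀ z, ‖f z‖ ≤ M) (hN : ∀ z, ‖g z‖ ≤ N) :
    Integrable (fun t : ℂ × ℂ => f t.1 * conj (g t.2) * skewKernel R w t)
      ((volume.restrict (Metric.ball (0 : ℂ) ρ)).prod
        (volume.restrict (Metric.ball (0 : ℂ) ρ))) := by
  obtain ⟨C, hC⟩ := exists_lintegral_mul_skewKernel_le ρ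
  have h1 : Measurable fun t : ℂ × ℂ => conj (g t.2) :=
    measurable_conj_comp (hg.comp measurable_snd)
  have hk := measurable_skewKernel hR w
  refine ⟨Measurable.aestronglyMeasurable (by fun_prop), ?_⟩
  have hfin : IsFiniteMeasure (volume.restrict (Metric.ball (0 : ℂ) ρ)) :=
    ⟨by rw [Measure.restrict_apply_univ]; exact measure_ball_lt_top⟩
  calc _ ≤ ∫⁻ t, ENNReal.ofReal N * (‖f t.1‖ₑ * ‖skewKernel R w t‖ₑ)
        ∂((volume.restrict (Metric.ball (0 : ℂ) ρ)).prod
          (volume.restrict (Metric.ball (0 : ℂ) ρ))) := by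
        refine lintegral_mono fun t => ?_
        rw [enorm_mul, enorm_mul, RCLike.enorm_conj, mul_comm ‖f t.1‖ₑ, mul_assoc]
        gcongr
        rw [← ofReal_norm]
        exact ENNReal.ofReal_le_ofReal (hN _)
    _ ≤ ENNReal.ofReal N * (C * eLpNorm f 5 (volume.restrict (Metric.ball (0 : ℂ) ρ))) := by
        rw [lintegral_const_mul' _ _ ENNReal.ofReal_ne_top]
        gcongr
        exact hC hR w f hf
    _ < ⊤ := ENNReal.mul_lt_top ENNReal.ofReal_lt_top (ENNReal.mul_lt_top ENNReal.coe_lt_top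
        (MemLp.of_bound hf.aestronglyMeasurable M (Eventually.of_forall hM)).2)

/-- Averaging the integrand with its swap replaces the density by `f z * conj (g x) - f x * conj (g
z)`, which is `O(‖z - x‖)` and cancels the Cauchy pole. The annulus kernel is then integrated alone.
-/
lemma exists_integral_lipschitz_mul_skewKernel_le (ρ : ℝ) : ∃ C : ℝ≥0, ∀ {R : ℝ}, 0 < R →
    ∀ w : ℂ, ∀ {f g : ℂ → ℂ} {M L : ℝ≥0}, LipschitzWith L f → LipschitzWith L g →
      (∀ z, ‖f z‖ ≤ M) → (∀ z, ‖g z‖ ≤ M) →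
      ‖∫ t, f t.1 * conj (g t.2) * skewKernel R w t
        ∂((volume.restrict (Metric.ball (0 : ℂ) ρ)).prod
          (volume.restrict (Metric.ball (0 : ℂ) ρ)))‖ₑ ≤
        C * (M * L) * ENNReal.ofReal R ^ (-(1 / 4) : ℝ) := by
  obtain ⟨C, hC⟩ := exists_lintegral_sq_sub_sq_le ρ
  refine ⟨2 * (NNReal.sqrt (2 * ρ).toNNReal * C), fun {R} hR w {f g M L} hfL hgL hM hN => ?_⟩
  have hf := hfL.continuous.measurable
  have hg := hgL.continuous.measurable
  set ν := volume.restrict (Metric.ball (0 : ℂ) ρ) with hν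
  have hI := integrable_mul_skewKernel (ρ := ρ) hR w hf hg hM hN
  rw [← hν] at hI
  have hkm := measurable_annulusKernel hR
  have hrm := measurable_rieszKernel (1 / 2)
  have e1 : 2 * ∫ t, f t.1 * conj (g t.2) * skewKernel R w t ∂(ν.prod ν) =
      ∫ t, (f t.1 * conj (g t.2) - f t.2 * conj (g t.1)) * skewKernel R w t ∂(ν.prod ν) := by
    have h2 : ∫ t, f t.1 * conj (g t.2) * skewKernel R w t ∂(ν.prod ν) =
        ∫ t : ℂ × ℂ, f t.2 * conj (g t.1) * skewKernel R w t.swap ∂(ν.prod ν) :=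
      (integral_prod_swap (μ := ν) (ν := ν)
        (fun t => f t.1 * conj (g t.2) * skewKernel R w t)).symm
    rw [two_mul]
    nth_rewrite 2 [h2]
    have hI2 : Integrable (fun t : ℂ × ℂ => f t.2 * conj (g t.1) * skewKernel R w t.swap)
      (ν.prod ν) := hI.swap
    rw [← integral_add hI hI2]
    refine integral_congr_ae (Eventually.of_forall fun t => ?_)
    simp only [skewKernel_swap hR]
    ring
  have pt : ∀ t : ℂ × ℂ, ‖(f t.1 * conj (g t.2) - f t.2 * conj (g t.1)) * skewKernel R w t‖ₑ ≤
      2 * (M * L) * ‖annulusKernel R ((t.1 - w) ^ 2 - (t.2 - w) ^ 2)‖ₑ := by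
    intro t
    have h1 : ‖f t.1 - f t.2‖ ≤ L * ‖t.1 - t.2‖ := by
      rw [← dist_eq_norm, ← dist_eq_norm]; exact hfL.dist_le_mul _ _
    have h2 : ‖g t.2 - g t.1‖ ≤ L * ‖t.1 - t.2‖ := by
      rw [← dist_eq_norm, ← dist_eq_norm, dist_comm]; exact hgL.dist_le_mul _ _
    have h3 : ‖f t.1 * conj (g t.2) - f t.2 * conj (g t.1)‖ ≤ 2 * (M * L) * ‖t.1 - t.2‖ := by
      calc _ = ‖(f t.1 - f t.2) * conj (g t.2) + f t.2 * conj (g t.2 - g t.1)‖ := by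
            rw [map_sub]; congr 1; ring
        _ ≤ ‖f t.1 - f t.2‖ * ‖g t.2‖ + ‖f t.2‖ * ‖g t.2 - g t.1‖ := by
            refine (norm_add_le _ _).trans ?_
            rw [norm_mul, norm_mul, RCLike.norm_conj, RCLike.norm_conj]
        _ ≤ (L * ‖t.1 - t.2‖) * M + M * (L * ‖t.1 - t.2‖) := by
            gcongr
            · exact hN _
            · exact hM _
        _ = _ := by ring
    have h4 : ‖(f t.1 * conj (g t.2) - f t.2 * conj (g t.1)) * skewKernel R w t‖ ≤
        2 * (M * L) * ‖annulusKernel R ((t.1 - w) ^ 2 - (t.2 - w) ^ 2)‖ := by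
      rw [skewKernel, norm_mul, norm_mul, RCLike.norm_conj, ← mul_assoc, norm_inv]
      refine mul_le_mul_of_nonneg_right ?_ (norm_nonneg _)
      calc _ ≤ 2 * (M * L) * ‖t.1 - t.2‖ * ‖t.1 - t.2‖⁻¹ :=
            mul_le_mul_of_nonneg_right h3 (by positivity)
        _ ≤ 2 * (M * L) * 1 := by
            rw [mul_assoc]
            exact mul_le_mul_of_nonneg_left mul_inv_le_one (by positivity)
        _ = _ := mul_one _
    have h5 := ENNReal.ofReal_le_ofReal h4
    rw [ofReal_norm, ENNReal.ofReal_mul (by positivity), ofReal_norm] at h5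
    refine h5.trans (le_of_eq ?_)
    rw [show (2 * (M * L) : ℝ) = ((2 * (M * L) : ℝ≥0) : ℝ) by push_cast; rfl,
      ENNReal.ofReal_coe_nnreal]
    push_cast; rfl
  -- On the ball the Riesz kernel of order `1/2` is bounded below, so it can be inserted in order to
  -- reuse `exists_lintegral_sq_sub_sq_le`.
  have hb : ∀ z ∈ Metric.ball (0 : ℂ) ρ, ∀ x ∈ Metric.ball (0 : ℂ) ρ,
      1 ≤ (NNReal.sqrt (2 * ρ).toNNReal : ℝ≥0∞) * rieszKernel (1 / 2) (z - x) := by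
    intro z hz x hx
    rcases eq_or_ne z x with rfl | hne
    · have hρ : 0 < ρ := (norm_nonneg z).trans_lt (by simpa using hz)
      rw [sub_self, rieszKernel, enorm_zero, ENNReal.inv_zero, ENNReal.top_rpow_of_pos (by norm_num),
        ENNReal.mul_top]
      · exact le_top
      · simp [hρ]
    · have hd : 0 < ‖z - x‖ := norm_pos_iff.2 (sub_ne_zero.2 hne)
      have hle : ‖z - x‖ ≤ 2 * ρ := by
        have h1 : ‖z‖ < ρ := by simpa using hz
        have h2 : ‖x‖ < ρ := by simpa using hx
        linarith [norm_sub_le z x]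
      rw [rieszKernel, ← ofReal_norm, ← ENNReal.ofReal_inv_of_pos hd,
        ENNReal.ofReal_rpow_of_pos (by positivity), ← ENNReal.ofReal_coe_nnreal,
        ← ENNReal.ofReal_mul (by positivity), ENNReal.one_le_ofReal, Real.coe_sqrt,
        Real.coe_toNNReal _ (by linarith), ← Real.sqrt_eq_rpow, ← Real.sqrt_mul (by linarith),
        Real.one_le_sqrt, ← div_eq_mul_inv, one_le_div hd]
      exact hle
  calc _ ≤ ‖2 * ∫ t, f t.1 * conj (g t.2) * skewKernel R w t ∂(ν.prod ν)‖ₑ := by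
        rw [enorm_mul]
        refine le_mul_of_one_le_left' ?_
        rw [← ofReal_norm]; simp
    _ ≤ ∫⁻ t, 2 * (M * L) * ‖annulusKernel R ((t.1 - w) ^ 2 - (t.2 - w) ^ 2)‖ₑ ∂(ν.prod ν) := by
        rw [e1]
        exact (enorm_integral_le_lintegral_enorm _).trans (lintegral_mono pt)
    _ = 2 * (M * L) * ∫⁻ x in Metric.ball (0 : ℂ) ρ, ∫⁻ z in Metric.ball (0 : ℂ) ρ,
          ‖annulusKernel R ((z - w) ^ 2 - (x - w) ^ 2)‖ₑ := by
        have hm : Measurable fun t : ℂ × ℂ =>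
          ‖annulusKernel R ((t.1 - w) ^ 2 - (t.2 - w) ^ 2)‖ₑ := by fun_prop
        rw [lintegral_const_mul _ hm, lintegral_prod_symm _ hm.aemeasurable]
    _ ≤ 2 * (M * L) * (NNReal.sqrt (2 * ρ).toNNReal * (C * ENNReal.ofReal R ^ (-(1 / 4) : ℝ))) := by
        gcongr
        refine le_trans ?_ (mul_le_mul_right (hC hR w) _)
        rw [← lintegral_const_mul' _ _ ENNReal.coe_ne_top]
        refine setLIntegral_mono' measurableSet_ball fun x hx => ?_
        rw [← lintegral_const_mul' _ _ ENNReal.coe_ne_top]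
        refine setLIntegral_mono' measurableSet_ball fun z hz => ?_
        rw [← mul_assoc]
        exact le_mul_of_one_le_left' (hb z hz x hx)
    _ = _ := by push_cast; ring

lemma IsBddPotential.exists_lipschitz_approx (hq : IsBddPotential ρ A q) {ε : ℝ} (hε : 0 < ε) :
    ∃ (f : ℂ → ℂ) (M L : ℝ≥0), LipschitzWith L f ∧ (∀ z, ‖f z‖ ≤ M) ∧
      eLpNorm (q - f) 5 (volume.restrict (Metric.ball (0 : ℂ) ρ)) ≤ ENNReal.ofReal ε := by
  have hm : MemLp q 5 volume := by
    have hfin : IsFiniteMeasure (volume.restrict (Metric.ball (0 : ℂ) ρ)) :=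
      ⟨by rw [Measure.restrict_apply_univ]; exact measure_ball_lt_top⟩
    have h1 : MemLp q 5 (volume.restrict (Metric.ball (0 : ℂ) ρ)) :=
      MemLp.of_bound hq.measurable.aestronglyMeasurable A (Eventually.of_forall hq.norm_le)
    rw [← memLp_indicator_iff_restrict measurableSet_ball] at h1
    convert h1 using 1
    ext z
    by_cases hz : z ∈ Metric.ball (0 : ℂ) ρ
    · rw [Set.indicator_of_mem hz]
    · rw [Set.indicator_of_notMem hz, hq.eq_zero z hz]
  obtain ⟨f, hf1, hf2, hf3⟩ := MemLp.exist_eLpNorm_sub_le (by norm_num) (by norm_num) hm hε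
  obtain ⟨L, hL⟩ := ContDiff.lipschitzWith_of_hasCompactSupport hf1 hf2 (by simp)
  obtain ⟨M, hM⟩ := hf1.exists_bound_of_continuous hf2.continuous
  refine ⟨f, M.toNNReal, L, hL, fun z => (hM z).trans (Real.le_coe_toNNReal M), ?_⟩
  exact (eLpNorm_mono_measure _ Measure.restrict_le_self).trans hf3

end

section

variable {ρ A : ℝ} {q p : ℂ → ℂ}

lemma enorm_integral_mul_skewKernel_le {R : ℝ} {w : ℂ} {f g : ℂ → ℂ} {C : ℝ≥0} {N δ : ℝ}
    {ν : Measure ℂ} [SFinite ν] (hR : 0 < R)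
    (hC : ∀ f : ℂ → ℂ, Measurable f →
      ∫⁻ t, ‖f t.1‖ₑ * ‖skewKernel R w t‖ₑ ∂(ν.prod ν) ≤ C * eLpNorm f 5 ν)
    (hf : Measurable f) (hδ : eLpNorm f 5 ν ≤ ENNReal.ofReal δ) (hN : ∀ z, ‖g z‖ ≤ N) :
    ‖∫ t, f t.1 * conj (g t.2) * skewKernel R w t ∂(ν.prod ν)‖ₑ ≤ ENNReal.ofReal (N * (C * δ)) ∧
    ‖∫ t, g t.1 * conj (f t.2) * skewKernel R w t ∂(ν.prod ν)‖ₑ ≤ ENNReal.ofReal (N * (C * δ)) := by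
  have hN0 : 0 ≤ N := (norm_nonneg _).trans (hN 0)
  have hg : ∀ z, ‖g z‖ₑ ≤ ENNReal.ofReal N := fun z => by
    rw [← ofReal_norm]; exact ENNReal.ofReal_le_ofReal (hN z)
  have h : ENNReal.ofReal N * ∫⁻ t, ‖f t.1‖ₑ * ‖skewKernel R w t‖ₑ ∂(ν.prod ν) ≤
      ENNReal.ofReal (N * (C * δ)) := by
    rw [ENNReal.ofReal_mul hN0, ENNReal.ofReal_mul C.coe_nonneg, ENNReal.ofReal_coe_nnreal]
    gcongr
    exact (hC f hf).trans (by gcongr)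
  constructor
  · refine (enorm_integral_le_lintegral_enorm _).trans (le_trans ?_ h)
    rw [← lintegral_const_mul' _ _ ENNReal.ofReal_ne_top]
    refine lintegral_mono fun t => ?_
    rw [enorm_mul, enorm_mul, RCLike.enorm_conj, mul_comm ‖f t.1‖ₑ, mul_assoc]
    gcongr
    exact hg _
  · refine (enorm_integral_le_lintegral_enorm _).trans (le_trans ?_ h)
    rw [← lintegral_mul_skewKernel_swap hR, ← lintegral_const_mul' _ _ ENNReal.ofReal_ne_top]
    refine lintegral_mono fun t => ?_
    rw [enorm_mul, enorm_mul, RCLike.enorm_conj, mul_assoc]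
    gcongr
    exact hg _

/-- Replace `q` by `f` and then `p` by `g`, both Lipschitz and `L⁵`-close. The two errors are small
uniformly in `R` and `w`, and the term with `f` and `g` decays by antisymmetry. The approximation
gives no rate in `R`. -/
lemma eventually_integral_mul_skewKernel_le (hq : IsBddPotential ρ A q) (hp : IsBddPotential ρ A p)
    {ε : ℝ} (hε : 0 < ε) : ∀ᶠ R : ℝ in atTop, ∀ w : ℂ,
    ‖∫ t, q t.1 * conj (p t.2) * skewKernel R w t
        ∂((volume.restrict (Metric.ball (0 : ℂ) ρ)).prod
          (volume.restrict (Metric.ball (0 : ℂ) ρ)))‖ₑ ≤ ENNReal.ofReal ε := by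
  obtain ⟨C, hC⟩ := exists_lintegral_mul_skewKernel_le ρ
  obtain ⟨D, hD⟩ := exists_integral_lipschitz_mul_skewKernel_le ρ
  have hA := hq.nonneg
  have hδ1 : 0 < ε / 3 / (A * C + 1) := by positivity
  obtain ⟨f, M₁, L₁, hfL, hfM, hfδ⟩ := hq.exists_lipschitz_approx hδ1
  -- The tolerance for `p` is fixed after `f`, since the second error is multiplied by the sup bound
  -- `M₁` of `f`.
  have hδ2 : 0 < ε / 3 / (M₁ * C + 1) := by positivity
  obtain ⟨g, M₂, L₂, hgL, hgM, hgδ⟩ := hp.exists_lipschitz_approx hδ2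
  set M := max M₁ M₂
  set L := max L₁ L₂
  set ν := volume.restrict (Metric.ball (0 : ℂ) ρ)
  have hlim : Tendsto (fun R : ℝ => D * (M * L) * R ^ (-(1 / 4) : ℝ)) atTop (𝓝 0) := by
    simpa using (tendsto_rpow_neg_atTop (y := 1 / 4) (by norm_num)).const_mul (D * (M * L) : ℝ)
  filter_upwards [eventually_gt_atTop 0, hlim.eventually (gt_mem_nhds (show 0 < ε / 3 by positivity))]
    with R hR hRε w
  have hqm := hq.measurable
  have hpm := hp.measurable
  have hfm := hfL.continuous.measurable
  have hgm := hgL.continuous.measurable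
  have hsmall : ∀ N : ℝ, 0 ≤ N → N * (C * (ε / 3 / (N * C + 1))) ≤ ε / 3 := by
    intro N hN
    have : (0 : ℝ) < N * C + 1 := by positivity
    rw [← mul_assoc, mul_div_assoc', div_le_iff₀ this]
    nlinarith
  have hqf : ∀ z, ‖(q - f) z‖ ≤ A + M₁ := fun z =>
    (norm_sub_le _ _).trans (add_le_add (hq.norm_le z) (hfM z))
  have hpg : ∀ z, ‖(p - g) z‖ ≤ A + M₂ := fun z =>
    (norm_sub_le _ _).trans (add_le_add (hp.norm_le z) (hgM z))
  have i1 := integrable_mul_skewKernel (ρ := ρ) hR w (hqm.sub hfm) hpm hqf hp.norm_le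
  have i2 := integrable_mul_skewKernel (ρ := ρ) hR w hfm (hpm.sub hgm) hfM hpg
  have i3 := integrable_mul_skewKernel (ρ := ρ) hR w hfm hgm hfM hgM
  have e : ∫ t, q t.1 * conj (p t.2) * skewKernel R w t ∂(ν.prod ν) =
      (∫ t, (q - f) t.1 * conj (p t.2) * skewKernel R w t ∂(ν.prod ν)) +
      ((∫ t, f t.1 * conj ((p - g) t.2) * skewKernel R w t ∂(ν.prod ν)) +
       ∫ t, f t.1 * conj (g t.2) * skewKernel R w t ∂(ν.prod ν)) := by
    rw [← integral_add i2 i3, ← integral_add i1 (by exact i2.add i3)]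
    refine integral_congr_ae (Eventually.of_forall fun t => ?_)
    simp only [Pi.sub_apply, map_sub]
    ring
  have b1 := (enorm_integral_mul_skewKernel_le hR (fun f hf => hC hR w f hf) (hqm.sub hfm) hfδ
    hp.norm_le).1
  have b2 := (enorm_integral_mul_skewKernel_le hR (fun f hf => hC hR w f hf) (hpm.sub hgm) hgδ
    hfM).2
  have b3 := hD hR w (M := M) (L := L) (hfL.weaken (le_max_left _ _)) (hgL.weaken (le_max_right _ _))
    (fun z => (hfM z).trans (NNReal.coe_le_coe.2 (le_max_left _ _)))
    (fun z => (hgM z).trans (NNReal.coe_le_coe.2 (le_max_right _ _)))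
  have b3' : D * (M * L) * ENNReal.ofReal R ^ (-(1 / 4) : ℝ) ≤ ENNReal.ofReal (ε / 3) := by
    rw [ENNReal.ofReal_rpow_of_pos hR, ← ENNReal.ofReal_coe_nnreal (p := D),
      ← ENNReal.ofReal_coe_nnreal (p := M), ← ENNReal.ofReal_coe_nnreal (p := L),
      ← ENNReal.ofReal_mul (by positivity), ← ENNReal.ofReal_mul (by positivity),
      ← ENNReal.ofReal_mul (by positivity)]
    exact ENNReal.ofReal_le_ofReal hRε.le
  rw [e]
  calc _ ≤ ENNReal.ofReal (ε / 3) + (ENNReal.ofReal (ε / 3) + ENNReal.ofReal (ε / 3)) := by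
        refine (enorm_add_le _ _).trans (add_le_add
          (b1.trans (ENNReal.ofReal_le_ofReal (hsmall A hA)))
          ((enorm_add_le _ _).trans (add_le_add
            (b2.trans (ENNReal.ofReal_le_ofReal (hsmall M₁ M₁.2))) (b3.trans b3'))))
    _ = _ := by
        rw [← ENNReal.ofReal_add (by positivity) (by positivity),
          ← ENNReal.ofReal_add (by positivity) (by positivity)]
        congr 1; ring

/-! ### Averages of the first-order terms. -/

/-- The oscillatory integral `∫ exp (-i Im[lam (z - w)²] / 2) q z f z`. -/
def oscInt (q : ℂ → ℂ) (lam w : ℂ) (f : ℂ → ℂ) : ℂ := ∫ z, oscPhase lam w z * (q z * f z)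

lemma IsBddPotential.conj (hq : IsBddPotential ρ A q) : IsBddPotential ρ A (fun z => conj (q z)) :=
  ⟨measurable_conj_comp hq.measurable, norm_conj_le hq.norm_le, fun z hz => by
    rw [hq.eq_zero z hz, map_zero]⟩

lemma integrable_prod_cauchyType {A' : ℝ} (hq : IsBddPotential ρ A q)
    (hp : IsBddPotential ρ A' p) {σ : ℂ → ℂ}
    (hσm : Measurable σ) (hσ : ∀ u, ‖σ u‖ₑ ≤ rieszKernel 1 u) :
    Integrable (fun t : ℂ × ℂ => q t.1 * (p t.2 * σ (t.1 - t.2))) (volume.prod volume) := by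
  have hqm := hq.measurable
  have hpm := hp.measurable
  have hm : Measurable fun t : ℂ × ℂ => q t.1 * (p t.2 * σ (t.1 - t.2)) := by fun_prop
  refine ⟨hm.aestronglyMeasurable, ?_⟩
  obtain ⟨K, hK⟩ := exists_setLIntegral_rieszKernel_le ρ (s := 1) (by norm_num) (by norm_num)
  rw [HasFiniteIntegral, lintegral_prod _ (by fun_prop)]
  calc _ ≤ ∫⁻ z, ‖q z‖ₑ * (ENNReal.ofReal A' * K) := by
        refine lintegral_mono fun z => ?_
        simp only [enorm_mul]
        rw [lintegral_const_mul' _ _ enorm_ne_top]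
        gcongr
        refine (hp.lintegral_mul_le _).trans ?_
        gcongr
        refine le_trans (lintegral_mono fun x => ?_) (hK z)
        rw [rieszKernel_sub_comm]
        exact hσ _
    _ ≤ ENNReal.ofReal A * ∫⁻ z in Metric.ball (0 : ℂ) ρ, ENNReal.ofReal A' * K :=
        hq.lintegral_mul_le _
    _ < ⊤ := by
        rw [setLIntegral_const]
        exact ENNReal.mul_lt_top ENNReal.ofReal_lt_top (ENNReal.mul_lt_top
          (ENNReal.mul_lt_top ENNReal.ofReal_lt_top ENNReal.coe_lt_top) measure_ball_lt_top)

/-- `E` stands for the phase of the inner variable or its conjugate, and `ζ` for the combined phase,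
so the holomorphic and antiholomorphic terms are treated at once. -/
lemma integral_annulus_oscInt_cauchyType (hq : IsBddPotential ρ A q) (hp : IsBddPotential ρ A p)
    {σ : ℂ → ℂ} (hσm : Measurable σ) (hσ : ∀ u, ‖σ u‖ₑ ≤ rieszKernel 1 u) {R : ℝ} (hR : 0 < R)
    {w : ℂ} {E : ℂ → ℂ → ℂ} {ζ : ℂ × ℂ → ℂ} (hζ : Measurable ζ)
    (hE : ∀ lam z x, oscPhase lam w z * E lam x =
      Complex.exp (-Complex.I * (((lam * ζ (z, x)).im / 2 : ℝ) : ℂ))) :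
    IntegrableOn (fun lam => ((‖lam‖⁻¹ : ℝ) : ℂ) *
      oscInt q lam w (fun z => ∫ x, E lam x * (p x * σ (z - x)))) (annulus R) ∧
    ∫ lam in annulus R, ((‖lam‖⁻¹ : ℝ) : ℂ) *
      oscInt q lam w (fun z => ∫ x, E lam x * (p x * σ (z - x))) =
      ∫ t, q t.1 * (p t.2 * σ (t.1 - t.2)) * annulusKernel R (ζ t) ∂(volume.prod volume) := by
  have hH := integrable_prod_cauchyType hq hp hσm hσ
  have e : ∀ lam : ℂ, oscInt q lam w (fun z => ∫ x, E lam x * (p x * σ (z - x))) =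
      ∫ t, Complex.exp (-Complex.I * (((lam * ζ t).im / 2 : ℝ) : ℂ)) *
        (q t.1 * (p t.2 * σ (t.1 - t.2))) ∂(volume.prod volume) := by
    intro lam
    rw [integral_prod]
    · refine integral_congr_ae (Eventually.of_forall fun z => ?_)
      simp only
      rw [← integral_const_mul, ← integral_const_mul]
      refine integral_congr_ae (Eventually.of_forall fun x => ?_)
      simp only
      rw [← hE lam z x]; ring
    · refine hH.bdd_mul (c := 1) (Measurable.aestronglyMeasurable (by fun_prop))
        (Eventually.of_forall fun t => (norm_cexp_neg_I_mul _).le)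
  simp_rw [e]
  exact ⟨integrable_annulus_cexp_mul hR hH hζ, integral_annulus_cexp_mul hR hH hζ⟩

lemma lsOp_eq_integral (p : ℂ → ℂ) (lam w : ℂ) (f : ℂ → ℂ) (z : ℂ) :
    lsOp p lam w f z = ∫ x, oscPhase lam w x * (p x * f x * ((1 / (Real.pi : ℂ)) * (z - x)⁻¹)) := by
  rw [lsOp, ← integral_const_mul]
  congr 1; ext x; rw [div_eq_mul_inv]; ring

lemma conj_lsOp_eq_integral (p : ℂ → ℂ) (lam w : ℂ) (f : ℂ → ℂ) (z : ℂ) :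
    conj (lsOp p lam w f z) = ∫ x, conj (oscPhase lam w x) *
      (conj (p x) * conj (f x) * conj ((1 / (Real.pi : ℂ)) * (z - x)⁻¹)) := by
  rw [lsOp_eq_integral, ← integral_conj]
  simp only [map_mul]

lemma enorm_one_div_pi_mul_inv_le (u : ℂ) : ‖(1 / (Real.pi : ℂ)) * u⁻¹‖ₑ ≤ rieszKernel 1 u := by
  rw [enorm_mul]
  exact (mul_le_of_le_one_left' enorm_one_div_pi_le).trans (enorm_inv_le_rieszKernel u)

lemma enorm_conj_one_div_pi_mul_inv_le (u : ℂ) :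
    ‖conj ((1 / (Real.pi : ℂ)) * u⁻¹)‖ₑ ≤ rieszKernel 1 u := by
  rw [RCLike.enorm_conj]; exact enorm_one_div_pi_mul_inv_le u

lemma measurable_one_div_pi_mul_inv : Measurable fun u : ℂ => (1 / (Real.pi : ℂ)) * u⁻¹ := by
  fun_prop

lemma integral_prod_restrict_ball (hq : IsBddPotential ρ A q) (hp : IsBddPotential ρ A p)
    (k : ℂ × ℂ → ℂ) :
    ∫ t, q t.1 * p t.2 * k t ∂((volume.restrict (Metric.ball (0 : ℂ) ρ)).prod
          (volume.restrict (Metric.ball (0 : ℂ) ρ))) =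
      ∫ t, q t.1 * p t.2 * k t ∂(volume.prod volume) := by
  rw [Measure.prod_restrict]
  refine setIntegral_eq_integral_of_forall_compl_eq_zero fun t ht => ?_
  rw [Set.mem_prod, not_and_or] at ht
  rcases ht with h | h
  · rw [hq.eq_zero _ h]; ring
  · rw [hp.eq_zero _ h]; ring

/-- Conjugation makes the phases subtract and conjugates the Cauchy kernel, which is how
`skewKernel` arises. -/
lemma eventually_annulus_oscInt_conj_lsOp_one_le (hq : IsBddPotential ρ A q)
    (hp : IsBddPotential ρ A p) {ε : ℝ} (hε : 0 < ε) : ∀ᶠ R : ℝ in atTop, ∀ w : ℂ,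
    IntegrableOn (fun lam => ((‖lam‖⁻¹ : ℝ) : ℂ) *
      oscInt q lam w (fun z => conj (lsOp p lam w (fun _ => 1) z))) (annulus R) ∧
    ‖∫ lam in annulus R, ((‖lam‖⁻¹ : ℝ) : ℂ) *
      oscInt q lam w (fun z => conj (lsOp p lam w (fun _ => 1) z))‖ₑ ≤ ENNReal.ofReal ε := by
  filter_upwards [eventually_gt_atTop 0, eventually_integral_mul_skewKernel_le hq hp hε]
    with R hR h w
  have key := integral_annulus_oscInt_cauchyType hq hp.conj
    (measurable_conj_comp measurable_one_div_pi_mul_inv) enorm_conj_one_div_pi_mul_inv_le hR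
    (ζ := fun t => (t.1 - w) ^ 2 - (t.2 - w) ^ 2) (by fun_prop)
    (fun lam z x => oscPhase_mul_conj_eq lam w z x)
  simp_rw [conj_lsOp_eq_integral, map_one, mul_one]
  refine ⟨key.1, ?_⟩
  rw [key.2]
  have e : ∫ t, q t.1 * (conj (p t.2) * conj (1 / (Real.pi : ℂ) * (t.1 - t.2)⁻¹)) *
      annulusKernel R ((t.1 - w) ^ 2 - (t.2 - w) ^ 2) ∂(volume.prod volume) =
      (1 / (Real.pi : ℂ)) * ∫ t, q t.1 * conj (p t.2) * skewKernel R w t ∂(volume.prod volume) := by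
    rw [← integral_const_mul]
    refine integral_congr_ae (Eventually.of_forall fun t => ?_)
    simp only [skewKernel, map_mul, map_div₀, map_one, Complex.conj_ofReal]
    ring
  rw [e, enorm_mul, ← integral_prod_restrict_ball hq hp.conj]
  exact (mul_le_of_le_one_left' enorm_one_div_pi_le).trans (h w)

/-- Here the phases add, so absolute values and `exists_lintegral_sq_add_sq_le` are enough, and a
rate results. -/
lemma exists_annulus_oscInt_lsOp_one_le (hq : IsBddPotential ρ A q) (hp : IsBddPotential ρ A p) :
    ∃ C : ℝ≥0, ∀ {R : ℝ}, 0 < R → ∀ w : ℂ,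
    IntegrableOn (fun lam => ((‖lam‖⁻¹ : ℝ) : ℂ) *
      oscInt q lam w (lsOp p lam w (fun _ => 1))) (annulus R) ∧
    ‖∫ lam in annulus R, ((‖lam‖⁻¹ : ℝ) : ℂ) *
      oscInt q lam w (lsOp p lam w (fun _ => 1))‖ₑ ≤ C * ENNReal.ofReal R ^ (-(1 / 4) : ℝ) := by
  obtain ⟨C, hC⟩ := exists_lintegral_sq_add_sq_le ρ
  refine ⟨A.toNNReal * (A.toNNReal * C), fun {R} hR w => ?_⟩
  have key := integral_annulus_oscInt_cauchyType hq hp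
    measurable_one_div_pi_mul_inv enorm_one_div_pi_mul_inv_le hR
    (ζ := fun t => (t.1 - w) ^ 2 + (t.2 - w) ^ 2) (by fun_prop)
    (fun lam z x => oscPhase_mul lam w z x)
  have e : ∀ lam, lsOp p lam w (fun _ => 1) = fun z => ∫ x, oscPhase lam w x *
      (p x * ((1 / (Real.pi : ℂ)) * (z - x)⁻¹)) := by
    intro lam; ext z; rw [lsOp_eq_integral]; simp only [mul_one]
  simp_rw [e]
  refine ⟨key.1, ?_⟩
  rw [key.2]
  have hkm := measurable_annulusKernel hR
  have hrm := measurable_rieszKernel 1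
  have hqm := hq.measurable
  have hpm := hp.measurable
  have hm : Measurable fun t : ℂ × ℂ => ‖p t.2‖ₑ * (‖q t.1‖ₑ * (rieszKernel 1 (t.1 - t.2) *
      ‖annulusKernel R ((t.1 - w) ^ 2 + (t.2 - w) ^ 2)‖ₑ)) := by fun_prop
  calc _ ≤ ∫⁻ t : ℂ × ℂ, ‖p t.2‖ₑ * (‖q t.1‖ₑ * (rieszKernel 1 (t.1 - t.2) *
        ‖annulusKernel R ((t.1 - w) ^ 2 + (t.2 - w) ^ 2)‖ₑ)) ∂(volume.prod volume) := by
        refine (enorm_integral_le_lintegral_enorm _).trans (lintegral_mono fun t => ?_)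
        rw [enorm_mul, enorm_mul, enorm_mul]
        calc _ ≤ ‖q t.1‖ₑ * (‖p t.2‖ₑ * rieszKernel 1 (t.1 - t.2)) *
              ‖annulusKernel R ((t.1 - w) ^ 2 + (t.2 - w) ^ 2)‖ₑ := by
              gcongr; exact enorm_one_div_pi_mul_inv_le _
          _ = _ := by ring
    _ = ∫⁻ x, ‖p x‖ₑ * ∫⁻ z, ‖q z‖ₑ * (rieszKernel 1 (z - x) *
        ‖annulusKernel R ((z - w) ^ 2 + (x - w) ^ 2)‖ₑ) := by
        rw [lintegral_prod_symm _ hm.aemeasurable]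
        refine lintegral_congr fun x => ?_
        simp only
        rw [lintegral_const_mul' _ _ enorm_ne_top]
    _ ≤ ENNReal.ofReal A * ∫⁻ x in Metric.ball (0 : ℂ) ρ, ENNReal.ofReal A *
        ∫⁻ z in Metric.ball (0 : ℂ) ρ, (rieszKernel 1 (z - x) *
        ‖annulusKernel R ((z - w) ^ 2 + (x - w) ^ 2)‖ₑ) := by
        refine (hp.lintegral_mul_le _).trans ?_
        gcongr
        exact hq.lintegral_mul_le _
    _ ≤ _ := by
        rw [lintegral_const_mul' _ _ ENNReal.ofReal_ne_top]
        refine (mul_le_mul_right (mul_le_mul_right (hC hR w) _) _).trans (le_of_eq ?_)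
        push_cast
        simp only [ENNReal.ofReal]
        ring

end

/-! ### The remainder as a pairing of two small factors. -/

section

variable {ρ A : ℝ} {q p : ℂ → ℂ}

/-- Fubini transposes the Cauchy operator: the outer oscillation and the kernel merge into an
oscillatory potential, whose average square is already known to decay. -/
lemma oscInt_cauchyType_eq {A' : ℝ} {P : ℂ → ℂ} (hq : IsBddPotential ρ A q)
    (hP : IsBddPotential ρ A' P) {σ : ℂ → ℂ} (hσm : Measurable σ)
    (hσ : ∀ u, ‖σ u‖ₑ ≤ rieszKernel 1 u) (lam w : ℂ) {e : ℂ → ℂ} (hem : Measurable e)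
    (he : ∀ x, ‖e x‖ ≤ 1) :
    oscInt q lam w (fun z => ∫ x, e x * (P x * σ (z - x))) =
      ∫ x, e x * (P x * oscPot σ q lam w x) := by
  have hH := integrable_prod_cauchyType hq hP hσm hσ
  have hI : Integrable (fun t : ℂ × ℂ => (oscPhase lam w t.1 * e t.2) *
      (q t.1 * (P t.2 * σ (t.1 - t.2)))) (volume.prod volume) := by
    refine hH.bdd_mul (c := 1) (Measurable.aestronglyMeasurable (by fun_prop))
      (Eventually.of_forall fun t => ?_)
    rw [norm_mul, norm_oscPhase, one_mul]; exact he _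
  calc _ = ∫ z, ∫ x, (oscPhase lam w z * e x) * (q z * (P x * σ (z - x))) := by
        unfold oscInt
        refine integral_congr_ae (Eventually.of_forall fun z => ?_)
        simp only
        rw [← integral_const_mul, ← integral_const_mul]
        congr 1; ext x; ring
    _ = ∫ x, ∫ z, (oscPhase lam w z * e x) * (q z * (P x * σ (z - x))) :=
        integral_integral_swap hI
    _ = _ := by
        refine integral_congr_ae (Eventually.of_forall fun x => ?_)
        simp only [oscPot]
        rw [← integral_const_mul, ← integral_const_mul]
        congr 1; ext z; ring

/-- The Cauchy kernel `1 / (π u)`. -/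
def cauchyKernel (u : ℂ) : ℂ := (1 / (Real.pi : ℂ)) * u⁻¹

lemma IsBddPotential.mul (hq : IsBddPotential ρ A q) {g : ℂ → ℂ} (hg : Measurable g) {C : ℝ}
    (hC : ∀ z, ‖g z‖ ≤ C) : IsBddPotential ρ (A * C) (fun z => q z * g z) :=
  ⟨hq.measurable.mul hg, fun z => by
    rw [norm_mul]
    exact mul_le_mul (hq.norm_le z) (hC z) (norm_nonneg _) hq.nonneg,
    fun z hz => by rw [hq.eq_zero z hz, zero_mul]⟩

lemma enorm_integral_mul_oscPot_le (hp : IsBddPotential ρ A p) {e g O : ℂ → ℂ}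
    (he : ∀ x, ‖e x‖ ≤ 1) :
    ‖∫ x, e x * (p x * g x * O x)‖ₑ ≤
      ENNReal.ofReal A * ∫⁻ x in Metric.ball (0 : ℂ) ρ, ‖O x‖ₑ * ‖g x‖ₑ := by
  refine (enorm_integral_le_lintegral_enorm _).trans (le_trans (lintegral_mono fun x => ?_)
    (hp.lintegral_mul_le _))
  rw [enorm_mul, enorm_mul, enorm_mul]
  have : ‖e x‖ₑ ≤ 1 := by rw [← ofReal_norm]; exact ENNReal.ofReal_le_one.2 (he x)
  calc _ ≤ 1 * (‖p x‖ₑ * ‖g x‖ₑ * ‖O x‖ₑ) := by gcongr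
    _ = _ := by ring

lemma enorm_oscInt_lsOp_le (hq : IsBddPotential ρ A q) (hp : IsBddPotential ρ A p) (lam w : ℂ)
    {g : ℂ → ℂ} (hg : Measurable g) {C : ℝ} (hC : ∀ z, ‖g z‖ ≤ C) :
    ‖oscInt q lam w (lsOp p lam w g)‖ₑ ≤ ENNReal.ofReal A *
      ∫⁻ x in Metric.ball (0 : ℂ) ρ, ‖oscPot cauchyKernel q lam w x‖ₑ * ‖g x‖ₑ := by
  have e : lsOp p lam w g = fun z => ∫ x, oscPhase lam w x * (p x * g x * cauchyKernel (z - x)) :=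
    funext fun z => lsOp_eq_integral p lam w g z
  rw [e, oscInt_cauchyType_eq hq (hp.mul hg hC) (σ := cauchyKernel) measurable_one_div_pi_mul_inv
    enorm_one_div_pi_mul_inv_le lam w (e := oscPhase lam w)
    (by fun_prop) fun x => (norm_oscPhase _ _ _).le]
  exact enorm_integral_mul_oscPot_le hp fun x => (norm_oscPhase _ _ _).le

lemma enorm_oscInt_conj_lsOp_le (hq : IsBddPotential ρ A q) (hp : IsBddPotential ρ A p) (lam w : ℂ)
    {g : ℂ → ℂ} (hg : Measurable g) {C : ℝ} (hC : ∀ z, ‖g z‖ ≤ C) :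
    ‖oscInt q lam w (fun z => conj (lsOp p lam w g z))‖ₑ ≤ ENNReal.ofReal A *
      ∫⁻ x in Metric.ball (0 : ℂ) ρ,
        ‖oscPot (fun u => conj (cauchyKernel u)) q lam w x‖ₑ * ‖g x‖ₑ := by
  have hn : ∀ x, ‖conj (oscPhase lam w x)‖ ≤ 1 := fun x => by
    rw [RCLike.norm_conj]; exact (norm_oscPhase _ _ _).le
  simp_rw [conj_lsOp_eq_integral]
  have h1 := oscInt_cauchyType_eq hq (hp.conj.mul (measurable_conj_comp hg) (norm_conj_le hC))
    (measurable_conj_comp measurable_one_div_pi_mul_inv) enorm_conj_one_div_pi_mul_inv_le lam w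
    (e := fun x => conj (oscPhase lam w x)) (measurable_conj_comp (by fun_prop)) hn
  rw [h1]
  refine (enorm_integral_mul_oscPot_le hp.conj hn).trans (le_of_eq ?_)
  simp only [RCLike.enorm_conj]
  rfl

/-- Solutions of the scalar system for all large spectral parameters. -/
structure IsSolutionFamily (ρ A r : ℝ) (q p : ℂ → ℂ) (a b : ℂ × ℂ → ℂ → ℂ) : Prop where
  pos : 0 < r
  fst : IsBddPotential ρ A q
  snd : IsBddPotential ρ A p
  contractive : ∀ P : ℂ × ℂ, r < ‖P.1‖ → IsContractive ρ A q P.1 P.2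
  sol : ∀ P : ℂ × ℂ, r < ‖P.1‖ → IsScalarSolution q p P.1 P.2 (a P) (b P)

/-- Bounded functions depending measurably on the parameters outside a disc. -/
structure IsBddParam (r M : ℝ) (F : ℂ × ℂ → ℂ → ℂ) : Prop where
  measurable : Measurable fun t : (ℂ × ℂ) × ℂ =>
    {t : (ℂ × ℂ) × ℂ | r < ‖t.1.1‖}.indicator (fun t => F t.1 t.2) t
  norm_le : ∀ P : ℂ × ℂ, r < ‖P.1‖ → ∀ z, ‖F P z‖ ≤ M

namespace IsBddParam

variable {r M : ℝ} {F : ℂ × ℂ → ℂ → ℂ}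

lemma comp_conj (h : IsBddParam r M F) : IsBddParam r M fun P z => conj (F P z) := by
  refine ⟨?_, fun P hP => norm_conj_le (h.norm_le P hP)⟩
  convert measurable_conj_comp h.measurable using 1
  ext t
  by_cases ht : r < ‖t.1.1‖
  · rw [Set.indicator_of_mem (by exact ht), Set.indicator_of_mem (by exact ht)]
  · rw [Set.indicator_of_notMem (by exact ht), Set.indicator_of_notMem (by exact ht), map_zero]

lemma sub_const (h : IsBddParam r M F) (c : ℂ) : IsBddParam r (M + ‖c‖) fun P z => F P z - c := by
  refine ⟨?_, fun P hP z => (norm_sub_le _ _).trans (by gcongr; exact h.norm_le P hP z)⟩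
  convert h.measurable.sub ((measurable_const (a := c)).indicator (measurableSet_param r))
    using 1
  ext t
  by_cases ht : r < ‖t.1.1‖
  · simp only [Pi.sub_apply]
    rw [Set.indicator_of_mem (by exact ht), Set.indicator_of_mem (by exact ht),
      Set.indicator_of_mem (by exact ht)]
  · simp only [Pi.sub_apply]
    rw [Set.indicator_of_notMem (by exact ht), Set.indicator_of_notMem (by exact ht),
      Set.indicator_of_notMem (by exact ht), sub_zero]

lemma measurable_oscInt (h : IsBddParam r M F) (hq : IsBddPotential ρ A q) :
    Measurable fun P : ℂ × ℂ => {P : ℂ × ℂ | r < ‖P.1‖}.indicator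
      (fun P => oscInt q P.1 P.2 (F P)) P := by
  have hqm := hq.measurable
  have hS : MeasurableSet {P : ℂ × ℂ | r < ‖P.1‖} := measurableSet_lt measurable_const (by fun_prop)
  have h1 : Measurable fun P : ℂ × ℂ => ∫ z, oscPhase P.1 P.2 z *
      (q z * {t : (ℂ × ℂ) × ℂ | r < ‖t.1.1‖}.indicator (fun t => F t.1 t.2) (P, z)) := by
    refine StronglyMeasurable.measurable (StronglyMeasurable.integral_prod_right'
      (f := fun s : (ℂ × ℂ) × ℂ => oscPhase s.1.1 s.1.2 s.2 * (q s.2 *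
        {t : (ℂ × ℂ) × ℂ | r < ‖t.1.1‖}.indicator (fun t => F t.1 t.2) (s.1, s.2))) ?_)
    have hF := h.measurable
    refine Measurable.stronglyMeasurable ?_
    exact Measurable.mul (by fun_prop) ((hqm.comp measurable_snd).mul hF)
  convert h1.indicator hS using 1
  ext P
  by_cases hP : r < ‖P.1‖
  · rw [Set.indicator_of_mem (by exact hP), Set.indicator_of_mem (by exact hP), oscInt]
    congr 1; ext z
    rw [Set.indicator_of_mem (by exact hP)]
  · rw [Set.indicator_of_notMem (by exact hP), Set.indicator_of_notMem (by exact hP)]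

lemma exists_norm_oscInt_le (h : IsBddParam r M F) (hq : IsBddPotential ρ A q) :
    ∃ K : ℝ, ∀ P : ℂ × ℂ, r < ‖P.1‖ → ‖oscInt q P.1 P.2 (F P)‖ ≤ K := by
  refine ⟨∫ z, ‖q z‖ * M, fun P hP => ?_⟩
  refine norm_integral_le_of_norm_le (hq.integrable.norm.mul_const M)
    (Eventually.of_forall fun z => ?_)
  rw [norm_mul, norm_oscPhase, one_mul, norm_mul]
  gcongr
  exact h.norm_le P hP z

lemma integrableOn_annulus (h : IsBddParam r M F) (hq : IsBddPotential ρ A q) (hr : 0 < r) {R : ℝ}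
    (hR : r ≤ R) (w : ℂ) : IntegrableOn (fun lam => ((‖lam‖⁻¹ : ℝ) : ℂ) *
      oscInt q lam w (F (lam, w))) (annulus R) := by
  obtain ⟨K, hK⟩ := h.exists_norm_oscInt_le hq
  have hm := (h.measurable_oscInt hq).comp (measurable_id.prodMk (measurable_const (a := w)))
  have hi : IntegrableOn (fun lam => {P : ℂ × ℂ | r < ‖P.1‖}.indicator
      (fun P => oscInt q P.1 P.2 (F P)) (lam, w) * ((‖lam‖⁻¹ : ℝ) : ℂ)) (annulus R) := by
    refine (integrable_inv_norm_annulus (hr.trans_le hR)).bdd_mul (c := max K 0)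
      hm.aestronglyMeasurable
      (Eventually.of_forall fun lam => ?_)
    by_cases hl : r < ‖lam‖
    · rw [Set.indicator_of_mem (by exact hl)]
      exact (hK _ hl).trans (le_max_left _ _)
    · rw [Set.indicator_of_notMem (by exact hl), norm_zero]
      exact le_max_right _ _
  refine hi.congr_fun (fun lam hl => ?_) (measurableSet_annulus R)
  simp only
  rw [Set.indicator_of_mem (by exact hR.trans_lt hl.1), mul_comm]

end IsBddParam

namespace IsSolutionFamily

variable {r : ℝ} {a b : ℂ × ℂ → ℂ → ℂ}

lemma isBddParam_fst (h : IsSolutionFamily ρ A r q p a b) : IsBddParam r 2 a :=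
  ⟨measurable_fst_param h.fst h.snd h.contractive h.sol, fun P hP =>
    (h.sol P hP).norm_fst_le h.fst h.snd (h.contractive P hP)⟩

lemma exists_isBddParam_snd (h : IsSolutionFamily ρ A r q p a b) : ∃ M, IsBddParam r M b := by
  obtain ⟨C₀, -, hC₀⟩ := exists_norm_lsOp_le ρ
  refine ⟨A * 2 * C₀, measurable_snd_param h.fst h.snd h.contractive h.sol, fun P hP z => ?_⟩
  rw [(h.sol P hP).snd_eq]
  exact hC₀ h.snd _ _ (norm_conj_le (h.isBddParam_fst.norm_le P hP)) z

end IsSolutionFamily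

lemma measurable_lintegral_sq_oscPot (hq : IsBddPotential ρ A q) {σ : ℂ → ℂ} (hσm : Measurable σ)
    (w : ℂ) :
    Measurable fun lam => ∫⁻ y in Metric.ball (0 : ℂ) ρ, ‖oscPot σ q lam w y‖ₑ ^ 2 :=
  Measurable.lintegral_prod_right' (f := fun t : ℂ × ℂ => ‖oscPot σ q t.1 w t.2‖ₑ ^ 2)
    ((measurable_oscPot hq hσm w).enorm.pow_const 2)

lemma lsOp_one_eq_oscPot (p : ℂ → ℂ) (lam w z : ℂ) :
    lsOp p lam w (fun _ => 1) z = oscPot (fun u => cauchyKernel (-u)) p lam w z := by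
  rw [lsOp_eq_integral, oscPot]
  simp only [mul_one, cauchyKernel, neg_sub]

/-- Each factor of the pairing is small in mean square: the oscillatory potential directly, and `a -
1` or `b` through the first Neumann term, which is itself an oscillatory potential. -/
lemma exists_lintegral_annulus_le_of_pairing (ρ A : ℝ) : ∃ C : ℝ≥0, ∀ {q p : ℂ → ℂ} {r : ℝ}
    {a b : ℂ × ℂ → ℂ → ℂ}, IsSolutionFamily ρ A r q p a b → ∀ {u : ℂ → ℂ}, IsBddPotential ρ A u →
    ∀ {σ : ℂ → ℂ}, Measurable σ → (∀ x, ‖σ x‖ₑ ≤ rieszKernel 1 x) →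
    ∀ {g : ℂ → ℂ → ℂ} {X : ℂ → ℂ} {R : ℝ} {w : ℂ}, r ≤ R →
    (∀ lam ∈ annulus R, ‖X lam‖ₑ ≤ ENNReal.ofReal A *
      ∫⁻ x in Metric.ball (0 : ℂ) ρ, ‖oscPot σ u lam w x‖ₑ * ‖g lam x‖ₑ) →
    (∀ lam, (∀ x, ‖g lam x‖ₑ = ‖a (lam, w) x - 1‖ₑ) ∨ ∀ x, ‖g lam x‖ₑ = ‖b (lam, w) x‖ₑ) →
    ‖∫ lam in annulus R, ((‖lam‖⁻¹ : ℝ) : ℂ) * X lam‖ₑ ≤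
      C * ENNReal.ofReal R ^ (-(1 / 4) : ℝ) := by
  obtain ⟨C, hC⟩ := exists_lintegral_mul_solution_le ρ A
  obtain ⟨D, hD⟩ := exists_lintegral_annulus_sq_oscPot_le ρ A
  refine ⟨A.toNNReal * (C * (2 * D)), fun {q p r a b} h {u} hu {σ} hσm hσ {g X R w} hR hX hg => ?_⟩
  have hR0 := h.pos.trans_le hR
  have hκm : Measurable fun u => cauchyKernel (-u) :=
    measurable_one_div_pi_mul_inv.comp measurable_neg
  have pt : ∀ lam ∈ annulus R, ‖((‖lam‖⁻¹ : ℝ) : ℂ) * X lam‖ₑ ≤ ENNReal.ofReal A * (C *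
      (‖lam‖ₑ⁻¹ * (∫⁻ y in Metric.ball (0 : ℂ) ρ, ‖oscPot σ u lam w y‖ₑ ^ 2) +
       ‖lam‖ₑ⁻¹ * ∫⁻ y in Metric.ball (0 : ℂ) ρ,
          ‖oscPot (fun u => cauchyKernel (-u)) p lam w y‖ₑ ^ 2)) := by
    intro lam hl
    have hl0 : 0 < ‖lam‖ := hR0.trans hl.1
    have hlr : r < ‖(lam, w).1‖ := hR.trans_lt hl.1
    have hom : Measurable fun y => ‖oscPot σ u lam w y‖ₑ :=
      ((measurable_oscPot hu hσm w).comp measurable_prodMk_left).enorm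
    have h1 := hC h.fst h.snd (h.contractive (lam, w) hlr) (h.sol (lam, w) hlr) _ hom
    simp only [lsOp_one_eq_oscPot] at h1
    have h2 : ∫⁻ x in Metric.ball (0 : ℂ) ρ, ‖oscPot σ u lam w x‖ₑ * ‖g lam x‖ₑ ≤
        C * ((∫⁻ y in Metric.ball (0 : ℂ) ρ, ‖oscPot σ u lam w y‖ₑ ^ 2) +
          ∫⁻ y in Metric.ball (0 : ℂ) ρ,
            ‖oscPot (fun u => cauchyKernel (-u)) p lam w y‖ₑ ^ 2) := by
      rcases hg lam with h3 | h3 <;> simp only [h3]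
      exacts [h1.1, h1.2]
    have e1 : ‖((‖lam‖⁻¹ : ℝ) : ℂ)‖ₑ = ‖lam‖ₑ⁻¹ := by
      rw [← ofReal_norm, Complex.norm_real, norm_inv, norm_norm, ENNReal.ofReal_inv_of_pos hl0,
        ofReal_norm]
    rw [enorm_mul, e1]
    calc _ ≤ ‖lam‖ₑ⁻¹ * (ENNReal.ofReal A * (C *
          ((∫⁻ y in Metric.ball (0 : ℂ) ρ, ‖oscPot σ u lam w y‖ₑ ^ 2) +
          ∫⁻ y in Metric.ball (0 : ℂ) ρ,
            ‖oscPot (fun u => cauchyKernel (-u)) p lam w y‖ₑ ^ 2))) :=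
          mul_le_mul_right ((hX lam hl).trans (mul_le_mul_right h2 _)) _
      _ = _ := by ring
  have hmeas := measurable_lintegral_sq_oscPot hu hσm w
  calc _ ≤ ∫⁻ lam in annulus R, ENNReal.ofReal A * (C *
      (‖lam‖ₑ⁻¹ * (∫⁻ y in Metric.ball (0 : ℂ) ρ, ‖oscPot σ u lam w y‖ₑ ^ 2) +
       ‖lam‖ₑ⁻¹ * ∫⁻ y in Metric.ball (0 : ℂ) ρ,
          ‖oscPot (fun u => cauchyKernel (-u)) p lam w y‖ₑ ^ 2)) :=
        (enorm_integral_le_lintegral_enorm _).trans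
          (setLIntegral_mono' (measurableSet_annulus R) pt)
    _ ≤ ENNReal.ofReal A * (C * (D * ENNReal.ofReal R ^ (-(1 / 4) : ℝ) +
          D * ENNReal.ofReal R ^ (-(1 / 4) : ℝ))) := by
        rw [lintegral_const_mul' _ _ ENNReal.ofReal_ne_top,
          lintegral_const_mul' _ _ ENNReal.coe_ne_top, lintegral_add_left (by fun_prop)]
        refine mul_le_mul_right (mul_le_mul_right (add_le_add (hD hu hσm hσ hR0 w) ?_) _) _
        refine hD h.snd hκm (fun x => ?_) hR0 w
        rw [← rieszKernel_neg]
        exact enorm_one_div_pi_mul_inv_le _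
    _ = _ := by
        push_cast
        simp only [ENNReal.ofReal]
        ring

end

/-! ### Uniform decay for the two components and their conjugates. -/

section

variable {ρ A : ℝ} {q p : ℂ → ℂ}

lemma tendstoUniformly_zero_of_enorm_le {F : ℝ → ℂ → ℂ}
    (h : ∀ ε : ℝ, 0 < ε → ∀ᶠ R in atTop, ∀ w, ‖F R w‖ₑ ≤ ENNReal.ofReal ε) :
    TendstoUniformly F (fun _ => 0) atTop := by
  rw [Metric.tendstoUniformly_iff]
  intro ε hε
  filter_upwards [h (ε / 2) (by positivity)] with R hR w
  have := hR w
  rw [← ofReal_norm, ENNReal.ofReal_le_ofReal_iff (by positivity)] at this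
  rw [dist_zero_left]
  linarith

lemma eventually_mul_rpow_neg_le (C : ℝ≥0) {ε : ℝ} (hε : 0 < ε) : ∀ᶠ R : ℝ in atTop,
    C * ENNReal.ofReal R ^ (-(1 / 4) : ℝ) ≤ ENNReal.ofReal ε := by
  have hlim : Tendsto (fun R : ℝ => C * R ^ (-(1 / 4) : ℝ)) atTop (𝓝 0) := by
    simpa using (tendsto_rpow_neg_atTop (y := 1 / 4) (by norm_num)).const_mul (C : ℝ)
  filter_upwards [eventually_gt_atTop 0, hlim.eventually (gt_mem_nhds hε)] with R hR hRε
  rw [ENNReal.ofReal_rpow_of_pos hR, ← ENNReal.ofReal_coe_nnreal,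
    ← ENNReal.ofReal_mul (by positivity)]
  exact ENNReal.ofReal_le_ofReal hRε.le

lemma integrable_oscInt (hq : IsBddPotential ρ A q) (lam w : ℂ) {f : ℂ → ℂ} (hf : Measurable f)
    {C : ℝ} (hC : ∀ z, ‖f z‖ ≤ C) : Integrable fun z => oscPhase lam w z * (q z * f z) :=
  (hq.mul hf hC).integrable.bdd_mul (c := 1) (Measurable.aestronglyMeasurable (by fun_prop))
    (Eventually.of_forall fun z => (norm_oscPhase _ _ _).le)

lemma oscInt_sub (hq : IsBddPotential ρ A q) (lam w : ℂ) {f g : ℂ → ℂ} (hf : Measurable f)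
    (hg : Measurable g) {C C' : ℝ} (hC : ∀ z, ‖f z‖ ≤ C) (hC' : ∀ z, ‖g z‖ ≤ C') :
    oscInt q lam w (fun z => f z - g z) = oscInt q lam w f - oscInt q lam w g := by
  unfold oscInt
  rw [← integral_sub (integrable_oscInt hq lam w hf hC) (integrable_oscInt hq lam w hg hC')]
  congr 1; ext z; ring

lemma IsScalarSolution.snd_sub_lsOp_one {lam w : ℂ} {a b : ℂ → ℂ}
    (h : IsScalarSolution q p lam w a b) (hp : IsBddPotential ρ A p) (z : ℂ) :
    b z - lsOp p lam w (fun _ => 1) z = lsOp p lam w (fun x => conj (a x) - 1) z := by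
  obtain ⟨C, hC⟩ := h.bdd_fst
  rw [h.snd_eq, ← lsOp_sub hp lam w (measurable_conj_comp h.measurable_fst) measurable_const
    (norm_conj_le hC) (C' := 1) (fun _ => by simp)]

lemma IsScalarSolution.fst_sub_one {lam w : ℂ} {a b : ℂ → ℂ}
    (h : IsScalarSolution q p lam w a b) (z : ℂ) :
    a z - 1 = lsOp q lam w (fun x => conj (b x)) z := by
  rw [h.fst_eq, add_sub_cancel_left]

lemma conj_sub_one_enorm (z : ℂ) : ‖conj z - 1‖ₑ = ‖z - 1‖ₑ := by
  rw [← RCLike.enorm_conj (z - 1), map_sub, map_one]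

lemma measurable_conj_cauchyKernel : Measurable fun u => conj (cauchyKernel u) :=
  measurable_conj_comp measurable_one_div_pi_mul_inv

lemma exists_norm_lsOp_one_le (hp : IsBddPotential ρ A p) (lam w : ℂ) :
    ∃ C : ℝ, ∀ z, ‖lsOp p lam w (fun _ => 1) z‖ ≤ C := by
  obtain ⟨C₀, -, hC₀⟩ := exists_norm_lsOp_le ρ
  exact ⟨_, fun z => hC₀ hp lam w (C := 1) (fun _ => by simp) z⟩

lemma enorm_integral_annulus_le_add {R : ℝ} {F G : ℂ → ℂ} {K L : ℝ≥0∞}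
    (hF : IntegrableOn (fun lam => ((‖lam‖⁻¹ : ℝ) : ℂ) * F lam) (annulus R))
    (hG : IntegrableOn (fun lam => ((‖lam‖⁻¹ : ℝ) : ℂ) * G lam) (annulus R))
    (h1 : ‖∫ lam in annulus R, ((‖lam‖⁻¹ : ℝ) : ℂ) * G lam‖ₑ ≤ K)
    (h2 : ‖∫ lam in annulus R, ((‖lam‖⁻¹ : ℝ) : ℂ) * (F lam - G lam)‖ₑ ≤ L) :
    ‖∫ lam in annulus R, ((‖lam‖⁻¹ : ℝ) : ℂ) * F lam‖ₑ ≤ K + L := by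
  have e : ∫ lam in annulus R, ((‖lam‖⁻¹ : ℝ) : ℂ) * F lam =
      (∫ lam in annulus R, ((‖lam‖⁻¹ : ℝ) : ℂ) * G lam) +
      ∫ lam in annulus R, ((‖lam‖⁻¹ : ℝ) : ℂ) * (F lam - G lam) := by
    simp_rw [mul_sub]
    rw [integral_sub hF hG]; ring
  rw [e]
  exact (enorm_add_le _ _).trans (add_le_add h1 h2)

namespace IsSolutionFamily

variable {r : ℝ} {a b : ℂ × ℂ → ℂ → ℂ}

/-- The first-order part `L_p 1` of `b` is handled by adding phases; what is left, `L_p (conj a -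
1)`, is a pairing. -/
lemma tendstoUniformly_snd (h : IsSolutionFamily ρ A r q p a b) :
    TendstoUniformly (fun (R : ℝ) w => ∫ lam in annulus R, ((‖lam‖⁻¹ : ℝ) : ℂ) *
      oscInt q lam w (b (lam, w))) (fun _ => 0) atTop := by
  refine tendstoUniformly_zero_of_enorm_le fun ε hε => ?_
  obtain ⟨C, hC⟩ := exists_lintegral_annulus_le_of_pairing ρ A
  obtain ⟨D, hD⟩ := exists_annulus_oscInt_lsOp_one_le h.fst h.snd
  obtain ⟨M, hM⟩ := h.exists_isBddParam_snd
  filter_upwards [eventually_ge_atTop r, eventually_mul_rpow_neg_le C (half_pos hε),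
    eventually_mul_rpow_neg_le D (half_pos hε)] with R hR h1 h2 w
  have hR0 := h.pos.trans_le hR
  rw [← add_halves ε, ENNReal.ofReal_add (by positivity) (by positivity)]
  refine enorm_integral_annulus_le_add (hM.integrableOn_annulus h.fst h.pos hR w) (hD hR0 w).1
    ((hD hR0 w).2.trans h2) (le_trans (hC h h.fst measurable_one_div_pi_mul_inv
      enorm_one_div_pi_mul_inv_le hR (g := fun lam x => conj (a (lam, w) x) - 1)
      (fun lam hl => ?_) (fun lam => Or.inl fun x => conj_sub_one_enorm _)) h1)
  have hl := hR.trans_lt hl.1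
  have hs := h.sol (lam, w) hl
  obtain ⟨K, hK⟩ := exists_norm_lsOp_one_le h.snd lam w
  rw [← oscInt_sub h.fst lam w hs.measurable_snd (measurable_lsOp h.snd lam w measurable_const
    (C := 1) fun _ => by simp) (hM.norm_le _ hl) hK]
  simp_rw [hs.snd_sub_lsOp_one h.snd]
  exact enorm_oscInt_lsOp_le h.fst h.snd lam w
    ((measurable_conj_comp hs.measurable_fst).sub_const 1)
    ((h.isBddParam_fst.comp_conj.sub_const 1).norm_le (lam, w) hl)

/-- The same splitting, conjugated. This is the only case that uses the cancellation in
`skewKernel`. -/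
lemma tendstoUniformly_conj_snd (h : IsSolutionFamily ρ A r q p a b) :
    TendstoUniformly (fun (R : ℝ) w => ∫ lam in annulus R, ((‖lam‖⁻¹ : ℝ) : ℂ) *
      oscInt q lam w (fun z => conj (b (lam, w) z))) (fun _ => 0) atTop := by
  refine tendstoUniformly_zero_of_enorm_le fun ε hε => ?_
  obtain ⟨C, hC⟩ := exists_lintegral_annulus_le_of_pairing ρ A
  obtain ⟨M, hM⟩ := h.exists_isBddParam_snd
  filter_upwards [eventually_ge_atTop r, eventually_mul_rpow_neg_le C (half_pos hε),
    eventually_annulus_oscInt_conj_lsOp_one_le h.fst h.snd (half_pos hε)] with R hR h1 h2 w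
  have hR0 := h.pos.trans_le hR
  rw [← add_halves ε, ENNReal.ofReal_add (by positivity) (by positivity)]
  refine enorm_integral_annulus_le_add (hM.comp_conj.integrableOn_annulus h.fst h.pos hR w)
    (h2 w).1 (h2 w).2 (le_trans (hC h h.fst measurable_conj_cauchyKernel
      enorm_conj_one_div_pi_mul_inv_le hR (g := fun lam x => conj (a (lam, w) x) - 1)
      (fun lam hl => ?_) (fun lam => Or.inl fun x => conj_sub_one_enorm _)) h1)
  have hl := hR.trans_lt hl.1
  have hs := h.sol (lam, w) hl
  obtain ⟨K, hK⟩ := exists_norm_lsOp_one_le h.snd lam w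
  rw [← oscInt_sub h.fst lam w (measurable_conj_comp hs.measurable_snd)
    (measurable_conj_comp (measurable_lsOp h.snd lam w measurable_const
    (C := 1) fun _ => by simp)) (hM.comp_conj.norm_le _ hl) (norm_conj_le hK)]
  simp_rw [← map_sub, hs.snd_sub_lsOp_one h.snd]
  exact enorm_oscInt_conj_lsOp_le h.fst h.snd lam w
    ((measurable_conj_comp hs.measurable_fst).sub_const 1)
    ((h.isBddParam_fst.comp_conj.sub_const 1).norm_le (lam, w) hl)

/-- Since `a - 1 = L_q (conj b)`, this is a pairing already; there is no first-order term to split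
off. -/
lemma tendstoUniformly_fst_sub_one (h : IsSolutionFamily ρ A r q p a b) :
    TendstoUniformly (fun (R : ℝ) w => ∫ lam in annulus R, ((‖lam‖⁻¹ : ℝ) : ℂ) *
      oscInt p lam w (fun z => a (lam, w) z - 1)) (fun _ => 0) atTop := by
  refine tendstoUniformly_zero_of_enorm_le fun ε hε => ?_
  obtain ⟨C, hC⟩ := exists_lintegral_annulus_le_of_pairing ρ A
  obtain ⟨M, hM⟩ := h.exists_isBddParam_snd
  filter_upwards [eventually_ge_atTop r, eventually_mul_rpow_neg_le C hε] with R hR h1 w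
  refine le_trans (hC h h.snd measurable_one_div_pi_mul_inv
      enorm_one_div_pi_mul_inv_le hR (g := fun lam x => conj (b (lam, w) x))
      (fun lam hl => ?_) (fun lam => Or.inr fun x => RCLike.enorm_conj _)) h1
  have hl := hR.trans_lt hl.1
  have hs := h.sol (lam, w) hl
  simp_rw [hs.fst_sub_one]
  exact enorm_oscInt_lsOp_le h.snd h.fst lam w (measurable_conj_comp hs.measurable_snd)
    (hM.comp_conj.norm_le (lam, w) hl)

lemma tendstoUniformly_conj_fst_sub_one (h : IsSolutionFamily ρ A r q p a b) :
    TendstoUniformly (fun (R : ℝ) w => ∫ lam in annulus R, ((‖lam‖⁻¹ : ℝ) : ℂ) *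
      oscInt p lam w (fun z => conj (a (lam, w) z) - 1)) (fun _ => 0) atTop := by
  refine tendstoUniformly_zero_of_enorm_le fun ε hε => ?_
  obtain ⟨C, hC⟩ := exists_lintegral_annulus_le_of_pairing ρ A
  obtain ⟨M, hM⟩ := h.exists_isBddParam_snd
  filter_upwards [eventually_ge_atTop r, eventually_mul_rpow_neg_le C hε] with R hR h1 w
  refine le_trans (hC h h.snd measurable_conj_cauchyKernel
      enorm_conj_one_div_pi_mul_inv_le hR (g := fun lam x => conj (b (lam, w) x))
      (fun lam hl => ?_) (fun lam => Or.inr fun x => RCLike.enorm_conj _)) h1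
  have hl := hR.trans_lt hl.1
  have hs := h.sol (lam, w) hl
  have e : ∀ z, conj (a (lam, w) z) - 1 = conj (lsOp q lam w (fun x => conj (b (lam, w) x)) z) := by
    intro z; rw [← hs.fst_sub_one, map_sub, map_one]
  simp_rw [e]
  exact enorm_oscInt_conj_lsOp_le h.snd h.fst lam w (measurable_conj_comp hs.measurable_snd)
    (hM.comp_conj.norm_le (lam, w) hl)

end IsSolutionFamily

end

/-! ### The main term and recovery of the potential. -/

section

variable {ρ A : ℝ} {q p : ℂ → ℂ}

lemma norm_annulusKernel_le {R : ℝ} (hR : 0 < R) (ζ : ℂ) : ‖annulusKernel R ζ‖ ≤ R * (2 * Real.pi) := by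
  rw [annulusKernel_scale hR, norm_mul, Complex.norm_real, Real.norm_of_nonneg hR.le]
  gcongr
  exact norm_annulusKernel_one_le _

lemma integral_annulus_oscInt_const (hq : IsBddPotential ρ A q) (δ : ℂ) {R : ℝ} (hR : 0 < R) (w : ℂ) :
    ∫ lam in annulus R, ((‖lam‖⁻¹ : ℝ) : ℂ) * oscInt q lam w (fun _ => δ) =
      ∫ z, q z * δ * annulusKernel R ((z - w) ^ 2) :=
  integral_annulus_cexp_mul hR (hq.integrable.mul_const δ) (ζ := fun z => (z - w) ^ 2) (by fun_prop)

/-- Fubini moves the average onto `g`, where it acts as the approximate identity; the bounded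
potential dominates in `z` and needs no regularity. -/
lemma tendsto_integral_mul_oscInt_const (hq : IsBddPotential ρ A q) (δ : ℂ) {g : ℂ → ℂ}
    (hg : Continuous g) (hgc : HasCompactSupport g) :
    Tendsto (fun R : ℝ => ∫ w, g w * ∫ lam in annulus R, ((‖lam‖⁻¹ : ℝ) : ℂ) *
      oscInt q lam w (fun _ => δ)) atTop
      (𝓝 (((4 * Real.pi ^ 2 * Real.log 2 : ℝ) : ℂ) * ∫ z, g z * (q z * δ))) := by
  obtain ⟨B, hB⟩ := hgc.exists_bound_of_continuous hg
  have hqi := hq.integrable.mul_const δ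
  have hgi : Integrable g := hg.integrable_of_hasCompactSupport hgc
  have e : ∀ R : ℝ, 0 < R → ∫ w, g w * ∫ lam in annulus R, ((‖lam‖⁻¹ : ℝ) : ℂ) *
      oscInt q lam w (fun _ => δ) =
      ∫ z, q z * δ * ∫ w, g w * annulusKernel R ((z - w) ^ 2) := by
    intro R hR
    simp_rw [integral_annulus_oscInt_const hq δ hR, ← integral_const_mul]
    rw [integral_integral_swap]
    · refine integral_congr_ae (Eventually.of_forall fun z => ?_)
      simp only
      congr 1; ext w; ring
    · have hkm := measurable_annulusKernel hR
      refine ((hgi.mul_prod hqi).bdd_mul (c := R * (2 * Real.pi))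
        (f := fun t : ℂ × ℂ => annulusKernel R ((t.2 - t.1) ^ 2))
        (Measurable.aestronglyMeasurable (by fun_prop))
        (Eventually.of_forall fun t => norm_annulusKernel_le hR _)).congr
        (Eventually.of_forall fun t => ?_)
      simp only [Function.uncurry]
      ring
  rw [← integral_const_mul]
  have hlim : Tendsto (fun R : ℝ => ∫ z, q z * δ * ∫ w, g w * annulusKernel R ((z - w) ^ 2)) atTop
      (𝓝 (∫ z, ((4 * Real.pi ^ 2 * Real.log 2 : ℝ) : ℂ) * (g z * (q z * δ)))) := by
    refine tendsto_integral_filter_of_dominated_convergence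
      (fun z => ‖q z * δ‖ * (B * ∫ v, ‖annulusKernel 1 (v ^ 2)‖)) ?_ ?_
      (hqi.norm.mul_const _) ?_
    · filter_upwards [eventually_gt_atTop 0] with R hR
      have hkm := measurable_annulusKernel hR
      have hgm := hg.measurable
      refine hqi.aestronglyMeasurable.mul (StronglyMeasurable.integral_prod_right'
        (f := fun t : ℂ × ℂ => g t.2 * annulusKernel R ((t.1 - t.2) ^ 2)) ?_).aestronglyMeasurable
      exact Measurable.stronglyMeasurable (by fun_prop)
    · filter_upwards [eventually_gt_atTop 0] with R hR
      refine Eventually.of_forall fun z => ?_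
      rw [norm_mul]
      gcongr
      exact norm_integral_mul_annulusKernel_sq_le hR hB z
    · refine Eventually.of_forall fun z => ?_
      convert (tendsto_integral_mul_annulusKernel_sq hg hB z).const_mul (q z * δ) using 2
      ring
  refine hlim.congr' ?_
  filter_upwards [eventually_gt_atTop 0] with R hR
  exact (e R hR).symm

lemma isBddParam_const (r : ℝ) (δ : ℂ) : IsBddParam r ‖δ‖ fun _ _ => δ :=
  ⟨measurable_const.indicator (measurableSet_param r), fun _ _ _ => le_rfl⟩

namespace IsBddParam

variable {r M : ℝ} {F : ℂ × ℂ → ℂ → ℂ}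

lemma integrable_prod (h : IsBddParam r M F) (hq : IsBddPotential ρ A q) (hr : 0 < r) {R : ℝ}
    (hR : r ≤ R) {g : ℂ → ℂ} (hg : Integrable g) :
    Integrable (fun t : ℂ × ℂ => ((‖t.1‖⁻¹ : ℝ) : ℂ) * (g t.2 * oscInt q t.1 t.2 (F t)))
      ((volume.restrict (annulus R)).prod volume) := by
  obtain ⟨K, hK⟩ := h.exists_norm_oscInt_le hq
  have hi := ((integrable_inv_norm_annulus (hr.trans_le hR)).mul_prod hg).bdd_mul (c := max K 0)
    (h.measurable_oscInt hq).aestronglyMeasurable (Eventually.of_forall fun P => by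
      by_cases hl : r < ‖P.1‖
      · rw [Set.indicator_of_mem (by exact hl)]
        exact (hK _ hl).trans (le_max_left _ _)
      · rw [Set.indicator_of_notMem (by exact hl), norm_zero]
        exact le_max_right _ _)
  refine hi.congr ?_
  have hae : ∀ᵐ t ∂((volume.restrict (annulus R)).prod (volume : Measure ℂ)), t.1 ∈ annulus R :=
    Measure.quasiMeasurePreserving_fst.ae (ae_restrict_mem (measurableSet_annulus R))
  refine hae.mono fun t ht => ?_
  simp only
  rw [Set.indicator_of_mem (by exact hR.trans_lt ht.1)]
  ring

lemma integrableOn_integral (h : IsBddParam r M F) (hq : IsBddPotential ρ A q) (hr : 0 < r) {R : ℝ}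
    (hR : r ≤ R) {g : ℂ → ℂ} (hg : Integrable g) :
    IntegrableOn (fun lam => ((‖lam‖⁻¹ : ℝ) : ℂ) * ∫ w, g w * oscInt q lam w (F (lam, w)))
      (annulus R) := by
  simp_rw [← integral_const_mul]
  exact (h.integrable_prod hq hr hR hg).integral_prod_left

lemma integral_swap (h : IsBddParam r M F) (hq : IsBddPotential ρ A q) (hr : 0 < r) {R : ℝ}
    (hR : r ≤ R) {g : ℂ → ℂ} (hg : Integrable g) :
    ∫ lam in annulus R, ((‖lam‖⁻¹ : ℝ) : ℂ) * ∫ w, g w * oscInt q lam w (F (lam, w)) =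
      ∫ w, g w * ∫ lam in annulus R, ((‖lam‖⁻¹ : ℝ) : ℂ) * oscInt q lam w (F (lam, w)) := by
  simp_rw [← integral_const_mul]
  rw [integral_integral_swap (h.integrable_prod hq hr hR hg)]
  refine integral_congr_ae (Eventually.of_forall fun w => ?_)
  simp only
  congr 1; ext lam; ring

lemma integrable_mul_integral (h : IsBddParam r M F) (hq : IsBddPotential ρ A q) (hr : 0 < r) {R : ℝ}
    (hR : r ≤ R) {g : ℂ → ℂ} (hg : Integrable g) :
    Integrable fun w => g w * ∫ lam in annulus R, ((‖lam‖⁻¹ : ℝ) : ℂ) *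
      oscInt q lam w (F (lam, w)) := by
  refine (h.integrable_prod hq hr hR hg).integral_prod_right.congr
    (Eventually.of_forall fun w => ?_)
  simp only
  rw [← integral_const_mul]
  congr 1; ext lam; ring

/-- Averaging the scattering data over large annuli recovers the potential. -/
lemma tendsto_integral_oscInt (h : IsBddParam r M F) (hq : IsBddPotential ρ A q) (hr : 0 < r)
    {g : ℂ → ℂ} (hg : Continuous g) (hgc : HasCompactSupport g) {δ : ℂ}
    (hm : ∀ P : ℂ × ℂ, r < ‖P.1‖ → Measurable (F P))
    (hu : TendstoUniformly (fun (R : ℝ) w => ∫ lam in annulus R, ((‖lam‖⁻¹ : ℝ) : ℂ) *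
      oscInt q lam w (fun z => F (lam, w) z - δ)) (fun _ => 0) atTop) :
    Tendsto (fun R : ℝ => ∫ lam in annulus R, ((‖lam‖⁻¹ : ℝ) : ℂ) *
      ∫ w, g w * oscInt q lam w (F (lam, w))) atTop
      (𝓝 (((4 * Real.pi ^ 2 * Real.log 2 : ℝ) : ℂ) * ∫ z, g z * (q z * δ))) := by
  have hgi : Integrable g := hg.integrable_of_hasCompactSupport hgc
  have hδ := isBddParam_const r δ
  -- The remainder tends to zero uniformly in `w`, hence also after integration against the
  -- integrable `g`.
  have h0 : Tendsto (fun R : ℝ => ∫ w, g w * ∫ lam in annulus R, ((‖lam‖⁻¹ : ℝ) : ℂ) *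
      oscInt q lam w (fun z => F (lam, w) z - δ)) atTop (𝓝 0) := by
    rw [Metric.tendsto_atTop']
    intro ε hε
    have hI : 0 ≤ ∫ w, ‖g w‖ := integral_nonneg fun _ => norm_nonneg _
    have hη : 0 < ε / ((∫ w, ‖g w‖) + 1) := by positivity
    rw [Metric.tendstoUniformly_iff] at hu
    obtain ⟨N, hN⟩ := eventually_atTop.1 (hu _ hη)
    refine ⟨N, fun R hR => ?_⟩
    rw [dist_zero_right]
    calc _ ≤ ∫ w, ‖g w‖ * (ε / ((∫ w, ‖g w‖) + 1)) := by
          refine norm_integral_le_of_norm_le (hgi.norm.mul_const _)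
            (Eventually.of_forall fun w => ?_)
          rw [norm_mul]
          gcongr
          have := hN R hR.le w
          rw [dist_zero_left] at this
          exact this.le
      _ < ε := by
          rw [integral_mul_const, mul_div_assoc', div_lt_iff₀ (by positivity)]
          nlinarith
  have h1 := (tendsto_integral_mul_oscInt_const hq δ hg hgc).add h0
  rw [add_zero] at h1
  refine h1.congr' ?_
  filter_upwards [eventually_ge_atTop r] with R hR
  rw [h.integral_swap hq hr hR hgi, ← integral_add (hδ.integrable_mul_integral hq hr hR hgi)
    ((h.sub_const δ).integrable_mul_integral hq hr hR hgi)]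
  refine integral_congr_ae (Eventually.of_forall fun w => ?_)
  simp only
  rw [← mul_add, ← integral_add (hδ.integrableOn_annulus hq hr hR w)
    ((h.sub_const δ).integrableOn_annulus hq hr hR w)]
  congr 1
  refine setIntegral_congr_fun (measurableSet_annulus R) fun lam hl => ?_
  have hl := hR.trans_lt hl.1
  rw [oscInt_sub hq lam w (hm (lam, w) hl) measurable_const (h.norm_le (lam, w) hl)
    (fun _ => le_rfl)]
  ring

end IsBddParam

end

/-! ### From matrices to scalar systems; the index `i + 1` in `Fin 2` is the other index. -/

/-- The nonzero entry in a row of the off-diagonal potential. -/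
def rowPotential (Q₁₂ Q₂₁ : ℂ → ℂ) (i : Fin 2) : ℂ → ℂ := if i = 0 then Q₁₂ else Q₂₁

lemma diracPotential_mul_apply (Q₁₂ Q₂₁ : ℂ → ℂ) (z : ℂ) (G : Mat2) (i j : Fin 2) :
    (diracPotential Q₁₂ Q₂₁ z * G) i j = rowPotential Q₁₂ Q₂₁ i z * G (i + 1) j := by
  rw [Matrix.mul_apply, Fin.sum_univ_two]
  fin_cases i <;> simp [diracPotential, rowPotential]

lemma diracPotential_apply (Q₁₂ Q₂₁ : ℂ → ℂ) (z : ℂ) (i j : Fin 2) :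
    diracPotential Q₁₂ Q₂₁ z i j = rowPotential Q₁₂ Q₂₁ i z * (1 : Mat2) (i + 1) j := by
  rw [← diracPotential_mul_apply, mul_one]

lemma IsBddPotential.mono {ρ A A' : ℝ} {q : ℂ → ℂ} (hq : IsBddPotential ρ A q) (h : A ≤ A') :
    IsBddPotential ρ A' q :=
  ⟨hq.measurable, fun z => (hq.norm_le z).trans h, hq.eq_zero⟩

/-- The potential enters only through integrals, so it may be replaced by a measurable
representative that is bounded, and zero off the ball, at every point. -/
lemma exists_isBddPotential_ae_eq {ρ : ℝ} {q : ℂ → ℂ} (hq : MemLp q ⊤ volume)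
    (h0 : ∀ z, z ∉ Metric.ball (0 : ℂ) ρ → q z = 0) : ∃ A u, IsBddPotential ρ A u ∧ u =ᵐ[volume] q := by
  set v := hq.1.mk q
  have hvm : Measurable v := hq.1.stronglyMeasurable_mk.measurable
  set A := (eLpNormEssSup q volume).toReal
  have hA : ∀ᵐ z, ‖q z‖ ≤ A := by
    have hfin : eLpNormEssSup q volume ≠ ⊤ := by
      have := hq.2.ne
      rwa [eLpNorm_exponent_top] at this
    filter_upwards [enorm_ae_le_eLpNormEssSup q volume] with z hz
    rw [← ofReal_norm] at hz
    exact (ENNReal.ofReal_le_iff_le_toReal hfin).1 hz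
  set S : Set ℂ := Metric.ball 0 ρ ∩ {z | ‖v z‖ ≤ A}
  have hS : MeasurableSet S := measurableSet_ball.inter (measurableSet_le hvm.norm measurable_const)
  refine ⟨A, S.indicator v, ⟨hvm.indicator hS, fun z => ?_, fun z hz => ?_⟩, ?_⟩
  · by_cases hz : z ∈ S
    · rw [Set.indicator_of_mem hz]; exact hz.2
    · rw [Set.indicator_of_notMem hz, norm_zero]; exact ENNReal.toReal_nonneg
  · exact Set.indicator_of_notMem (fun h => hz h.1) _
  · filter_upwards [hA, hq.1.ae_eq_mk] with z h1 h2
    replace h2 : q z = v z := h2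
    by_cases hz : z ∈ Metric.ball (0 : ℂ) ρ
    · rw [Set.indicator_of_mem, ← h2]
      refine ⟨hz, ?_⟩
      change ‖v z‖ ≤ A
      rw [← h2]; exact h1
    · rw [Set.indicator_of_notMem (fun h => hz h.1), h0 z hz]

section Matrix

variable {Q₁₂ Q₂₁ : ℂ → ℂ} {u : Fin 2 → ℂ → ℂ} {ρ A : ℝ} {O : Set ℂ}

lemma one_div_pi_mul_integral_eq_lsOp (hu : ∀ i, u i =ᵐ[volume] rowPotential Q₁₂ Q₂₁ i) (lam w z : ℂ)
    (ν : ℂ → Mat2) (i j : Fin 2) :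
    (1 / (Real.pi : ℂ)) * ∫ z' : ℂ, oscPhase lam w z' / (z - z') *
      (diracPotential Q₁₂ Q₂₁ z' * conjMat (ν z')) i j =
    lsOp (u i) lam w (fun x => conj (ν x (i + 1) j)) z := by
  rw [lsOp]
  congr 1
  refine integral_congr_ae ?_
  filter_upwards [hu i] with x hx
  rw [diracPotential_mul_apply, hx]
  rfl

lemma fin_two_add_one_add_one (j : Fin 2) : j + 1 + 1 = j := by fin_cases j <;> rfl

lemma fin_two_add_one_ne (j : Fin 2) : j + 1 ≠ j := by fin_cases j <;> decide

lemma fin_two_eq_or (i j : Fin 2) : i = j ∨ i = j + 1 := by revert i j; decide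

/-- The columns decouple: in column `j` the diagonal entry is driven by row `j` of the potential and
the off-diagonal entry by row `j + 1`. -/
lemma IsLippmannSchwingerSolution.isScalarSolution
    (hu : ∀ i, u i =ᵐ[volume] rowPotential Q₁₂ Q₂₁ i) {lam w : ℂ} {ν : ℂ → Mat2}
    (h : IsLippmannSchwingerSolution (diracPotential Q₁₂ Q₂₁) lam w ν) (j : Fin 2) :
    IsScalarSolution (u j) (u (j + 1)) lam w (fun z => ν z j j) (fun z => ν z (j + 1) j) := by
  obtain ⟨C, hC⟩ := h.bounded
  have he := h.equation
  simp_rw [one_div_pi_mul_integral_eq_lsOp hu] at he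
  refine ⟨h.measurable _ _, h.measurable _ _, ⟨C, fun z => hC z _ _⟩, ⟨C, fun z => hC z _ _⟩,
    fun z => ?_, fun z => ?_⟩
  · have := he z j j
    rwa [Matrix.one_apply_eq] at this
  · have := he z (j + 1) j
    rwa [Matrix.one_apply_ne (fin_two_add_one_ne j), zero_add, fin_two_add_one_add_one] at this

/-- The condition at infinity is automatic, because `lsOp` of a bounded function vanishes there. -/
lemma isLippmannSchwingerSolution_of_scalar (hb : ∀ i, IsBddPotential ρ A (u i))
    (hu : ∀ i, u i =ᵐ[volume] rowPotential Q₁₂ Q₂₁ i) {lam w : ℂ} {ν : ℂ → Mat2}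
    (h : ∀ j, IsScalarSolution (u j) (u (j + 1)) lam w (fun z => ν z j j)
      (fun z => ν z (j + 1) j)) :
    IsLippmannSchwingerSolution (diracPotential Q₁₂ Q₂₁) lam w ν := by
  have hm : ∀ i j, Measurable fun z => ν z i j := by
    intro i j
    rcases fin_two_eq_or i j with rfl | rfl
    · exact (h i).measurable_fst
    · exact (h j).measurable_snd
  have hC : ∀ i j, ∃ C : ℝ, ∀ z, ‖ν z i j‖ ≤ C := by
    intro i j
    rcases fin_two_eq_or i j with rfl | rfl
    · exact (h i).bdd_fst
    · exact (h j).bdd_snd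
  have he : ∀ z i j, ν z i j = (1 : Mat2) i j +
      lsOp (u i) lam w (fun x => conj (ν x (i + 1) j)) z := by
    intro z i j
    rcases fin_two_eq_or i j with rfl | rfl
    · rw [Matrix.one_apply_eq]; exact (h i).fst_eq z
    · rw [Matrix.one_apply_ne (fin_two_add_one_ne j), zero_add, fin_two_add_one_add_one]
      exact (h j).snd_eq z
  choose C hC using hC
  refine ⟨hm, ⟨∑ i, ∑ j, |C i j|, fun z i j => ?_⟩, fun z i j => ?_, fun i j => ?_⟩
  · refine (hC i j z).trans ((le_abs_self _).trans ?_)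
    refine (Finset.single_le_sum (f := fun j => |C i j|) (fun j _ => abs_nonneg _)
      (Finset.mem_univ j)).trans ?_
    exact Finset.single_le_sum (f := fun i => ∑ j, |C i j|)
      (fun i _ => Finset.sum_nonneg fun j _ => abs_nonneg _) (Finset.mem_univ i)
  · rw [one_div_pi_mul_integral_eq_lsOp hu]; exact he z i j
  · simp_rw [fun z => he z i j]
    simpa using (tendsto_lsOp_cocompact (hb i) lam w (norm_conj_le (hC (i + 1) j))).const_add
      ((1 : Mat2) i j)

lemma existsUnique_isLippmannSchwingerSolution (hb : ∀ i, IsBddPotential ρ A (u i))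
    (hu : ∀ i, u i =ᵐ[volume] rowPotential Q₁₂ Q₂₁ i) {lam w : ℂ}
    (hc : ∀ i, IsContractive ρ A (u i) lam w) :
    ∃! ν : ℂ → Mat2, IsLippmannSchwingerSolution (diracPotential Q₁₂ Q₂₁) lam w ν := by
  choose a b hab using fun j => exists_isScalarSolution (hb j) (hb (j + 1)) (hc j)
  refine ⟨fun z => Matrix.of fun i j => if i = j then a j z else b j z,
    isLippmannSchwingerSolution_of_scalar hb hu fun j => ?_, fun ν hν => ?_⟩
  · simp only [Matrix.of_apply, if_true, if_neg (fin_two_add_one_ne j)]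
    exact hab j
  · ext z i j
    rw [Matrix.of_apply]
    have key := (hν.isScalarSolution hu j).unique (hab j) (hb j) (hb (j + 1)) (hc j)
    rcases fin_two_eq_or i j with rfl | rfl
    · rw [if_pos rfl]; exact congrFun key.1 z
    · rw [if_neg (fin_two_add_one_ne j)]; exact congrFun key.2 z

lemma scatteringOp_apply (hu : ∀ i, u i =ᵐ[volume] rowPotential Q₁₂ Q₂₁ i)
    (hO : ∀ i z, z ∉ O → rowPotential Q₁₂ Q₂₁ i z = 0) (lam w : ℂ) (G : ℂ → Mat2) (i j : Fin 2) :
    scatteringOp O (diracPotential Q₁₂ Q₂₁) lam w G i j =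
      oscInt (u i) lam w (fun z => G z (i + 1) j) := by
  rw [scatteringOp, Matrix.of_apply, setIntegral_eq_integral_of_forall_compl_eq_zero, oscInt]
  · refine integral_congr_ae ?_
    filter_upwards [hu i] with z hz
    rw [diracPotential_mul_apply, hz]
  · intro z hz
    rw [diracPotential_mul_apply, hO i z hz, zero_mul, mul_zero]

lemma scatteringData_apply (hu : ∀ i, u i =ᵐ[volume] rowPotential Q₁₂ Q₂₁ i)
    (μ : ℂ → ℂ → ℂ → Mat2) (lam w : ℂ) (i j : Fin 2) :
    scatteringData (diracPotential Q₁₂ Q₂₁) μ lam w i j =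
      oscInt (u i) lam w (fun z => conj (μ z lam w (i + 1) j)) := by
  rw [scatteringData, Matrix.of_apply, oscInt]
  refine integral_congr_ae ?_
  filter_upwards [hu i] with z hz
  rw [diracPotential_mul_apply, hz]
  rfl

/-- Row `i` of the potential meets row `i + 1` of `μ`. For `i = j` that entry is the off-diagonal
`b`, paired with the first potential of the column; for `i = j + 1` it is the diagonal `a`, paired
with the second. -/
lemma tendstoUniformly_entry {r : ℝ} {μ : ℂ → ℂ → ℂ → Mat2}
    (h : ∀ j, IsSolutionFamily ρ A r (u j) (u (j + 1)) (fun P z => μ z P.1 P.2 j j)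
      (fun P z => μ z P.1 P.2 (j + 1) j)) (i j : Fin 2) :
    (∃ M, IsBddParam r M fun P z => μ z P.1 P.2 (i + 1) j) ∧
    TendstoUniformly (fun (R : ℝ) w => ∫ lam in annulus R, ((‖lam‖⁻¹ : ℝ) : ℂ) *
      oscInt (u i) lam w (fun z => conj (μ z lam w (i + 1) j) - (1 : Mat2) (i + 1) j))
      (fun _ => 0) atTop ∧
    TendstoUniformly (fun (R : ℝ) w => ∫ lam in annulus R, ((‖lam‖⁻¹ : ℝ) : ℂ) *
      oscInt (u i) lam w (fun z => μ z lam w (i + 1) j - (1 : Mat2) (i + 1) j))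
      (fun _ => 0) atTop := by
  rcases fin_two_eq_or i j with rfl | rfl
  · simp only [Matrix.one_apply_ne (fin_two_add_one_ne i), sub_zero]
    exact ⟨(h i).exists_isBddParam_snd, (h i).tendstoUniformly_conj_snd, (h i).tendstoUniformly_snd⟩
  · have e : (1 : Mat2) (j + 1 + 1) j = 1 := by
      rw [fin_two_add_one_add_one, Matrix.one_apply_eq]
    simp only [e, fin_two_add_one_add_one]
    exact ⟨⟨2, (h j).isBddParam_fst⟩, (h j).tendstoUniformly_conj_fst_sub_one,
      (h j).tendstoUniformly_fst_sub_one⟩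

lemma setIntegral_mul_diracPotential (hu : ∀ i, u i =ᵐ[volume] rowPotential Q₁₂ Q₂₁ i)
    (hO : ∀ i z, z ∉ O → rowPotential Q₁₂ Q₂₁ i z = 0) (g : ℂ → ℂ) (i j : Fin 2) :
    ∫ z in O, g z * diracPotential Q₁₂ Q₂₁ z i j =
      ∫ z, g z * (u i z * (1 : Mat2) (i + 1) j) := by
  rw [setIntegral_eq_integral_of_forall_compl_eq_zero]
  · refine integral_congr_ae ?_
    filter_upwards [hu i] with z hz
    rw [diracPotential_apply, hz]
  · intro z hz
    rw [diracPotential_apply, hO i z hz, zero_mul, mul_zero]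

end Matrix

end

/-! ### Assembling the theorem. -/

theorem mainTheorem2 (O : Set ℂ) (hO : IsOpen O) (hOb : Bornology.IsBounded O)
    (Q₁₂ Q₂₁ : ℂ → ℂ)
    (hQ₁₂ : MemLp Q₁₂ ⊤ (volume : Measure ℂ)) (hQ₂₁ : MemLp Q₂₁ ⊤ (volume : Measure ℂ))
    (hs₁₂ : ∀ z, z ∉ O → Q₁₂ z = 0) (hs₂₁ : ∀ z, z ∉ O → Q₂₁ z = 0) :
    ∃ R₀ : ℝ, 0 < R₀ ∧
      -- for large spectral parameter the solution exists and is unique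
      (∀ lam w : ℂ, R₀ < ‖lam‖ →
        ∃! ν : ℂ → Mat2, IsLippmannSchwingerSolution (diracPotential Q₁₂ Q₂₁) lam w ν) ∧
      ∀ μ : ℂ → ℂ → ℂ → Mat2,
        (∀ lam w : ℂ, R₀ < ‖lam‖ →
          IsLippmannSchwingerSolution (diracPotential Q₁₂ Q₂₁) lam w (fun z => μ z lam w)) →
        -- splitting of the scattering data
        (∀ lam w : ℂ, R₀ < ‖lam‖ →
          scatteringData (diracPotential Q₁₂ Q₂₁) μ lam w =
              scatteringOp O (diracPotential Q₁₂ Q₂₁) lam w (fun z => conjMat (μ z lam w)) ∧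
          scatteringData (diracPotential Q₁₂ Q₂₁) μ lam w =
              scatteringOp O (diracPotential Q₁₂ Q₂₁) lam w (fun _ => 1) +
              scatteringOp O (diracPotential Q₁₂ Q₂₁) lam w
                (fun z => conjMat (μ z lam w) - 1)) ∧
        -- the remainder, for `conj μ - I`
        (∀ i j,
          (∀ R : ℝ, R₀ ≤ R → ∀ w ∈ O, IntegrableOn (fun lam : ℂ => ((‖lam‖⁻¹ : ℝ) : ℂ) *
            scatteringOp O (diracPotential Q₁₂ Q₂₁) lam w
              (fun z => conjMat (μ z lam w) - 1) i j) (annulus R)) ∧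
          TendstoUniformlyOn (fun (R : ℝ) (w : ℂ) => ∫ lam in annulus R, ((‖lam‖⁻¹ : ℝ) : ℂ) *
            scatteringOp O (diracPotential Q₁₂ Q₂₁) lam w
              (fun z => conjMat (μ z lam w) - 1) i j) (fun _ => 0) atTop O) ∧
        -- the remainder, for `μ - I`
        (∀ i j,
          (∀ R : ℝ, R₀ ≤ R → ∀ w ∈ O, IntegrableOn (fun lam : ℂ => ((‖lam‖⁻¹ : ℝ) : ℂ) *
            scatteringOp O (diracPotential Q₁₂ Q₂₁) lam w
              (fun z => μ z lam w - 1) i j) (annulus R)) ∧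
          TendstoUniformlyOn (fun (R : ℝ) (w : ℂ) => ∫ lam in annulus R, ((‖lam‖⁻¹ : ℝ) : ℂ) *
            scatteringOp O (diracPotential Q₁₂ Q₂₁) lam w
              (fun z => μ z lam w - 1) i j) (fun _ => 0) atTop O) ∧
        ∀ g : ℂ → ℂ, ContDiff ℝ ∞ g → HasCompactSupport g → tsupport g ⊆ O → ∀ i j,
          -- the main term
          Tendsto (fun R : ℝ => ∫ w in O, g w * ∫ lam in annulus R, ((‖lam‖⁻¹ : ℝ) : ℂ) *
              scatteringOp O (diracPotential Q₁₂ Q₂₁) lam w (fun _ => 1) i j) atTop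
            (𝓝 (((4 * Real.pi ^ 2 * Real.log 2 : ℝ) : ℂ) *
              ∫ z in O, g z * diracPotential Q₁₂ Q₂₁ z i j)) ∧
          -- recovery of the potential from the scattering data
          (∀ R : ℝ, R₀ ≤ R → IntegrableOn (fun lam : ℂ => ((‖lam‖⁻¹ : ℝ) : ℂ) *
            ∫ w : ℂ, g w * scatteringData (diracPotential Q₁₂ Q₂₁) μ lam w i j) (annulus R)) ∧
          Tendsto (fun R : ℝ => ((1 / (4 * Real.pi ^ 2 * Real.log 2) : ℝ) : ℂ) *
              ∫ lam in annulus R, ((‖lam‖⁻¹ : ℝ) : ℂ) *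
                ∫ w : ℂ, g w * scatteringData (diracPotential Q₁₂ Q₂₁) μ lam w i j) atTop
            (𝓝 (∫ z in O, g z * diracPotential Q₁₂ Q₂₁ z i j)) := by
  obtain ⟨ρ, hρ⟩ := hOb.subset_ball (0 : ℂ)
  have hrow : ∀ i z, z ∉ O → rowPotential Q₁₂ Q₂₁ i z = 0 := by
    intro i z hz
    unfold rowPotential
    split_ifs
    exacts [hs₁₂ z hz, hs₂₁ z hz]
  have hmem : ∀ i, MemLp (rowPotential Q₁₂ Q₂₁ i) ⊤ (volume : Measure ℂ) := by
    intro i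
    unfold rowPotential
    split_ifs
    exacts [hQ₁₂, hQ₂₁]
  choose A' u hb' hu using fun i =>
    exists_isBddPotential_ae_eq (hmem i) fun z hz => hrow i z fun h => hz (hρ h)
  set A := max (A' 0) (A' 1)
  have hb : ∀ i, IsBddPotential ρ A (u i) := fun i => (hb' i).mono (by
    fin_cases i
    exacts [le_max_left _ _, le_max_right _ _])
  choose r' hr'0 hr' using fun i => exists_isContractive (hb i)
  -- One threshold must make the iterated operators of both columns contract.
  set r := max (r' 0) (r' 1)
  have hr : 0 < r := (hr'0 0).trans_le (le_max_left _ _)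
  have hrr : ∀ i, r' i ≤ r := fun i => by
    fin_cases i
    exacts [le_max_left _ _, le_max_right _ _]
  have hc : ∀ lam w : ℂ, r < ‖lam‖ → ∀ i, IsContractive ρ A (u i) lam w :=
    fun lam w hl i => hr' i lam w ((hrr i).trans_lt hl)
  refine ⟨r, hr, fun lam w hl => existsUnique_isLippmannSchwingerSolution hb hu (hc lam w hl),
    fun μ hμ => ?_⟩
  have hfam : ∀ j, IsSolutionFamily ρ A r (u j) (u (j + 1)) (fun P z => μ z P.1 P.2 j j)
      (fun P z => μ z P.1 P.2 (j + 1) j) := fun j =>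
    ⟨hr, hb j, hb (j + 1), fun P hP => hc P.1 P.2 hP j,
      fun P hP => (hμ P.1 P.2 hP).isScalarSolution hu j⟩
  have hconj : ∀ (B : Mat2) i j, (conjMat B - 1) i j = conj (B i j) - (1 : Mat2) i j :=
    fun _ _ _ => rfl
  have hsub : ∀ (B : Mat2) i j, (B - 1) i j = B i j - (1 : Mat2) i j := fun _ _ _ => rfl
  refine ⟨fun lam w hl => ⟨?_, ?_⟩, fun i j => ⟨fun R hR w _ => ?_, ?_⟩,
    fun i j => ⟨fun R hR w _ => ?_, ?_⟩, fun g hg hgc hgO i j => ⟨?_, fun R hR => ?_, ?_⟩⟩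
  · ext i j
    rw [scatteringData_apply hu, scatteringOp_apply hu hrow]
    rfl
  · ext i j
    obtain ⟨C, hC⟩ := (hμ lam w hl).bounded
    rw [Matrix.add_apply, scatteringData_apply hu, scatteringOp_apply hu hrow,
      scatteringOp_apply hu hrow]
    simp_rw [hconj]
    rw [oscInt_sub (hb i) lam w (measurable_conj_comp ((hμ lam w hl).measurable _ _))
      measurable_const (norm_conj_le fun z => hC z _ _) (fun _ => le_rfl), add_sub_cancel]
  · obtain ⟨⟨M, hM⟩, -, -⟩ := tendstoUniformly_entry hfam i j
    simp_rw [scatteringOp_apply hu hrow, hconj]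
    exact (hM.comp_conj.sub_const ((1 : Mat2) (i + 1) j)).integrableOn_annulus (hb i) hr hR w
  · simp_rw [scatteringOp_apply hu hrow, hconj]
    exact (tendstoUniformly_entry hfam i j).2.1.tendstoUniformlyOn
  · obtain ⟨⟨M, hM⟩, -, -⟩ := tendstoUniformly_entry hfam i j
    simp_rw [scatteringOp_apply hu hrow, hsub]
    exact (hM.sub_const ((1 : Mat2) (i + 1) j)).integrableOn_annulus (hb i) hr hR w
  · simp_rw [scatteringOp_apply hu hrow, hsub]
    exact (tendstoUniformly_entry hfam i j).2.2.tendstoUniformlyOn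
  · simp_rw [scatteringOp_apply hu hrow]
    rw [setIntegral_mul_diracPotential hu hrow]
    refine (tendsto_integral_mul_oscInt_const (hb i) ((1 : Mat2) (i + 1) j) hg.continuous
      hgc).congr fun R => ?_
    -- The support of `g` lies in `O`, so the integrals over `O` and over the plane agree.
    refine (setIntegral_eq_integral_of_forall_compl_eq_zero fun w hw => ?_).symm
    rw [image_eq_zero_of_notMem_tsupport fun h => hw (hgO h), zero_mul]
  · obtain ⟨⟨M, hM⟩, -, -⟩ := tendstoUniformly_entry hfam i j
    simp_rw [scatteringData_apply hu]
    exact hM.comp_conj.integrableOn_integral (hb i) hr hR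
      (hg.continuous.integrable_of_hasCompactSupport hgc)
  · obtain ⟨⟨M, hM⟩, hlim, -⟩ := tendstoUniformly_entry hfam i j
    simp_rw [scatteringData_apply hu]
    rw [setIntegral_mul_diracPotential hu hrow]
    have key := (hM.comp_conj.tendsto_integral_oscInt (hb i) hr hg.continuous hgc
      (fun P hP => measurable_conj_comp ((hμ P.1 P.2 hP).measurable _ _)) hlim).const_mul
      ((1 / (4 * Real.pi ^ 2 * Real.log 2) : ℝ) : ℂ)
    have hne : (4 * Real.pi ^ 2 * Real.log 2 : ℝ) ≠ 0 := by
      have := Real.log_pos one_lt_two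
      positivity
    rwa [← mul_assoc, ← Complex.ofReal_mul, one_div_mul_cancel hne, Complex.ofReal_one,
      one_mul] at key
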